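/- Let $n\ge 2$ and $d\ge 1$. Let $|\mathcal O(d)|=\mathbb P\big(H^0(\mathbb P^n,\mathcal O(d))\big)$ be the projective space parametrizing hypersurfaces of degree $d$ in the complex projective space $\mathbb P^n$, with homogeneous coordinates $\alpha_I$ indexed by the monomials $x^I$ of degree $d$ in $x_0,\dots,x_n$. Let $$\mathfrak X=\Big\{\textstyle\sum_I\alpha_I x^I=0\Big\}\subseteq \mathbb P^n\times|\mathcal O(d)|$$ be the universal hypersurface, $\pi\colon\mathfrak X\to|\mathcal O(d)|$ the second projection, and $\mathcal L$ the pullback of $\mathcal O(1)$ along the first projection $\mathfrak X\to\mathbb P^n$. For $k\ge 1$ let $V_k=\pi_*(\mathcal L^{\otimes k})$ be the $k$-th Verlinde bundle. For a line $T\cong\mathbb P^1$ in $|\mathcal O(d)|$, the splitting type of $V_k$ on $T$ is the unique non-increasing tuple of integers $(b_1,\dots,b_r)$ such that $V_k|_T\cong\bigoplus_{i=1}^r\mathcal O_{\mathbb P^1}(b_i)$. Let $k=d+1$. Then for every line $T\subseteq|\mathcal O(d)|$ spanned by two linearly independent forms $f_1,f_2$ of degree $d$, the bundle $V_{d+1}|_T$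 has a unique splitting type, and this type is one of $$(\underbrace{1,\dots,1}_{n+1},\underbrace{0,\dots,0}_{r-n-1})\qquad\text{and}\qquad(2,\underbrace{1,\dots,1}_{n-1},\underbrace{0,\dots,0}_{r-n}),$$ where $r=\operatorname{rank}V_{d+1}=\binom{n+d+1}{n}-(n+1)$. That is, no other splitting types of $V_{d+1}$ occur. -/

import Mathlib

open AlgebraicGeometry CategoryTheory

noncomputable section

namespace Verlinde

/-! ### The sheaves `𝒪(m)` on `Proj` -/

section Twist

variable {A σ : Type} [CommRing A] [SetLike σ A] [AddSubgroupClass σ A]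
variable (𝒜 : ℕ → σ) [GradedRing 𝒜]

/-- The localization of `A` at the homogeneous prime `x`. -/
abbrev LocalAt (x : ProjectiveSpectrum 𝒜) : Type :=
  Localization x.asHomogeneousIdeal.toIdeal.primeCompl

variable {𝒜} in
/-- `z` is the fraction `a / b` in the localization at `x` (in particular `b ∉ x`). -/
def IsFraction {x : ProjectiveSpectrum 𝒜} (z : LocalAt 𝒜 x) (a b : A) : Prop :=
  ∃ hb : b ∈ x.asHomogeneousIdeal.toIdeal.primeCompl, z = Localization.mk a ⟨b, hb⟩

section IsFraction

variable {𝒜} {x : ProjectiveSpectrum 𝒜} {z z' : LocalAt 𝒜 x} {a b a' b' : A}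

lemma IsFraction.add (h : IsFraction z a b) (h' : IsFraction z' a' b') :
    IsFraction (z + z') (b * a' + b' * a) (b * b') := by
  obtain ⟨h1, rfl⟩ := h
  obtain ⟨h2, rfl⟩ := h'
  exact ⟨mul_mem h1 h2, Localization.add_mk _ _ _ _⟩

lemma IsFraction.mul (h : IsFraction z a b) (h' : IsFraction z' a' b') :
    IsFraction (z * z') (a * a') (b * b') := by
  obtain ⟨h1, rfl⟩ := h
  obtain ⟨h2, rfl⟩ := h'
  exact ⟨mul_mem h1 h2, Localization.mk_mul _ _ _ _⟩

lemma IsFraction.neg (h : IsFraction z a b) : IsFraction (-z) (-a) b := by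
  obtain ⟨h1, rfl⟩ := h
  exact ⟨h1, Localization.neg_mk _ _⟩

lemma isFraction_zero_pow (hb : b ∉ x.asHomogeneousIdeal) (k : ℕ) :
    IsFraction (0 : LocalAt 𝒜 x) 0 (b ^ k) :=
  ⟨pow_mem (S := x.asHomogeneousIdeal.toIdeal.primeCompl) hb k, (Localization.mk_zero _).symm⟩

end IsFraction

/-- A function `x ↦ s x ∈ A_x` which on all of `U` is one fraction `a / b` of homogeneous
elements with `deg a - deg b = m`. -/
def twistPrelocal (m : ℤ) :
    TopCat.PrelocalPredicate (X := ProjectiveSpectrum.top 𝒜) (fun x ↦ LocalAt 𝒜 x) where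
  pred {U} s := ∃ (i j : ℕ) (a b : A), a ∈ 𝒜 i ∧ b ∈ 𝒜 j ∧ (i : ℤ) = j + m ∧
    ∀ x : U, IsFraction (s x) a b
  res := by
    rintro V U f s ⟨i, j, a, b, ha, hb, hij, h⟩
    exact ⟨i, j, a, b, ha, hb, hij, fun x ↦ h (f x)⟩

/-- A function which is locally a fraction of homogeneous elements of degree difference `m`. -/
def twistLocal (m : ℤ) :
    TopCat.LocalPredicate (X := ProjectiveSpectrum.top 𝒜) (fun x ↦ LocalAt 𝒜 x) :=
  (twistPrelocal 𝒜 m).sheafify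

lemma twistLocal_add (m : ℤ) {U : (Proj 𝒜).Opens} {s t : ∀ x : U, LocalAt 𝒜 x.1}
    (hs : (twistLocal 𝒜 m).pred s) (ht : (twistLocal 𝒜 m).pred t) :
    (twistLocal 𝒜 m).pred (s + t) := by
  refine TopCat.PrelocalPredicate.sheafify_inductionOn₂' _ _ _ (fun a b ↦ a + b) ?_ hs ht
  rintro U V s t ⟨i, j, a, b, ha, hb, hij, h⟩ ⟨i', j', a', b', ha', hb', hij', h'⟩
  refine ⟨j + i', j + j', b * a' + b' * a, b * b', add_mem (SetLike.mul_mem_graded hb ha') ?_,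
    SetLike.mul_mem_graded hb hb', by push_cast; omega, fun x ↦ ?_⟩
  · rw [show j + i' = j' + i by omega]
    exact SetLike.mul_mem_graded hb' ha
  · exact (h ⟨x.1, x.2.1⟩).add (h' ⟨x.1, x.2.2⟩)

lemma twistLocal_smul (m : ℤ) {U : (Proj 𝒜).Opens} (r : Γ(Proj 𝒜, U))
    {s : ∀ x : U, LocalAt 𝒜 x.1} (hs : (twistLocal 𝒜 m).pred s) :
    (twistLocal 𝒜 m).pred (fun x : U ↦ (r.1 x).val * s x) := by
  intro x
  obtain ⟨V, hxV, iV, k, ⟨c, hc⟩, ⟨e, he⟩, hne, hr⟩ := r.2 x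
  obtain ⟨W, hxW, iW, i, j, a, b, ha, hb, hij, h⟩ := hs x
  refine ⟨V ⊓ W, ⟨hxV, hxW⟩, TopologicalSpace.Opens.infLELeft _ _ ≫ iV, k + i, k + j, c * a, e * b,
    SetLike.mul_mem_graded hc ha, SetLike.mul_mem_graded he hb, by push_cast; omega, fun y ↦ ?_⟩
  have h1 : IsFraction (r.1 (iV ⟨y.1, y.2.1⟩)).val c e :=
    ⟨hne ⟨y.1, y.2.1⟩, congrArg HomogeneousLocalization.val (hr ⟨y.1, y.2.1⟩)⟩
  exact h1.mul (h ⟨y.1, y.2.2⟩)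

lemma twistLocal_zero (m : ℤ) {U : (Proj 𝒜).Opens} :
    (twistLocal 𝒜 m).pred (0 : ∀ x : U, LocalAt 𝒜 x.1) := by
  intro x
  have hx := ProjectiveSpectrum.not_irrelevant_le (𝒜 := 𝒜) x.1
  rw [HomogeneousIdeal.irrelevant_le] at hx
  push Not at hx
  obtain ⟨e, he, hle⟩ := hx
  obtain ⟨b, hb, hbx⟩ := Set.not_subset.1 hle
  refine ⟨U ⊓ Proj.basicOpen 𝒜 b, ⟨x.2, hbx⟩, TopologicalSpace.Opens.infLELeft _ _,
    (m.natAbs * e + m).toNat, m.natAbs * e, 0, b ^ m.natAbs, zero_mem _,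
    SetLike.pow_mem_graded (A := 𝒜) m.natAbs (show b ∈ 𝒜 e from hb), ?_, fun y ↦ ?_⟩
  · have h1 : (m.natAbs : ℤ) * 1 ≤ m.natAbs * e := by gcongr; exact_mod_cast he
    rw [Int.toNat_of_nonneg (by omega)]
    push_cast
    rfl
  · exact isFraction_zero_pow y.2.2 _

/-- Sections of `𝒪(m)` over `U`. -/
def twistSections (m : ℤ) (U : (Proj 𝒜).Opens) : AddSubgroup (∀ x : U, LocalAt 𝒜 x.1) where
  carrier := {s | (twistLocal 𝒜 m).pred s}
  zero_mem' := twistLocal_zero 𝒜 m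
  add_mem' hs ht := twistLocal_add 𝒜 m hs ht
  neg_mem' := by
    intro s hs x
    obtain ⟨V, hxV, iV, i, j, a, b, ha, hb, hij, h⟩ := hs x
    refine ⟨V, hxV, iV, i, j, -a, b, neg_mem ha, hb, hij, fun y ↦ (h y).neg⟩

instance twistModule (m : ℤ) (U : (Proj 𝒜).Opens) :
    Module Γ(Proj 𝒜, U) (twistSections 𝒜 m U) where
  smul r s := ⟨fun x ↦ (r.1 x).val * s.1 x, twistLocal_smul 𝒜 m r s.2⟩
  one_smul s := Subtype.ext <| funext fun x ↦
    (congrArg (· * s.1 x) HomogeneousLocalization.val_one).trans (one_mul _)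
  mul_smul _ _ s := Subtype.ext <| funext fun x ↦
    (congrArg (· * s.1 x) (HomogeneousLocalization.val_mul _ _)).trans (mul_assoc _ _ _)
  smul_zero _ := Subtype.ext <| funext fun _ ↦ mul_zero _
  smul_add _ _ _ := Subtype.ext <| funext fun _ ↦ mul_add _ _ _
  add_smul _ _ s := Subtype.ext <| funext fun x ↦
    (congrArg (· * s.1 x) (HomogeneousLocalization.val_add _ _)).trans (add_mul _ _ _)
  zero_smul s := Subtype.ext <| funext fun x ↦
    (congrArg (· * s.1 x) HomogeneousLocalization.val_zero).trans (zero_mul _)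

/-- The underlying presheaf of abelian groups of `𝒪(m)`. -/
def twistPresheaf (m : ℤ) : TopCat.Presheaf Ab (Proj 𝒜) where
  obj U := AddCommGrpCat.of (twistSections 𝒜 m U.unop)
  map i := AddCommGrpCat.ofHom
    { toFun s := ⟨fun x ↦ s.1 (i.unop x), (twistLocal 𝒜 m).res i.unop s.1 s.2⟩
      map_zero' := rfl
      map_add' _ _ := rfl }

/-- Serre's twisting sheaf `𝒪(m)` on `Proj 𝒜`. -/
def twist (m : ℤ) : (Proj 𝒜).Modules where
  val :=
    letI (U : ((Proj 𝒜).Opens)ᵒᵖ) :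
        Module ((Proj 𝒜).ringCatSheaf.obj.obj U) ((twistPresheaf 𝒜 m).obj U) :=
      inferInstanceAs (Module Γ(Proj 𝒜, U.unop) (twistSections 𝒜 m U.unop))
    PresheafOfModules.ofPresheaf (twistPresheaf 𝒜 m) fun _ _ _ _ _ ↦ rfl
  isSheaf := (TopCat.Presheaf.isSheaf_iff_isSheaf_comp (forget AddCommGrpCat) _).2
    (TopCat.subsheafToTypes (twistLocal 𝒜 m)).2

end Twist

/-! ### Projective spaces, the linear system `|𝒪(d)|` and the universal hypersurface -/

open MvPolynomial Limits

attribute [local instance] MvPolynomial.gradedAlgebra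

/-- The projective space over `ℂ` with homogeneous coordinates indexed by `σ`. -/
abbrev projSpace (σ : Type) : Scheme := Proj (homogeneousSubmodule σ ℂ)

/-- The structure morphism of projective space. -/
def projSpaceToSpec (σ : Type) : projSpace σ ⟶ Spec (CommRingCat.of ℂ) :=
  Proj.toSpecZero (homogeneousSubmodule σ ℂ) ≫
    Spec.map (CommRingCat.ofHom (algebraMap ℂ (homogeneousSubmodule σ ℂ 0)))

/-- The standard open subset of projective space on which the coordinate `X i` is invertible. -/
abbrev stdOpen {σ : Type} (i : σ) : (projSpace σ).Opens :=
  Proj.basicOpen (homogeneousSubmodule σ ℂ) (X i)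

/-- For a homogeneous polynomial `p` of degree `m`, the regular function `p / (X i) ^ m` on the
standard open subset of `X i`. -/
def stdFraction {σ : Type} (i : σ) (m : ℕ) (p : homogeneousSubmodule σ ℂ m) :
    Γ(projSpace σ, stdOpen i) :=
  (Proj.awayToSection (homogeneousSubmodule σ ℂ) (X i)).hom
    (HomogeneousLocalization.Away.mk (homogeneousSubmodule σ ℂ) (isHomogeneous_X ℂ i) m p.1
      (by simp))

/-- Exponents of the monomials of degree `d` in `x_0, …, x_n`. -/
abbrev MonomialIndex (n d : ℕ) : Type :=
  Finset.finsuppAntidiag (Finset.univ : Finset (Fin (n + 1))) d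

lemma degree_monomialIndex {n d : ℕ} (I : MonomialIndex n d) : I.1.degree = d := by
  rw [Finsupp.degree_eq_sum]
  exact (Finset.mem_finsuppAntidiag.1 I.2).1

/-- The monomial `x ^ I` as a form of degree `d`. -/
def monomialForm {n d : ℕ} (I : MonomialIndex n d) : homogeneousSubmodule (Fin (n + 1)) ℂ d :=
  ⟨monomial I.1 1, isHomogeneous_monomial 1 (degree_monomialIndex I)⟩

/-- The linear system `|𝒪(d)|` of hypersurfaces of degree `d` in `ℙⁿ`: the projective space whose
homogeneous coordinates `α_I` are the coefficients of a form `∑ α_I x ^ I` of degree `d`. -/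
abbrev linearSystem (n d : ℕ) : Scheme := projSpace (MonomialIndex n d)

/-- `ℙⁿ × |𝒪(d)|` -/
abbrev ambient (n d : ℕ) : Scheme :=
  pullback (projSpaceToSpec (Fin (n + 1))) (projSpaceToSpec (MonomialIndex n d))

/-- The first projection `ℙⁿ × |𝒪(d)| → ℙⁿ`. -/
abbrev ambientFst (n d : ℕ) : ambient n d ⟶ projSpace (Fin (n + 1)) := pullback.fst _ _

/-- The second projection `ℙⁿ × |𝒪(d)| → |𝒪(d)|`. -/
abbrev ambientSnd (n d : ℕ) : ambient n d ⟶ linearSystem n d := pullback.snd _ _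

/-- The standard affine chart `{x_i ≠ 0} × {α_J ≠ 0}` of `ℙⁿ × |𝒪(d)|`. -/
def chart {n d : ℕ} (i : Fin (n + 1)) (J : MonomialIndex n d) : (ambient n d).Opens :=
  (ambientFst n d ⁻¹ᵁ stdOpen i) ⊓ (ambientSnd n d ⁻¹ᵁ stdOpen J)

/-- The equation `∑ (α_I / α_J) (x ^ I / x_i ^ d)` of the universal hypersurface
`∑ α_I x ^ I = 0` on a standard chart. -/
def chartEquation {n d : ℕ} (i : Fin (n + 1)) (J : MonomialIndex n d) :
    Γ(ambient n d, chart i J) :=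
  ∑ I : MonomialIndex n d,
    ((ambientSnd n d).appLE (stdOpen J) (chart i J) inf_le_right).hom
        (stdFraction J 1 ⟨X I, isHomogeneous_X ℂ I⟩) *
      ((ambientFst n d).appLE (stdOpen i) (chart i J) inf_le_left).hom
        (stdFraction i d (monomialForm I))

/-- The ideal sheaf of the universal hypersurface `∑ α_I x ^ I = 0` in `ℙⁿ × |𝒪(d)|`: its sections
over an affine open `U` are the functions whose restriction to each `U ∩ {x_i ≠ 0, α_J ≠ 0}` is a
multiple of the equation on that chart. (These ideals are quasi-coherent; `ofIdeals` packages them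
as the largest ideal sheaf contained in them.) -/
def universalIdeal (n d : ℕ) : (ambient n d).IdealSheafData :=
  Scheme.IdealSheafData.ofIdeals fun U ↦ ⨅ (i : Fin (n + 1)) (J : MonomialIndex n d),
    (Ideal.span {(ambient n d).presheaf.map
        (homOfLE inf_le_right : U.1 ⊓ chart i J ⟶ chart i J).op (chartEquation i J)}).comap
      ((ambient n d).presheaf.map (homOfLE inf_le_left : U.1 ⊓ chart i J ⟶ U.1).op).hom

/-- The total space `𝔛 ⊆ ℙⁿ × |𝒪(d)|` of the universal family. -/
abbrev universalFamily (n d : ℕ) : Scheme := (universalIdeal n d).subscheme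

/-- The universal family `π : 𝔛 → |𝒪(d)|`. -/
def universalMap (n d : ℕ) : universalFamily n d ⟶ linearSystem n d :=
  (universalIdeal n d).subschemeι ≫ ambientSnd n d

/-- The projection `𝔛 → ℙⁿ`. -/
def universalToSpace (n d : ℕ) : universalFamily n d ⟶ projSpace (Fin (n + 1)) :=
  (universalIdeal n d).subschemeι ≫ ambientFst n d

/-- The power `ℒ^k` of the polarization `ℒ`, where `ℒ` is the pullback of `𝒪(1)` along `𝔛 → ℙⁿ`:
the pullback of `𝒪(k) = 𝒪(1)^k`. -/
def polarizationPow (n d : ℕ) (k : ℤ) : (universalFamily n d).Modules :=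
  (Scheme.Modules.pullback (universalToSpace n d)).obj
    (twist (homogeneousSubmodule (Fin (n + 1)) ℂ) k)

/-- The Verlinde bundle `V_k = π_* ℒ^k` on `|𝒪(d)|`. -/
def verlindeBundle (n d : ℕ) (k : ℤ) : (linearSystem n d).Modules :=
  (Scheme.Modules.pushforward (universalMap n d)).obj (polarizationPow n d k)

/-! ### Lines in `|𝒪(d)|` and splitting types -/

/-- The homomorphism of graded rings `ℂ[α_I] → ℂ[s, t]`, `α_I ↦ s a_I + t b_I`, where `a_I` and
`b_I` are the coefficients of the two forms `f 0` and `f 1`. -/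
def lineHom {n d : ℕ} (f : Fin 2 → homogeneousSubmodule (Fin (n + 1)) ℂ d) :
    homogeneousSubmodule (MonomialIndex n d) ℂ →+*ᵍ homogeneousSubmodule (Fin 2) ℂ where
  toRingHom := (aeval fun I : MonomialIndex n d ↦ ∑ j, C (coeff I.1 (f j).1) * X j).toRingHom
  map_mem := by
    intro i p hp
    have h := IsHomogeneous.aeval (m := i) (n := 1) (φ := p) hp
      (fun I : MonomialIndex n d ↦ ∑ j, C (coeff I.1 (f j).1) * (X j : MvPolynomial (Fin 2) ℂ))
      (fun I ↦ IsHomogeneous.sum _ _ _ fun j _ ↦ by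
        simpa using (isHomogeneous_C (Fin 2) (coeff I.1 (f j).1)).mul (isHomogeneous_X ℂ j))
    simpa using h

lemma form_eq_sum {n d : ℕ} (p : homogeneousSubmodule (Fin (n + 1)) ℂ d) :
    p = ∑ I : MonomialIndex n d, coeff I.1 p.1 • monomialForm I := by
  apply Subtype.ext
  ext m
  simp only [monomialForm, AddSubmonoidClass.coe_finsetSum, Submodule.coe_smul, coeff_sum,
    coeff_smul, coeff_monomial, smul_eq_mul, mul_ite, mul_one, mul_zero]
  by_cases hm : m ∈ Finset.finsuppAntidiag (Finset.univ : Finset (Fin (n + 1))) d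
  · rw [Finset.sum_eq_single ⟨m, hm⟩]
    · simp
    · rintro J - hJ
      exact if_neg fun h ↦ hJ (Subtype.ext h)
    · simp
  · rw [Finset.sum_eq_zero]
    · by_contra h
      refine hm (Finset.mem_finsuppAntidiag.2 ⟨?_, Finset.subset_univ _⟩)
      have h2 : m.degree = d := by
        rw [Finsupp.degree_eq_weight_one]
        exact p.2 fun h0 ↦ h h0
      rwa [Finsupp.degree_eq_sum] at h2
    · rintro J -
      refine if_neg fun h ↦ hm ?_
      rw [← h]
      exact J.2

lemma lineHom_irrelevant {n d : ℕ} (f : Fin 2 → homogeneousSubmodule (Fin (n + 1)) ℂ d)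
    (hf : LinearIndependent ℂ f) :
    HomogeneousIdeal.irrelevant (homogeneousSubmodule (Fin 2) ℂ) ≤
      (HomogeneousIdeal.irrelevant (homogeneousSubmodule (MonomialIndex n d) ℂ)).map
        (lineHom f) := by
  have hI (I : MonomialIndex n d) : ∑ j, C (coeff I.1 (f j).1) * (X j : MvPolynomial (Fin 2) ℂ) ∈
      ((HomogeneousIdeal.irrelevant (homogeneousSubmodule (MonomialIndex n d) ℂ)).map
        (lineHom f)).toIdeal := by
    have h1 : (X I : MvPolynomial (MonomialIndex n d) ℂ) ∈
        HomogeneousIdeal.irrelevant (homogeneousSubmodule (MonomialIndex n d) ℂ) :=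
      HomogeneousIdeal.mem_irrelevant_of_mem _ one_pos (isHomogeneous_X ℂ I)
    have h2 : lineHom f (X I) = ∑ j, C (coeff I.1 (f j).1) * (X j : MvPolynomial (Fin 2) ℂ) :=
      aeval_X _ I
    rw [← h2]
    exact Ideal.mem_map_of_mem _ h1
  obtain ⟨g, hg⟩ := LinearMap.exists_leftInverse_of_injective (Fintype.linearCombination ℂ f)
    (LinearMap.ker_eq_bot.2 hf.fintypeLinearCombination_injective)
  have hgf (k : Fin 2) : g (f k) = Pi.single k 1 := by
    simpa using LinearMap.congr_fun hg (Pi.single k 1)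
  have hX (j : Fin 2) : (X j : MvPolynomial (Fin 2) ℂ) ∈
      ((HomogeneousIdeal.irrelevant (homogeneousSubmodule (MonomialIndex n d) ℂ)).map
        (lineHom f)).toIdeal := by
    have h : (X j : MvPolynomial (Fin 2) ℂ) = ∑ I : MonomialIndex n d,
        C (g (monomialForm I) j) * ∑ k, C (coeff I.1 (f k).1) * X k := by
      have hk (k : Fin 2) : ∑ I : MonomialIndex n d,
          g (monomialForm I) j * coeff I.1 (f k).1 = if k = j then 1 else 0 := by
        have := congrArg (fun p ↦ g p j) (form_eq_sum (f k))
        simp only [hgf, map_sum, map_smul, Finset.sum_apply, Pi.smul_apply, smul_eq_mul] at this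
        rw [Pi.single_apply] at this
        simp only [mul_comm (g _ _), ← this, eq_comm]
      simp only [Finset.mul_sum]
      rw [Finset.sum_comm]
      simp only [← mul_assoc, ← C_mul, ← Finset.sum_mul, ← map_sum, hk]
      simp [ite_mul]
    rw [h]
    exact Ideal.sum_mem _ fun I _ ↦ Ideal.mul_mem_left _ _ (hI I)
  rw [HomogeneousIdeal.irrelevant_le]
  intro i hi p hp
  have hp' : p ∈ Ideal.span (X '' (Set.univ : Set (Fin 2)) : Set (MvPolynomial (Fin 2) ℂ)) := by
    rw [mem_ideal_span_X_image]
    intro m hm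
    by_contra! h
    have h0 : m = 0 := Finsupp.ext fun j ↦ h j trivial
    have h2 := (mem_homogeneousSubmodule i p).1 hp (mem_support_iff.1 hm)
    rw [h0, map_zero] at h2
    omega
  refine (Ideal.span_le.2 ?_ : _ ≤ ((HomogeneousIdeal.irrelevant
    (homogeneousSubmodule (MonomialIndex n d) ℂ)).map (lineHom f)).toIdeal) hp'
  rintro _ ⟨j, -, rfl⟩
  exact hX j

/-- The line `ℙ¹ → |𝒪(d)|`, `(s : t) ↦ s f 0 + t f 1`, spanned by two linearly independent
forms. -/
def lineMap {n d : ℕ} (f : Fin 2 → homogeneousSubmodule (Fin (n + 1)) ℂ d)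
    (hf : LinearIndependent ℂ f) : projSpace (Fin 2) ⟶ linearSystem n d :=
  Proj.map (lineHom f) (lineHom_irrelevant f hf)

/-- The restriction `V_{k,T}` of the Verlinde bundle to the line `T = ℙ¹` spanned by `f 0`, `f 1`. -/
def verlindeOnLine {n d : ℕ} (k : ℤ) (f : Fin 2 → homogeneousSubmodule (Fin (n + 1)) ℂ d)
    (hf : LinearIndependent ℂ f) : (projSpace (Fin 2)).Modules :=
  (Scheme.Modules.pullback (lineMap f hf)).obj (verlindeBundle n d k)

/-- The non-increasing tuple `b` is a splitting type of the sheaf `E` on `ℙ¹`: `E ≅ ⨁ 𝒪(b_i)`. -/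
def IsSplittingType (E : (projSpace (Fin 2)).Modules) (b : List ℤ) : Prop :=
  b.Pairwise (· ≥ ·) ∧
    Nonempty (E ≅ ∐ fun i : Fin b.length ↦ twist (homogeneousSubmodule (Fin 2) ℂ) (b.get i))

end Verlinde

end

/-! Over a small affine open `U` of the linear system, let F = ∑ (α_I/α_J) x^I be the universal
form. The sections of V_k over `U` are the forms of degree k in x_0, …, x_n with coefficients in the
functions on `U`, modulo multiples of F (`exists_form_of_section`, `sum_smul_eq_zero_iff`). Lifting
a section to a form is the vanishing of H¹(ℙⁿ, 𝒪(k-d)) in elementary terms: since n ≥ 2, F lies in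
no ideal (x_i, x_j), so numerators that agree modulo F on overlaps come from one form
(`exists_form_of_compatible`).

For k = d+1 the cofactor of F is linear, so the relations are generated by F·x_0, …, F·x_n. Pulled
back to the line with coordinates (s : t), F becomes s f_0 + t f_1 up to a denominator. Hence
V_{d+1} on the line is the cokernel of the pencil s A + t B : L → W, where L and W are the forms of
degrees 1 and d+1, and A, B are multiplication by f_0, f_1. This is stated as a universal property
(`isUniversalPencilMap_lineSec`), which suits pullbacks because they are handled through their
adjunction with pushforward.

Kronecker's normal form finishes the computation. A block with m generators and m+1 basis vectors
w_0, …, w_m subject to s w_j + t w_{j+1} = 0 has cokernel 𝒪(m), by w_j ↦ (-1)^j s^j t^{m-j}. If f_0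
p + f_1 q = 0 has no nonzero solution in linear forms, every element of a basis of L gives a block
with m = 1. Otherwise p and q are independent, and since p is prime the solution is unique up to
scalar. The chain A(-q), B(-q) = A(p), B(p) is then one block with m = 2, and the n - 1 remaining
basis elements give blocks with m = 1 (`exists_kroneckerBasis_mulForm`). The rest of W contributes
trivial summands.

Uniqueness of the splitting type follows from Hom(𝒪(a), 𝒪(b)) = 0 for b < a: an isomorphism of two
sums restricts to an injective matrix between the summands of degree at least t, so their numbers
agree for every t (`card_le_of_iso`). -/

noncomputable section

namespace Verlinde

open TopologicalSpace

/-! ### Sections, gluing and construction of morphisms of modules -/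

section Modules

variable {X Y : Scheme.{0}}

/-- Restriction of functions to a smaller open subset. -/
abbrev rres {U V : X.Opens} (h : V ≤ U) : Γ(X, U) →+* Γ(X, V) :=
  (X.presheaf.map (homOfLE h).op).hom

/-- Restriction of sections of a module to a smaller open subset. -/
def mres (M : X.Modules) {U V : X.Opens} (h : V ≤ U) : Γ(M, U) →+ Γ(M, V) :=
  (M.presheaf.map (homOfLE h).op).hom

variable {M N : X.Modules} {U V W : X.Opens}

@[simp] lemma rres_self (r : Γ(X, U)) : rres le_rfl r = r :=
  congr($(X.presheaf.map_id (.op U)) r)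

@[simp] lemma rres_rres (h : V ≤ U) (h' : W ≤ V) (r : Γ(X, U)) :
    rres h' (rres h r) = rres (h'.trans h) r :=
  congr($((X.presheaf.map_comp (homOfLE h).op (homOfLE h').op).symm) r)

@[simp] lemma mres_self (s : Γ(M, U)) : mres M le_rfl s = s :=
  congr($(M.presheaf.map_id (.op U)) s)

@[simp] lemma mres_mres (h : V ≤ U) (h' : W ≤ V) (s : Γ(M, U)) :
    mres M h' (mres M h s) = mres M (h'.trans h) s :=
  congr($((M.presheaf.map_comp (homOfLE h).op (homOfLE h').op).symm) s)

@[simp] lemma mres_smul (h : V ≤ U) (r : Γ(X, U)) (s : Γ(M, U)) :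
    mres M h (r • s) = rres h r • mres M h s :=
  M.map_smul (homOfLE h) r s

/-- The map induced on sections by a morphism of modules. -/
def secMap (φ : M ⟶ N) (U : X.Opens) : Γ(M, U) →ₗ[Γ(X, U)] Γ(N, U) where
  toFun s := φ.app U s
  map_add' := map_add _
  map_smul' r s := φ.app_smul r s

@[simp] lemma secMap_mres (φ : M ⟶ N) (h : V ≤ U) (s : Γ(M, U)) :
    secMap φ V (mres M h s) = mres N h (secMap φ U s) :=
  congr($(φ.mapPresheaf.naturality (homOfLE h).op) s)

@[simp] lemma secMap_id (s : Γ(M, U)) : secMap (𝟙 M) U s = s := rfl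

@[simp] lemma secMap_comp {K : X.Modules} (φ : M ⟶ N) (ψ : N ⟶ K) (s : Γ(M, U)) :
    secMap (φ ≫ ψ) U s = secMap ψ U (secMap φ U s) := rfl

lemma hom_ext_sec {φ ψ : M ⟶ N} (h : ∀ U (s : Γ(M, U)), secMap φ U s = secMap ψ U s) : φ = ψ := by
  ext U s
  exact h U s

lemma sec_ext {s t : Γ(M, U)} (h : ∀ x ∈ U, ∃ V, ∃ hV : V ≤ U, x ∈ V ∧ mres M hV s = mres M hV t) :
    s = t := by
  choose V hV hx e using h
  refine TopCat.Sheaf.eq_of_locally_eq' ⟨M.presheaf, M.isSheaf⟩ (fun x : U ↦ V x.1 x.2) U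
    (fun x ↦ homOfLE (hV x.1 x.2)) (fun x hx' ↦ ?_) s t fun x ↦ e x.1 x.2
  exact Opens.mem_iSup.2 ⟨⟨x, hx'⟩, hx x hx'⟩

lemma sec_glue {ι : Type} (V : ι → X.Opens) (hV : ∀ i, V i ≤ U) (hU : U ≤ ⨆ i, V i)
    (s : ∀ i, Γ(M, V i))
    (hs : ∀ i j, mres M (inf_le_left : V i ⊓ V j ≤ V i) (s i) = mres M inf_le_right (s j)) :
    ∃ t : Γ(M, U), ∀ i, mres M (hV i) t = s i := by
  obtain ⟨t, ht, -⟩ := TopCat.Sheaf.existsUnique_gluing' ⟨M.presheaf, M.isSheaf⟩ V U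
    (fun i ↦ homOfLE (hV i)) hU s hs
  exact ⟨t, ht⟩

/-- A morphism of modules from a compatible family of linear maps on sections. -/
def homOfSecMap (f : ∀ U, Γ(M, U) →ₗ[Γ(X, U)] Γ(N, U))
    (hf : ∀ (U V : X.Opens) (h : V ≤ U) (s : Γ(M, U)), f V (mres M h s) = mres N h (f U s)) :
    M ⟶ N :=
  ⟨PresheafOfModules.homMk (M₁ := M.val) (M₂ := N.val)
    { app U := AddCommGrpCat.ofHom (f U.unop).toAddMonoidHom
      naturality := by
        intro U V i
        ext s
        exact hf U.unop V.unop (leOfHom i.unop) s }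
    (fun U r s ↦ (f U.unop).map_smul r s)⟩

/-- A locally total, functional, linear relation between the sections of two modules is the graph
of a morphism. -/
theorem exists_hom_of_relation (R : ∀ U : X.Opens, Γ(M, U) → Γ(N, U) → Prop)
    (res : ∀ {U V : X.Opens} (h : V ≤ U) {s t}, R U s t → R V (mres M h s) (mres N h t))
    (add : ∀ {U : X.Opens} {s t s' t'}, R U s t → R U s' t' → R U (s + s') (t + t'))
    (smul : ∀ {U : X.Opens} (r : Γ(X, U)) {s t}, R U s t → R U (r • s) (r • t))
    (func : ∀ {U : X.Opens} {t}, R U 0 t → t = 0)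
    (total : ∀ {U : X.Opens} (s : Γ(M, U)), ∀ x ∈ U, ∃ V, ∃ h : V ≤ U, x ∈ V ∧
      ∃ t, R V (mres M h s) t) :
    ∃ φ : M ⟶ N, ∀ (U : X.Opens) (s t), R U s t → secMap φ U s = t := by
  have uniq {U : X.Opens} {s t t'} (h : R U s t) (h' : R U s t') : t = t' := by
    have := add h (smul (-1) h')
    rw [neg_one_smul, neg_one_smul, add_neg_cancel] at this
    exact add_neg_eq_zero.1 (func this)
  -- `R` is only locally total. Its sheafification `P` is still functional, and it is total because
  -- local values of `t` agree on overlaps and glue.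
  let P (U : X.Opens) (s : Γ(M, U)) (t : Γ(N, U)) : Prop :=
    ∀ x ∈ U, ∃ V, ∃ h : V ≤ U, x ∈ V ∧ R V (mres M h s) (mres N h t)
  have Puniq {U : X.Opens} {s t t'} (h : P U s t) (h' : P U s t') : t = t' := by
    refine sec_ext fun x hx ↦ ?_
    obtain ⟨V, hV, hxV, h1⟩ := h x hx
    obtain ⟨W, hW, hxW, h2⟩ := h' x hx
    refine ⟨V ⊓ W, inf_le_left.trans hV, ⟨hxV, hxW⟩, ?_⟩
    have h3 := res (inf_le_left : V ⊓ W ≤ V) h1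
    have h4 := res (inf_le_right : V ⊓ W ≤ W) h2
    rw [mres_mres, mres_mres] at h3 h4
    exact uniq h3 h4
  have Pex {U : X.Opens} (s : Γ(M, U)) : ∃ t, P U s t := by
    choose V hV hx t ht using fun x : U ↦ total s x.1 x.2
    obtain ⟨t', ht'⟩ := sec_glue (M := N) V hV
      (fun x hx' ↦ Opens.mem_iSup.2 ⟨⟨x, hx'⟩, hx ⟨x, hx'⟩⟩) t (by
        intro i j
        have h3 := res (inf_le_left : V i ⊓ V j ≤ V i) (ht i)
        have h4 := res (inf_le_right : V i ⊓ V j ≤ V j) (ht j)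
        rw [mres_mres] at h3 h4
        exact uniq h3 h4)
    refine ⟨t', fun x hx' ↦ ⟨V ⟨x, hx'⟩, hV _, hx _, ?_⟩⟩
    rw [ht']
    exact ht _
  choose f hf using @Pex
  refine ⟨homOfSecMap (fun U ↦
    { toFun := f
      map_add' := fun s s' ↦ Puniq (hf _) fun x hx ↦ ?_
      map_smul' := fun r s ↦ Puniq (hf _) fun x hx ↦ ?_ }) fun U V h s ↦ Puniq (hf _) fun x hx ↦ ?_,
    fun U s t h ↦ Puniq (hf s) fun x hx ↦ ⟨U, le_rfl, hx, res le_rfl h⟩⟩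
  · obtain ⟨V, hV, hxV, h1⟩ := hf s x hx
    obtain ⟨W, hW, hxW, h2⟩ := hf s' x hx
    refine ⟨V ⊓ W, inf_le_left.trans hV, ⟨hxV, hxW⟩, ?_⟩
    have h3 := res (inf_le_left : V ⊓ W ≤ V) h1
    have h4 := res (inf_le_right : V ⊓ W ≤ W) h2
    rw [mres_mres, mres_mres] at h3 h4
    rw [map_add, map_add]
    exact add h3 h4
  · obtain ⟨V, hV, hxV, h1⟩ := hf s x hx
    refine ⟨V, hV, hxV, ?_⟩
    rw [RingHom.id_apply, mres_smul, mres_smul]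
    exact smul _ h1
  · obtain ⟨W, hW, hxW, h1⟩ := hf s x (h hx)
    refine ⟨W ⊓ V, inf_le_right, ⟨hxW, hx⟩, ?_⟩
    have h3 := res (inf_le_left : W ⊓ V ≤ W) h1
    rw [mres_mres] at h3
    change R _ (mres M _ (mres M h s)) (mres N _ (mres N h _))
    rw [mres_mres]
    rwa [mres_mres] at h3 ⊢

end Modules

/-! ### Local generators, extension from an open subset, and pullback -/

section Generators

variable {X Y : Scheme.{0}} {M N : X.Modules} {U V W : X.Opens}

lemma mres_bijective_of_le (h : V ≤ U) (h' : U ≤ V) : Function.Bijective (mres M h) := by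
  obtain rfl := le_antisymm h h'
  convert Function.bijective_id
  ext r
  exact mres_self r

/-- The section `e` of `M` over `U` generates `M` freely on `U`. -/
def IsGen (e : Γ(M, U)) : Prop :=
  ∀ V, ∀ h : V ≤ U, Function.Bijective fun r : Γ(X, V) ↦ r • mres M h e

/-- The sections of `M` over any open subset are those over its intersection with `U`. -/
def IsExtended (M : X.Modules) (U : X.Opens) : Prop :=
  ∀ V : X.Opens, Function.Bijective (mres M (inf_le_left : V ⊓ U ≤ V))

lemma IsGen.mres {e : Γ(M, U)} (he : IsGen e) (h : V ≤ U) : IsGen (mres M h e) := by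
  intro W hW
  simpa using he W (hW.trans h)

/-- Morphisms into an extended module are determined by the value on a generator. -/
lemma IsGen.exists_hom {e : Γ(M, U)} (he : IsGen e) (hN : IsExtended N U) (z : Γ(N, U)) :
    ∃ φ : M ⟶ N, secMap φ U e = z := by
  -- On `V ⊓ U` both sections have the same coefficient `r` with respect to `e` and `z`. Freeness of
  -- `e` provides `r`, and since `N` is extended, `t` is recovered from its restriction.
  let R (V : X.Opens) (s : Γ(M, V)) (t : Γ(N, V)) : Prop :=
    ∃ r : Γ(X, V ⊓ U), Verlinde.mres M inf_le_left s = r • Verlinde.mres M inf_le_right e ∧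
      Verlinde.mres N inf_le_left t = r • Verlinde.mres N inf_le_right z
  suffices ∃ φ : M ⟶ N, ∀ (U : X.Opens) (s t), R U s t → secMap φ U s = t by
    obtain ⟨φ, hφ⟩ := this
    refine ⟨φ, hφ _ _ _ ⟨1, ?_, ?_⟩⟩ <;> simp
  refine exists_hom_of_relation R ?_ ?_ ?_ ?_ ?_
  · rintro U' V h s t ⟨r, h1, h2⟩
    refine ⟨rres (inf_le_inf_right _ h) r, ?_, ?_⟩
    · have := congrArg (Verlinde.mres M (inf_le_inf_right U h)) h1
      simpa using this
    · have := congrArg (Verlinde.mres N (inf_le_inf_right U h)) h2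
      simpa using this
  · rintro V s t s' t' ⟨r, h1, h2⟩ ⟨r', h1', h2'⟩
    exact ⟨r + r', by simp [h1, h1', add_smul], by simp [h2, h2', add_smul]⟩
  · rintro V a s t ⟨r, h1, h2⟩
    exact ⟨rres inf_le_left a * r, by simp [h1, mul_smul], by simp [h2, mul_smul]⟩
  · rintro V t ⟨r, h1, h2⟩
    have hr : r = 0 := (he _ inf_le_right).1 (by simpa using h1.symm)
    refine (hN V).1 ?_
    rw [h2, hr, zero_smul, map_zero]
  · intro V s x hx
    obtain ⟨r, hr⟩ := (he _ inf_le_right).2 (Verlinde.mres M (inf_le_left : V ⊓ U ≤ V) s)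
    obtain ⟨t, ht⟩ := (hN V).2 (r • Verlinde.mres N inf_le_right z)
    exact ⟨V, le_rfl, hx, t, r, by simpa using hr.symm, ht⟩

lemma IsGen.hom_ext {e : Γ(M, U)} (he : IsGen e) (hN : IsExtended N U) {φ ψ : M ⟶ N}
    (h : secMap φ U e = secMap ψ U e) : φ = ψ := by
  refine hom_ext_sec fun V s ↦ (hN V).1 ?_
  rw [← secMap_mres, ← secMap_mres]
  obtain ⟨r, hr⟩ := (he _ inf_le_right).2 (Verlinde.mres M (inf_le_left : V ⊓ U ≤ V) s)
  rw [← hr]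
  simp [h]

lemma mres_pushforward (f : X ⟶ Y) {U V : Y.Opens} (h : V ≤ U)  :
   mres ((Scheme.Modules.pushforward f).obj M) h = mres M (f.preimage_mono h) := rfl

/-- Every module maps to an extended one, isomorphically on `U`. -/
lemma exists_extension (M : X.Modules) (U : X.Opens) : ∃ (N : X.Modules) (ρ : M ⟶ N),
    IsExtended N U ∧ ∀ V ≤ U, Function.Bijective (secMap ρ V) := by
  -- The extension is j_* j^* M for the inclusion j of `U`, with the unit of the adjunction.
  refine ⟨(Scheme.Modules.pushforward U.ι).obj (M.restrict U.ι),
    (Scheme.Modules.restrictAdjunction U.ι).unit.app M, fun V ↦ ?_, fun V hV ↦ ?_⟩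
  · rw [mres_pushforward]
    apply mres_bijective_of_le
    exact fun x hx ↦ ⟨hx, x.2⟩
  · have := mres_bijective_of_le (M := M) (U := V) (V := U.ι ''ᵁ U.ι ⁻¹ᵁ V)
      (U.ι.image_preimage_le V) (fun x hx ↦ ⟨⟨x, hV hx⟩, hx, rfl⟩)
    have h2 := Scheme.Modules.restrictAdjunction_unit_app_app U.ι M V
    have h3 (s) : secMap ((Scheme.Modules.restrictAdjunction U.ι).unit.app M) V s = mres M (U.ι.image_preimage_le V) s := congr($h2 s)
    exact (funext h3 : ⇑(secMap ((Scheme.Modules.restrictAdjunction U.ι).unit.app M) V) = _) ▸ this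

/-- The image of a section under the unit of the adjunction of pullback and pushforward. -/
def unitSec (f : X ⟶ Y) (M : Y.Modules) (U : Y.Opens) :
    Γ(M, U) →+ Γ((Scheme.Modules.pullback f).obj M, f ⁻¹ᵁ U) :=
  (secMap ((Scheme.Modules.pullbackPushforwardAdjunction f).unit.app M) U).toAddMonoidHom

variable (f : X ⟶ Y) {P : Y.Modules}

lemma unitSec_mres {U V : Y.Opens} (h : V ≤ U) (s : Γ(P, U)) :
    unitSec f P V (mres P h s) = mres _ (f.preimage_mono h) (unitSec f P U s) :=
  secMap_mres _ h s

lemma unitSec_smul {U : Y.Opens} (r : Γ(Y, U)) (s : Γ(P, U)) :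
    unitSec f P U (r • s) = f.app U r • unitSec f P U s :=
  (secMap ((Scheme.Modules.pullbackPushforwardAdjunction f).unit.app P) U).map_smul r s

lemma exists_pullback_hom (ψ : P ⟶ (Scheme.Modules.pushforward f).obj M) :
    ∃ φ : (Scheme.Modules.pullback f).obj P ⟶ M, ∀ (U : Y.Opens) (s : Γ(P, U)),
      secMap φ (f ⁻¹ᵁ U) (unitSec f P U s) = secMap ψ U s := by
  refine ⟨((Scheme.Modules.pullbackPushforwardAdjunction f).homEquiv _ _).symm ψ, fun U s ↦ ?_⟩
  conv_rhs => rw [← ((Scheme.Modules.pullbackPushforwardAdjunction f).homEquiv _ _).apply_symm_apply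
    ψ, Adjunction.homEquiv_unit]
  rfl

lemma pullback_hom_ext {φ φ' : (Scheme.Modules.pullback f).obj P ⟶ M}
    (h : ∀ (U : Y.Opens) (s : Γ(P, U)),
      secMap φ (f ⁻¹ᵁ U) (unitSec f P U s) = secMap φ' (f ⁻¹ᵁ U) (unitSec f P U s)) : φ = φ' := by
  apply ((Scheme.Modules.pullbackPushforwardAdjunction f).homEquiv _ _).injective
  rw [Adjunction.homEquiv_unit, Adjunction.homEquiv_unit]
  exact hom_ext_sec h

lemma IsExtended.pushforward {U : Y.Opens} (h : IsExtended M (f ⁻¹ᵁ U)) :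
    IsExtended ((Scheme.Modules.pushforward f).obj M) U :=
  fun V ↦ h (f ⁻¹ᵁ V)

/-- The structure sheaf as a module. -/
abbrev structureModule (X : Scheme.{0}) : X.Modules := SheafOfModules.unit X.ringCatSheaf

lemma isGen_one (U : X.Opens) : IsGen (M := structureModule X) (U := U) (1 : Γ(X, U)) := by
  intro V h
  have h1 (r : Γ(X, V)) : r • mres (structureModule X) h (1 : Γ(X, U)) = r := by
    change r * rres h 1 = r
    simp
  exact ⟨fun r r' hr ↦ ((h1 r).symm.trans hr).trans (h1 r'), fun r ↦ ⟨r, h1 r⟩⟩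

lemma IsGen.of_extension {e : Γ(M, U)} (he : IsGen e) {ρ : M ⟶ N}
    (hρ : ∀ V ≤ U, Function.Bijective (secMap ρ V)) : IsGen (secMap ρ U e) := by
  intro V h
  convert (hρ V h).comp (he V h) using 1
  ext r
  simp

/-- The pullback of a generator is a generator. -/
theorem IsGen.unitSec {U : Y.Opens} {e : Γ(P, U)} (he : IsGen e) :
    IsGen (unitSec f P U e) := by
  -- The pullback is accessible only through maps out of it. Extending the structure sheaf and the
  -- pullback from `f ⁻¹ᵁ U` allows global maps: `θ` sends the pulled back generator to 1 and `κ`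
  -- sends 1 back. Then `θ` detects coefficients, which gives injectivity, and `θ ≫ κ = τ` gives
  -- surjectivity.
  obtain ⟨JO, ρ, hJO, hρ⟩ := exists_extension (structureModule X) (f ⁻¹ᵁ U)
  obtain ⟨JE, τ, hJE, hτ⟩ := exists_extension ((Scheme.Modules.pullback f).obj P) (f ⁻¹ᵁ U)
  have h1 := (isGen_one (f ⁻¹ᵁ U)).of_extension hρ
  obtain ⟨θ', hθ'⟩ := he.exists_hom (hJO.pushforward f) (secMap ρ (f ⁻¹ᵁ U) (1 : Γ(X, f ⁻¹ᵁ U)))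
  obtain ⟨θ, hθ⟩ := exists_pullback_hom f θ'
  have hθe := (hθ U e).trans hθ'
  obtain ⟨κ, hκ⟩ := h1.exists_hom hJE (secMap τ _ (Verlinde.unitSec f P U e))
  have key : θ ≫ κ = τ := by
    apply ((Scheme.Modules.pullbackPushforwardAdjunction f).homEquiv _ _).injective
    rw [Adjunction.homEquiv_unit, Adjunction.homEquiv_unit]
    refine he.hom_ext (hJE.pushforward f) ?_
    change secMap (θ ≫ κ) (f ⁻¹ᵁ U) (Verlinde.unitSec f P U e) =
      secMap τ (f ⁻¹ᵁ U) (Verlinde.unitSec f P U e)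
    rw [secMap_comp, hθe, hκ]
  intro V h
  constructor
  · intro r r' hr
    apply (h1 V h).1
    have := congrArg (secMap θ V) hr
    simpa [hθe] using this
  · intro m
    obtain ⟨r, hr⟩ := (h1 V h).2 (secMap θ V m)
    refine ⟨r, (hτ V h).1 ?_⟩
    rw [← key, secMap_comp, secMap_comp, ← hr]
    simp [hθe]

/-- Morphisms out of a module which is locally generated by global sections. -/
theorem exists_hom_of_generators {ι : Type} [Fintype ι] (σ : ι → Γ(M, ⊤)) (z : ι → Γ(N, ⊤))
    (gen : ∀ {U : X.Opens} (s : Γ(M, U)), ∀ x ∈ U, ∃ V, ∃ h : V ≤ U, x ∈ V ∧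
      ∃ c : ι → Γ(X, V), mres M h s = ∑ i, c i • mres M (le_top : V ≤ ⊤) (σ i))
    (rel : ∀ {U : X.Opens} (c : ι → Γ(X, U)), ∑ i, c i • mres M (le_top : U ≤ ⊤) (σ i) = 0 →
      ∀ x ∈ U, ∃ V, ∃ h : V ≤ U, x ∈ V ∧ ∑ i, rres h (c i) • mres N (le_top : V ≤ ⊤) (z i) = 0) :
    ∃ φ : M ⟶ N, ∀ i, secMap φ ⊤ (σ i) = z i := by
  classical
  let R (V : X.Opens) (s : Γ(M, V)) (t : Γ(N, V)) : Prop :=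
    ∃ c : ι → Γ(X, V), s = ∑ i, c i • mres M (le_top : V ≤ ⊤) (σ i) ∧ t = ∑ i, c i • mres N (le_top : V ≤ ⊤) (z i)
  suffices ∃ φ : M ⟶ N, ∀ (U : X.Opens) (s t), R U s t → secMap φ U s = t by
    obtain ⟨φ, hφ⟩ := this
    refine ⟨φ, fun i ↦ hφ _ _ _ ⟨Pi.single i 1, ?_, ?_⟩⟩
    all_goals
      symm
      rw [Finset.sum_eq_single i (fun j _ hj ↦ by simp [hj]) (by simp)]
      simp
  refine exists_hom_of_relation R ?_ ?_ ?_ ?_ ?_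
  · rintro U V h s t ⟨c, rfl, rfl⟩
    exact ⟨fun i ↦ rres h (c i), by simp, by simp⟩
  · rintro V s t s' t' ⟨r, rfl, rfl⟩ ⟨r', rfl, rfl⟩
    exact ⟨r + r', by simp [add_smul, Finset.sum_add_distrib],
      by simp [add_smul, Finset.sum_add_distrib]⟩
  · rintro V a s t ⟨r, rfl, rfl⟩
    exact ⟨a • r, by simp [mul_smul, Finset.smul_sum], by simp [mul_smul, Finset.smul_sum]⟩
  · rintro U t ⟨c, h1, rfl⟩
    refine sec_ext fun x hx ↦ ?_
    obtain ⟨V, h, hxV, h2⟩ := rel c h1.symm x hx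
    refine ⟨V, h, hxV, ?_⟩
    rw [map_zero, ← h2]
    simp
  · intro U s x hx
    obtain ⟨V, h, hxV, c, hc⟩ := gen s x hx
    exact ⟨V, h, hxV, _, c, hc, rfl⟩

theorem hom_ext_of_generators {ι : Type} [Fintype ι] (σ : ι → Γ(M, ⊤))
    (gen : ∀ {U : X.Opens} (s : Γ(M, U)), ∀ x ∈ U, ∃ V, ∃ h : V ≤ U, x ∈ V ∧
      ∃ c : ι → Γ(X, V), mres M h s = ∑ i, c i • mres M (le_top : V ≤ ⊤) (σ i))
    {φ ψ : M ⟶ N} (h : ∀ i, secMap φ ⊤ (σ i) = secMap ψ ⊤ (σ i)) : φ = ψ := by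
  refine hom_ext_sec fun U s ↦ sec_ext fun x hx ↦ ?_
  obtain ⟨V, hV, hxV, c, hc⟩ := gen s x hx
  refine ⟨V, hV, hxV, ?_⟩
  rw [← secMap_mres, ← secMap_mres, hc]
  simp [h]

end Generators

/-! ### Values and generators of the twisting sheaves on Proj -/

section TwistSections

variable {A σ : Type} [CommRing A] [SetLike σ A] [AddSubgroupClass σ A]
variable (𝒜 : ℕ → σ) [GradedRing 𝒜]

variable {𝒜} in
/-- The multiplicative set of elements which do not vanish at a point. -/
abbrev primeComplAt (x : ProjectiveSpectrum 𝒜) : Submonoid A :=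
  x.asHomogeneousIdeal.toIdeal.primeCompl

variable {𝒜} in
/-- The image of an element in the localization at a point. -/
abbrev valAt (x : ProjectiveSpectrum 𝒜) : A →+* LocalAt 𝒜 x := algebraMap A _

variable {𝒜} in
/-- The value of a function at a point, in the localization. -/
def evalAt {U : (Proj 𝒜).Opens} (x : Proj 𝒜) (hx : x ∈ U) : Γ(Proj 𝒜, U) →+* LocalAt 𝒜 x where
  toFun r := (r.1 ⟨x, hx⟩).val
  map_one' := HomogeneousLocalization.val_one
  map_mul' _ _ := HomogeneousLocalization.val_mul _ _
  map_zero' := HomogeneousLocalization.val_zero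
  map_add' _ _ := HomogeneousLocalization.val_add _ _

variable {𝒜} in
/-- The value of a section of `𝒪(m)` at a point. -/
def secAt {m : ℤ} {U : (Proj 𝒜).Opens} (x : Proj 𝒜) (hx : x ∈ U) :
    Γ(twist 𝒜 m, U) →+ LocalAt 𝒜 x where
  toFun s := Subtype.val (p := fun s ↦ s ∈ twistSections 𝒜 m U) s ⟨x, hx⟩
  map_zero' := rfl
  map_add' _ _ := rfl

variable {𝒜} {m : ℤ} {U V : (Proj 𝒜).Opens} {x : Proj 𝒜}

@[simp] lemma evalAt_rres (h : V ≤ U) (hx : x ∈ V) (r : Γ(Proj 𝒜, U)) :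
    evalAt x hx (rres h r) = evalAt x (h hx) r := rfl

@[simp] lemma secAt_mres (h : V ≤ U) (hx : x ∈ V) (s : Γ(twist 𝒜 m, U)) :
    secAt x hx (mres _ h s) = secAt x (h hx) s := rfl

@[simp] lemma secAt_smul (hx : x ∈ U) (r : Γ(Proj 𝒜, U)) (s : Γ(twist 𝒜 m, U)) :
    secAt x hx (r • s) = evalAt x hx r * secAt x hx s := rfl

lemma fun_ext {r r' : Γ(Proj 𝒜, U)} (h : ∀ x hx, evalAt x hx r = evalAt x hx r') : r = r' :=
  Subtype.ext <| funext fun x ↦ HomogeneousLocalization.val_injective _ (h x.1 x.2)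

lemma twist_ext {s s' : Γ(twist 𝒜 m, U)} (h : ∀ x hx, secAt x hx s = secAt x hx s') : s = s' :=
  Subtype.ext (p := fun s ↦ s ∈ twistSections 𝒜 m U) <| funext fun x ↦ h x.1 x.2

/-- The section of `𝒪(m)` given by a fraction. -/
def twistFrac (m : ℤ) {i j : ℕ} {a b : A} (ha : a ∈ 𝒜 i) (hb : b ∈ 𝒜 j) (h : (i : ℤ) = j + m)
    (hU : U ≤ Proj.basicOpen 𝒜 b) : Γ(twist 𝒜 m, U) :=
  show twistSections 𝒜 m U from ⟨fun x ↦ Localization.mk a ⟨b, hU x.2⟩,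
    fun x ↦ ⟨U, x.2, 𝟙 _, i, j, a, b, ha, hb, h, fun y ↦ ⟨hU y.2, rfl⟩⟩⟩

/-- A function on an open subset from a family of local fractions. -/
lemma exists_function (s : ∀ x : Proj 𝒜, x ∈ U → LocalAt 𝒜 x)
    (hs : ∀ x, ∀ _ : x ∈ U, ∃ V ≤ U, x ∈ V ∧ ∃ (i : ℕ) (a b : A), a ∈ 𝒜 i ∧ b ∈ 𝒜 i ∧
      ∀ y, ∀ hy : y ∈ U, y ∈ V → IsFraction (s y hy) a b) :
    ∃ r : Γ(Proj 𝒜, U), ∀ x hx, evalAt x hx r = s x hx := by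
  have h1 (x : U) : ∃ z : HomogeneousLocalization 𝒜 (primeComplAt x.1),
      z.val = s x.1 x.2 := by
    obtain ⟨V, -, hxV, i, a, b, ha, hb, h⟩ := hs x.1 x.2
    obtain ⟨hb', h'⟩ := h x.1 x.2 hxV
    exact ⟨HomogeneousLocalization.mk ⟨i, ⟨a, ha⟩, ⟨b, hb⟩, hb'⟩, h'.symm⟩
  choose z hz using h1
  refine ⟨⟨z, fun x ↦ ?_⟩, fun x hx ↦ hz ⟨x, hx⟩⟩
  obtain ⟨V, hV, hxV, i, a, b, ha, hb, h⟩ := hs x.1 x.2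
  refine ⟨V, hxV, homOfLE hV, i, ⟨a, ha⟩, ⟨b, hb⟩, fun y ↦ (h y.1 (hV y.2) y.2).1, fun y ↦ ?_⟩
  obtain ⟨hb', h'⟩ := h y.1 (hV y.2) y.2
  refine HomogeneousLocalization.val_injective _ ?_
  exact (hz _).trans h'

/-- The generator `b ^ m` of `𝒪(m)` on the open subset where the element `b` of degree one does not
vanish. -/
def twistGen {b : A} (hb : b ∈ 𝒜 1) (m : ℤ) : Γ(twist 𝒜 m, Proj.basicOpen 𝒜 b) :=
  -- One of the two exponents is 0, whatever the sign of `m`, so the fraction is b^m.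
  twistFrac m (a := b ^ m.toNat) (b := b ^ (-m).toNat)
    (by simpa using SetLike.pow_mem_graded m.toNat hb)
    (by simpa using SetLike.pow_mem_graded (-m).toNat hb) (by simp; omega)
    (fun x hx ↦ pow_mem (S := primeComplAt x) hx _)

/-- An element not in the prime ideal of a point, as a unit of the local ring. -/
def unitAt {b : A} (hx : x ∈ Proj.basicOpen 𝒜 b) : (LocalAt 𝒜 x)ˣ where
  val := Localization.mk b 1
  inv := Localization.mk 1 ⟨b, hx⟩
  val_inv := by rw [Localization.mk_mul, mul_one, one_mul, Localization.mk_self ⟨b, hx⟩]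
  inv_val := by rw [Localization.mk_mul, mul_one, one_mul, Localization.mk_self ⟨b, hx⟩]

lemma unitAt_val {b : A} (hx : x ∈ Proj.basicOpen 𝒜 b) : (unitAt hx).val = valAt x b :=
  Localization.mk_one_eq_algebraMap _

lemma mk_eq_unitAt {a b : A} (hx : x ∈ Proj.basicOpen 𝒜 b) (k : ℕ)
    (h : b ^ k ∈ primeComplAt x) :
    (Localization.mk a ⟨b ^ k, h⟩ : LocalAt 𝒜 x) = Localization.mk a 1 * ((unitAt hx ^ k)⁻¹ : (LocalAt 𝒜 x)ˣ).val := by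
  rw [Units.eq_mul_inv_iff_mul_eq, Units.val_pow_eq_pow_val]
  change _ * (Localization.mk b 1) ^ k = _
  rw [Localization.mk_pow, Localization.mk_mul, one_pow, mul_one, Localization.mk_eq_mk_iff,
    Localization.r_iff_exists]
  exact ⟨1, by simp [mul_comm]⟩

lemma secAt_twistGen {b : A} (hb : b ∈ 𝒜 1) (m : ℤ) (hx : x ∈ Proj.basicOpen 𝒜 b) :
    secAt x hx (twistGen hb m) = (unitAt hx ^ m : (LocalAt 𝒜 x)ˣ).val := by
  refine (mk_eq_unitAt hx _ _).trans ?_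
  have : (Localization.mk (b ^ m.toNat) 1 : LocalAt 𝒜 x) = (unitAt hx ^ m.toNat : (LocalAt 𝒜 x)ˣ).val := by
    rw [Units.val_pow_eq_pow_val]
    change _ = (Localization.mk b 1) ^ _
    rw [Localization.mk_pow, one_pow]
  rw [this, ← Units.val_mul]
  congr 1
  rw [← zpow_natCast, ← zpow_natCast, ← zpow_neg, ← zpow_add]
  congr 1
  omega

/-- At every point the value b^m is a unit. Dividing a section that is locally a/c by it gives
a·b^(-m)/c, whose numerator and denominator have equal degree once negative powers are moved across.
-/
theorem isGen_twistGen {b : A} (hb : b ∈ 𝒜 1) (m : ℤ) : IsGen (twistGen hb m) := by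
  intro V h
  constructor
  · intro r r' hr
    refine fun_ext fun x hx ↦ ?_
    have := congrArg (secAt x hx) hr
    simpa [secAt_twistGen] using this
  · intro s
    obtain ⟨r, hr⟩ := exists_function (U := V)
      (fun x hx ↦ secAt x hx s * ((unitAt (h hx) ^ m)⁻¹ : (LocalAt 𝒜 x)ˣ).val) (by
        intro x hx
        obtain ⟨W, hxW, iW, i, j, a, c, ha, hc, hij, hs⟩ :=
          Subtype.property (p := fun s ↦ s ∈ twistSections 𝒜 m V) s ⟨x, hx⟩
        refine ⟨W, leOfHom iW, hxW, i + (-m).toNat, a * b ^ (-m).toNat, c * b ^ m.toNat,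
          SetLike.mul_mem_graded ha (by simpa using SetLike.pow_mem_graded (-m).toNat hb), ?_, ?_⟩
        · rw [show i + (-m).toNat = j + m.toNat by omega]
          exact SetLike.mul_mem_graded hc (by simpa using SetLike.pow_mem_graded m.toNat hb)
        · intro y hy hyW
          refine (hs ⟨y, hyW⟩).mul
            ⟨pow_mem (S := primeComplAt y) (h hy) _, ?_⟩
          have h3 := secAt_twistGen hb (-m) (h hy)
          rw [zpow_neg] at h3
          refine h3.symm.trans ?_
          change Localization.mk _ _ = Localization.mk _ _
          simp only [neg_neg])
    refine ⟨r, twist_ext fun x hx ↦ ?_⟩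
    simp [hr, secAt_twistGen]

/-- The global section of `𝒪(m)` given by an element of degree `m`. -/
def globalSec {m : ℕ} {a : A} (ha : a ∈ 𝒜 m) : Γ(twist 𝒜 (m : ℤ), ⊤) :=
  twistFrac (m : ℤ) ha (SetLike.one_mem_graded 𝒜) (by simp) (by simp)

lemma secAt_globalSec {m : ℕ} {a : A} (ha : a ∈ 𝒜 m) (hx : x ∈ (⊤ : (Proj 𝒜).Opens)) :
    secAt x hx (globalSec ha) = valAt x a :=
  Localization.mk_one_eq_algebraMap _

end TwistSections

/-! ### Standard fractions on projective space -/

section Polynomial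

open MvPolynomial

attribute [local instance] MvPolynomial.gradedAlgebra

variable {σ : Type} {x : projSpace σ}

lemma X_mem (i : σ) : (X i : MvPolynomial σ ℂ) ∈ homogeneousSubmodule σ ℂ 1 := isHomogeneous_X ℂ i

lemma evalAt_stdFraction (i : σ) (m : ℕ) (p : homogeneousSubmodule σ ℂ m) (hx : x ∈ stdOpen i) :
    evalAt x hx (stdFraction i m p) = valAt x p.1 *
      ((unitAt hx ^ m)⁻¹ : (LocalAt (homogeneousSubmodule σ ℂ) x)ˣ).val := by
  refine Eq.trans ?_ (congrArg (· * ((unitAt hx ^ m)⁻¹ : (LocalAt (homogeneousSubmodule σ ℂ)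
    x)ˣ).val) (Localization.mk_one_eq_algebraMap _))
  exact mk_eq_unitAt hx m (pow_mem (S := primeComplAt x) hx _)

lemma globalSec_eq_smul (i : σ) (m : ℕ) (p : homogeneousSubmodule σ ℂ m) :
    mres _ le_top (globalSec p.2) = stdFraction i m p • twistGen (X_mem i) m := by
  refine twist_ext fun x hx ↦ ?_
  rw [secAt_smul, evalAt_stdFraction, secAt_twistGen, secAt_mres, secAt_globalSec,
    zpow_natCast, mul_assoc, Units.inv_mul, mul_one]

end Polynomial

end Verlinde

namespace Verlinde

open TopologicalSpace MvPolynomial Limits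
attribute [local instance] MvPolynomial.gradedAlgebra

/-! ### Charts, constants and coordinate ratios on projective space -/

section ProjSpace

variable {σ : Type}

lemma exists_mem_stdOpen (x : projSpace σ) : ∃ i : σ, x ∈ stdOpen i := by
  by_contra! h
  refine ProjectiveSpectrum.not_irrelevant_le (𝒜 := homogeneousSubmodule σ ℂ) x ?_
  rw [HomogeneousIdeal.irrelevant_le]
  intro i hi p hp
  have hp' : p ∈ Ideal.span (X '' (Set.univ : Set σ) : Set (MvPolynomial σ ℂ)) := by
    rw [mem_ideal_span_X_image]
    intro m hm
    by_contra! h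
    have h0 : m = 0 := Finsupp.ext fun j ↦ h j trivial
    have h2 := (mem_homogeneousSubmodule i p).1 hp (mem_support_iff.1 hm)
    rw [h0, map_zero] at h2
    omega
  refine (Ideal.span_le.2 ?_ : _ ≤ x.asHomogeneousIdeal.toIdeal) hp'
  rintro _ ⟨j, -, rfl⟩
  exact not_not.1 (h j)

/-- A constant function on projective space. -/
def cstFun (U : (projSpace σ).Opens) (c : ℂ) : Γ(projSpace σ, U) :=
  ⟨fun x ↦ HomogeneousLocalization.mk ⟨0, ⟨C c, isHomogeneous_C σ c⟩,
      ⟨1, isHomogeneous_one σ ℂ⟩, one_mem (primeComplAt x.1)⟩,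
    fun x ↦ ⟨U, x.2, 𝟙 _, 0, ⟨C c, isHomogeneous_C σ c⟩, ⟨1, isHomogeneous_one σ ℂ⟩,
      fun y ↦ one_mem (primeComplAt y.1), fun _ ↦ rfl⟩⟩

lemma evalAt_cstFun {U : (projSpace σ).Opens} {x : projSpace σ} (hx : x ∈ U) (c : ℂ) :
    evalAt x hx (cstFun U c) = valAt x (C c) :=
  Localization.mk_one_eq_algebraMap _

/-- The constant functions on projective space. -/
def cst (U : (projSpace σ).Opens) : ℂ →+* Γ(projSpace σ, U) where
  toFun := cstFun U
  map_one' := fun_ext fun x hx ↦ by simp only [evalAt_cstFun, map_one]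
  map_mul' a b := fun_ext fun x hx ↦ by simp only [evalAt_cstFun, map_mul]
  map_zero' := fun_ext fun x hx ↦ by simp only [evalAt_cstFun, map_zero]
  map_add' a b := fun_ext fun x hx ↦ by simp only [evalAt_cstFun, map_add]

lemma evalAt_cst {U : (projSpace σ).Opens} {x : projSpace σ} (hx : x ∈ U) (c : ℂ) :
    evalAt x hx (cst U c) = valAt x (C c) :=
  evalAt_cstFun hx c

@[simp] lemma rres_cst {U V : (projSpace σ).Opens} (h : V ≤ U) (c : ℂ) :
    rres h (cst U c) = cst V c := rfl

/-- Acting through the constants makes it meaningful to speak of ℂ-linear maps from a space of forms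
to sections. -/
instance complexModule (Z : (projSpace σ).Modules) (U : (projSpace σ).Opens) : Module ℂ Γ(Z, U) :=
  Module.compHom _ (cst U)

variable {Z Z' : (projSpace σ).Modules} {U V : (projSpace σ).Opens}

lemma cst_smul (c : ℂ) (s : Γ(Z, U)) : c • s = cst U c • s := rfl

lemma smul_smul_comm' (c : ℂ) (r : Γ(projSpace σ, U)) (s : Γ(Z, U)) : r • c • s = c • r • s := by
  rw [cst_smul, cst_smul, smul_smul, smul_smul, mul_comm]

lemma mres_smul_complex (h : V ≤ U) (c : ℂ) (s : Γ(Z, U)) : mres Z h (c • s) = c • mres Z h s := by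
  rw [cst_smul, mres_smul, rres_cst, ← cst_smul]

lemma secMap_smul_complex (φ : Z ⟶ Z') (c : ℂ) (s : Γ(Z, U)) :
    secMap φ U (c • s) = c • secMap φ U s :=
  (secMap φ U).map_smul _ _

/-- The function `X i / X j` on the open subset where `X j` is invertible. -/
def ratio (i j : σ) : Γ(projSpace σ, stdOpen j) := stdFraction j 1 ⟨X i, X_mem i⟩

lemma evalAt_ratio {x : projSpace σ} (i j : σ) (hx : x ∈ stdOpen j) :
    evalAt x hx (ratio i j) = valAt x (X i) *
      ((unitAt hx)⁻¹ : (LocalAt (homogeneousSubmodule σ ℂ) x)ˣ).val := by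
  rw [ratio, evalAt_stdFraction, pow_one]

@[simp] lemma ratio_self (i : σ) : ratio i i = 1 :=
  fun_ext fun x hx ↦ by rw [evalAt_ratio, map_one, ← unitAt_val hx]; exact (unitAt hx).mul_inv

end ProjSpace

/-! ### Presentation of 𝒪(m) on the line by m + 1 generators and m relations -/

section TwistHom

/-- The projective line. -/
abbrev line : Scheme := projSpace (Fin 2)

/-- The relations between adjacent monomials. -/
def IsChain {Z : line.Modules} {m : ℕ} (z : Fin (m + 1) → Γ(Z, ⊤)) : Prop :=
  ∀ (b : Fin 2) (j : Fin m), ratio 0 b • mres Z (le_top : stdOpen b ≤ ⊤) (z j.castSucc) +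
    ratio 1 b • mres Z (le_top : stdOpen b ≤ ⊤) (z j.succ) = 0

/-- The monomials of degree `m` in two variables, with signs. -/
def signedMonomial (m : ℕ) (j : Fin (m + 1)) : homogeneousSubmodule (Fin 2) ℂ m :=
  ⟨(-1) ^ (j : ℕ) * (X 0 ^ (j : ℕ) * X 1 ^ (m - j)), by
    have h1 : IsHomogeneous (X (0 : Fin 2) ^ (j : ℕ) * X 1 ^ (m - j) : MvPolynomial (Fin 2) ℂ) m := by
      have := (isHomogeneous_X_pow (R := ℂ) (0 : Fin 2) j).mul
        (isHomogeneous_X_pow (R := ℂ) (1 : Fin 2) (m - j))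
      rwa [show (j : ℕ) + (m - j) = m by omega] at this
    obtain h | h := neg_one_pow_eq_or (MvPolynomial (Fin 2) ℂ) j
    · rwa [h, one_mul]
    · rw [h, neg_one_mul]
      exact (homogeneousSubmodule (Fin 2) ℂ m).neg_mem h1⟩

/-- The monomials of degree `m` in two variables, with signs, as sections of `𝒪(m)`. -/
def chainSec (m : ℕ) (j : Fin (m + 1)) : Γ(twist (homogeneousSubmodule (Fin 2) ℂ) m, ⊤) :=
  globalSec (signedMonomial m j).2

lemma isChain_chainSec (m : ℕ) : IsChain (chainSec m) := by
  intro b j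
  refine twist_ext fun x hx ↦ ?_
  simp only [map_add, map_zero, secAt_smul, secAt_mres, chainSec, secAt_globalSec, evalAt_ratio]
  rw [mul_right_comm, mul_right_comm _ _ (valAt x _), ← add_mul, ← map_mul, ← map_mul, ← map_add]
  -- The alternating signs were chosen for this cancellation.
  have : (X 0 * (signedMonomial m j.castSucc).1 + X 1 * (signedMonomial m j.succ).1 :
      MvPolynomial (Fin 2) ℂ) = 0 := by
    simp only [signedMonomial, Fin.val_castSucc, Fin.val_succ]
    rw [show m - (j : ℕ) = (m - (j + 1)) + 1 by omega]
    ring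
  rw [this, map_zero, zero_mul]

variable {Z : line.Modules}

/-- Where the second coordinate is invertible, each relation can be solved for the later term; where
the first one is, for the earlier term. So the chain is governed by its first or its last term
respectively. -/
lemma IsChain.eq_smul_zero {m : ℕ} {z : Fin (m + 1) → Γ(Z, ⊤)} (hz : IsChain z) (j : Fin (m + 1)) :
    mres Z (le_top : stdOpen (1 : Fin 2) ≤ ⊤) (z j) =
      (-ratio (0 : Fin 2) 1) ^ (j : ℕ) • mres Z (le_top : stdOpen (1 : Fin 2) ≤ ⊤) (z 0) := by
  induction j using Fin.induction with
  | zero => simp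
  | succ j ih =>
    have := hz 1 j
    rw [ratio_self, one_smul, ih] at this
    rw [eq_neg_of_add_eq_zero_right this, Fin.val_succ, pow_succ', mul_smul, neg_smul,
      Fin.val_castSucc]

lemma IsChain.eq_smul_last {m : ℕ} {z : Fin (m + 1) → Γ(Z, ⊤)} (hz : IsChain z) (j : Fin (m + 1)) :
    mres Z (le_top : stdOpen (0 : Fin 2) ≤ ⊤) (z j) =
      (-ratio (1 : Fin 2) 0) ^ (m - j : ℕ) •
        mres Z (le_top : stdOpen (0 : Fin 2) ≤ ⊤) (z (Fin.last m)) := by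
  induction j using Fin.reverseInduction with
  | last => simp
  | cast j ih =>
    have := hz 0 j
    rw [ratio_self, one_smul, ih] at this
    rw [eq_neg_of_add_eq_zero_left this, Fin.val_castSucc,
      show m - (j : ℕ) = (m - j.succ) + 1 by simp; omega, pow_succ', mul_smul, neg_smul]

/-- The coefficients `ρ` do not depend on the module or the chain, so any chain can be compared with
the monomial chain, whose `k`-th term is a free generator on the chart. -/
lemma exists_index (m : ℕ) (b : Fin 2) : ∃ (k : Fin (m + 1)) (ρ : Fin (m + 1) → Γ(line, stdOpen b)),
    (∀ (Z : line.Modules) (z : Fin (m + 1) → Γ(Z, ⊤)), IsChain z → ∀ j,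
      mres Z (le_top : stdOpen b ≤ ⊤) (z j) = ρ j • mres Z (le_top : stdOpen b ≤ ⊤) (z k)) ∧
    IsGen (mres _ (le_top : stdOpen b ≤ ⊤) (chainSec m k)) := by
  fin_cases b
  · refine ⟨Fin.last m, _, fun Z z hz j ↦ hz.eq_smul_last j, ?_⟩
    have h : mres _ (le_top : stdOpen (0 : Fin 2) ≤ ⊤) (chainSec m (Fin.last m)) =
        ((-1) ^ m : Γ(line, stdOpen 0)) • twistGen (X_mem 0) m := by
      refine twist_ext fun x hx ↦ ?_
      rw [secAt_mres, chainSec, secAt_globalSec, secAt_smul, secAt_twistGen]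
      simp only [signedMonomial, Fin.val_last, tsub_self, pow_zero, mul_one, map_pow, map_neg,
        map_one, zpow_natCast, Units.val_pow_eq_pow_val, unitAt_val, map_mul]
    rw [h]
    intro V hV
    have h2 := isGen_twistGen (X_mem (0 : Fin 2)) m V hV
    have h3 (r : Γ(line, V)) : r • mres _ hV (((-1) ^ m : Γ(line, stdOpen 0)) •
        twistGen (X_mem 0) m) = (r * (-1) ^ m) • mres _ hV (twistGen (X_mem 0) m) := by
      simp [mul_smul]
    have h4 : Function.Bijective fun r : Γ(line, V) ↦ r * (-1) ^ m :=
      Function.Involutive.bijective fun r ↦ by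
        rw [mul_assoc, ← mul_pow]; simp
    exact (funext h3) ▸ h2.comp h4
  · refine ⟨0, _, fun Z z hz j ↦ hz.eq_smul_zero j, ?_⟩
    suffices h : mres _ (le_top : stdOpen (1 : Fin 2) ≤ ⊤) (chainSec m 0) =
        twistGen (X_mem (1 : Fin 2)) m by
      exact h ▸ isGen_twistGen (X_mem (1 : Fin 2)) m
    refine twist_ext fun x hx ↦ ?_
    rw [secAt_mres, chainSec, secAt_globalSec, secAt_twistGen]
    simp only [signedMonomial, Fin.val_zero, pow_zero, one_mul, tsub_zero, zpow_natCast,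
      Units.val_pow_eq_pow_val, unitAt_val, map_pow]

lemma chainSec_generates {m : ℕ} {U : line.Opens} (s : Γ(twist (homogeneousSubmodule (Fin 2) ℂ) m, U))
    (x : line) (hx : x ∈ U) : ∃ V, ∃ h : V ≤ U, x ∈ V ∧ ∃ c : Fin (m + 1) → Γ(line, V),
      mres _ h s = ∑ j, c j • mres _ (le_top : V ≤ ⊤) (chainSec m j) := by
  obtain ⟨b, hb⟩ := exists_mem_stdOpen x
  obtain ⟨k, ρ, -, hk⟩ := exists_index m b
  obtain ⟨r, hr⟩ := (hk (U ⊓ stdOpen b) inf_le_right).2 (mres _ inf_le_left s)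
  refine ⟨U ⊓ stdOpen b, inf_le_left, ⟨hx, hb⟩, Pi.single k r, ?_⟩
  rw [Finset.sum_eq_single k (fun j _ hj ↦ by simp [hj]) (by simp), ← hr]
  simp

/-- A relation ∑ c_j e_j = 0 among the monomial sections says ∑ c_j ρ_j = 0 on each chart, by
freeness of the `k`-th one. As `z` has the same coefficients ρ_j, the relation passes to `z`. -/
theorem exists_twist_hom {m : ℕ} {z : Fin (m + 1) → Γ(Z, ⊤)} (hz : IsChain z) :
    ∃ φ : twist (homogeneousSubmodule (Fin 2) ℂ) m ⟶ Z, ∀ j, secMap φ ⊤ (chainSec m j) = z j := by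
  refine exists_hom_of_generators _ _ (fun s x hx ↦ chainSec_generates s x hx)
    fun {U} c hc x hx ↦ ?_
  obtain ⟨b, hb⟩ := exists_mem_stdOpen x
  obtain ⟨k, ρ, hρ, hk⟩ := exists_index m b
  have h1 {Z : line.Modules} {z : Fin (m + 1) → Γ(Z, ⊤)} (hz : IsChain z) (j : Fin (m + 1)) :
      mres Z (le_top : U ⊓ stdOpen b ≤ ⊤) (z j) =
        (rres inf_le_right (ρ j) : Γ(line, U ⊓ stdOpen b)) •
          mres Z (le_top : U ⊓ stdOpen b ≤ ⊤) (z k) := by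
    have := congrArg (mres Z (inf_le_right : U ⊓ stdOpen b ≤ _)) (hρ Z z hz j)
    simpa using this
  refine ⟨U ⊓ stdOpen b, inf_le_left, ⟨hx, hb⟩, ?_⟩
  have h2 := congrArg (mres _ (inf_le_left : U ⊓ stdOpen b ≤ _)) hc
  simp only [map_sum, mres_smul, mres_mres, map_zero] at h2
  rw [Finset.sum_congr rfl fun j _ ↦ by rw [h1 (isChain_chainSec m) j, smul_smul],
    ← Finset.sum_smul] at h2
  have h3 := (hk (U ⊓ stdOpen b) inf_le_right).1 (a₁ := ∑ j, rres inf_le_left (c j) *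
    rres inf_le_right (ρ j)) (a₂ := 0) (by simpa using h2)
  rw [Finset.sum_congr rfl fun j _ ↦ by rw [h1 hz j, smul_smul], ← Finset.sum_smul, h3, zero_smul]

end TwistHom

/-! ### Cokernels of pencils of linear maps, as sheaves on the line -/

section Pencil

variable {L W : Type} [AddCommGroup L] [Module ℂ L] [AddCommGroup W] [Module ℂ W]
  (A B : L →ₗ[ℂ] W)

/-- A linear map from `W` to the global sections of a module on the line which vanishes on the
image of the pencil `X 0 * A + X 1 * B`. -/
def IsPencilMap {Z : line.Modules} (z : W →ₗ[ℂ] Γ(Z, ⊤)) : Prop :=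
  ∀ (b : Fin 2) (l : L), ratio 0 b • mres Z (le_top : stdOpen b ≤ ⊤) (z (A l)) +
    ratio 1 b • mres Z (le_top : stdOpen b ≤ ⊤) (z (B l)) = 0

/-- A pencil map which is universal, so that the module is the cokernel of the pencil. -/
structure IsUniversalPencilMap {E : line.Modules} (u : W →ₗ[ℂ] Γ(E, ⊤)) : Prop where
  isPencilMap : IsPencilMap A B u
  exists_hom {Z : line.Modules} {z : W →ₗ[ℂ] Γ(Z, ⊤)} (hz : IsPencilMap A B z) :
    ∃ φ : E ⟶ Z, ∀ w, secMap φ ⊤ (u w) = z w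
  hom_ext {Z : line.Modules} {φ ψ : E ⟶ Z} (h : ∀ w, secMap φ ⊤ (u w) = secMap ψ ⊤ (u w)) : φ = ψ

variable {A B}

theorem IsUniversalPencilMap.nonempty_iso {E E' : line.Modules} {u : W →ₗ[ℂ] Γ(E, ⊤)}
    {u' : W →ₗ[ℂ] Γ(E', ⊤)} (hu : IsUniversalPencilMap A B u) (hu' : IsUniversalPencilMap A B u') :
    Nonempty (E ≅ E') := by
  obtain ⟨φ, hφ⟩ := hu.exists_hom hu'.isPencilMap
  obtain ⟨ψ, hψ⟩ := hu'.exists_hom hu.isPencilMap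
  exact ⟨⟨φ, ψ, hu.hom_ext fun w ↦ by simp [hφ, hψ], hu'.hom_ext fun w ↦ by simp [hφ, hψ]⟩⟩

/-- The sections of a module over an open subset, as a complex linear map in the section. -/
def secMapₗ {Z Z' : line.Modules} (φ : Z ⟶ Z') (U : line.Opens) : Γ(Z, U) →ₗ[ℂ] Γ(Z', U) where
  toFun := secMap φ U
  map_add' := map_add _
  map_smul' := secMap_smul_complex φ

lemma IsPencilMap.of_span {Z : line.Modules} {z : W →ₗ[ℂ] Γ(Z, ⊤)} {s : Set L}
    (hs : Submodule.span ℂ s = ⊤) (h : ∀ (b : Fin 2), ∀ l ∈ s,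
      ratio 0 b • mres Z (le_top : stdOpen b ≤ ⊤) (z (A l)) +
        ratio 1 b • mres Z (le_top : stdOpen b ≤ ⊤) (z (B l)) = 0) : IsPencilMap A B z := by
  intro b l
  have hl : l ∈ Submodule.span ℂ s := hs ▸ Submodule.mem_top
  induction hl using Submodule.span_induction with
  | mem l hl => exact h b l hl
  | zero => simp
  | add l l' _ _ h1 h2 =>
    simp only [map_add, smul_add]
    rw [add_add_add_comm, h1, h2, add_zero]
  | smul c l _ h1 =>
    simp only [map_smul, mres_smul_complex, smul_smul_comm']
    rw [← smul_add, h1, smul_zero]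

/-- A Kronecker normal form of a pencil. -/
structure KroneckerBasis (A B : L →ₗ[ℂ] W) {ι : Type} (m : ι → ℕ) where
  /-- the basis of the target -/
  w : Module.Basis (Σ i, Fin (m i + 1)) ℂ W
  /-- the generators of the source -/
  l : (Σ i, Fin (m i)) → L
  span_l : Submodule.span ℂ (Set.range l) = ⊤
  map_fst : ∀ i j, A (l ⟨i, j⟩) = w ⟨i, j.castSucc⟩
  map_snd : ∀ i j, B (l ⟨i, j⟩) = w ⟨i, j.succ⟩

/-- The cokernel of a pencil in Kronecker normal form. -/
theorem KroneckerBasis.exists_universal {ι : Type} {m : ι → ℕ} (K : KroneckerBasis A B m) :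
    ∃ u : W →ₗ[ℂ] Γ((∐ fun i ↦ twist (homogeneousSubmodule (Fin 2) ℂ) (m i) : line.Modules), ⊤),
      IsUniversalPencilMap A B u := by
  let E : line.Modules := ∐ fun i ↦ twist (homogeneousSubmodule (Fin 2) ℂ) (m i)
  let inj (i : ι) : twist (homogeneousSubmodule (Fin 2) ℂ) (m i) ⟶ E :=
    Sigma.ι (fun i ↦ twist (homogeneousSubmodule (Fin 2) ℂ) (m i)) i
  let u : W →ₗ[ℂ] Γ(E, ⊤) := K.w.constr ℂ fun p ↦ secMap (inj p.1) ⊤ (chainSec (m p.1) p.2)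
  have hu (i) (j : Fin (m i + 1)) : u (K.w ⟨i, j⟩) = secMap (inj i) ⊤ (chainSec (m i) j) :=
    K.w.constr_basis ℂ _ _
  refine ⟨u, ?_, ?_, ?_⟩
  · refine IsPencilMap.of_span K.span_l ?_
    rintro b _ ⟨⟨i, j⟩, rfl⟩
    rw [K.map_fst, K.map_snd, hu, hu]
    have := congrArg (secMap (inj i) (stdOpen b)) (isChain_chainSec (m i) b j)
    simpa using this
  · intro Z z hz
    -- On a single Kronecker block, a pencil map is a chain, and therefore a map out of 𝒪(m i).
    have hc (i : ι) : IsChain fun j ↦ z (K.w ⟨i, j⟩) := by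
      intro b j
      have := hz b (K.l ⟨i, j⟩)
      rwa [K.map_fst, K.map_snd] at this
    choose φ hφ using fun i ↦ exists_twist_hom (hc i)
    refine ⟨Sigma.desc φ, fun w ↦ ?_⟩
    suffices (secMapₗ (Sigma.desc φ) ⊤).comp u = z from LinearMap.congr_fun this w
    refine K.w.ext fun ⟨i, j⟩ ↦ ?_
    change secMap _ ⊤ (u _) = _
    rw [hu, ← secMap_comp, Sigma.ι_desc]
    exact hφ i j
  · intro Z φ ψ h
    refine Sigma.hom_ext _ _ fun i ↦ hom_ext_of_generators _
      (fun s x hx ↦ chainSec_generates s x hx) fun j ↦ ?_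
    have := h (K.w ⟨i, j⟩)
    rw [hu] at this
    exact this

end Pencil

end Verlinde

namespace Verlinde

open MvPolynomial Module

/-! ### Kronecker normal forms -/

section LinearAlgebra

variable {L W : Type} [AddCommGroup L] [Module ℂ L] [AddCommGroup W] [Module ℂ W]
  {A B : L →ₗ[ℂ] W}

lemma sumExtend_inl {α : Type} {v : α → W} (hv : LinearIndependent ℂ v) (a : α) :
    Basis.sumExtend hv (Sum.inl a) = v a := by
  simp [Basis.sumExtend]
  rfl

lemma exists_basis_extend [FiniteDimensional ℂ W] {α : Type} [Fintype α] {v : α → W}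
    (hv : LinearIndependent ℂ v) : ∃ b : Basis (α ⊕ Fin (finrank ℂ W - Fintype.card α)) ℂ W,
      ∀ a, b (Sum.inl a) = v a := by
  have := FiniteDimensional.fintypeBasisIndex (Basis.sumExtend hv)
  have : Fintype (Basis.sumExtendIndex hv) :=
    Fintype.ofInjective (Sum.inr : _ → α ⊕ Basis.sumExtendIndex hv) Sum.inr_injective
  have h1 := finrank_eq_card_basis (Basis.sumExtend hv)
  have h2 : Fintype.card (Basis.sumExtendIndex hv) = finrank ℂ W - Fintype.card α := by
    have h3 : finrank ℂ W = Fintype.card α + Fintype.card (Basis.sumExtendIndex hv) := by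
      rw [← Fintype.card_sum, h1]
      convert rfl
    omega
  refine ⟨(Basis.sumExtend hv).reindex (Equiv.sumCongr (Equiv.refl _) (Fintype.equivFinOfCardEq h2)),
    fun a ↦ ?_⟩
  rw [Basis.reindex_apply]
  exact sumExtend_inl hv a

/-- Extension of a linearly independent family in Kronecker form by vectors outside the image of
the pencil. -/
theorem exists_kroneckerBasis [FiniteDimensional ℂ W] {ι : Type} [Fintype ι] (m : ι → ℕ)
    {v : (Σ i, Fin (m i + 1)) → W} (hv : LinearIndependent ℂ v) (l : (Σ i, Fin (m i)) → L)
    (hl : Submodule.span ℂ (Set.range l) = ⊤)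
    (hA : ∀ i j, A (l ⟨i, j⟩) = v ⟨i, j.castSucc⟩) (hB : ∀ i j, B (l ⟨i, j⟩) = v ⟨i, j.succ⟩) :
    Nonempty (KroneckerBasis A B
      (Sum.elim m fun _ : Fin (finrank ℂ W - ∑ i, (m i + 1)) ↦ 0)) := by
  have key := exists_basis_extend hv
  rw [show Fintype.card (Σ i, Fin (m i + 1)) = ∑ i, (m i + 1) by simp] at key
  obtain ⟨b, hb⟩ := key
  -- Each added basis vector is a block with `m = 0`: one vector, no generator of the source,
  -- cokernel 𝒪.
  let mm : ι ⊕ Fin (finrank ℂ W - ∑ i, (m i + 1)) → ℕ := Sum.elim m fun _ ↦ 0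
  let e : (Σ i, Fin (mm i + 1)) ≃ (Σ i, Fin (m i + 1)) ⊕ Fin (finrank ℂ W - ∑ i, (m i + 1)) :=
    (Equiv.sumSigmaDistrib fun i ↦ Fin (mm i + 1)).trans
      (Equiv.sumCongr (Equiv.refl _) (Equiv.sigmaUnique _ fun _ ↦ Fin 1))
  let l' : (Σ i, Fin (mm i)) → L
    | ⟨.inl i, j⟩ => l ⟨i, j⟩
    | ⟨.inr _, j⟩ => Fin.elim0 j
  refine ⟨⟨b.reindex e.symm, l', ?_, ?_, ?_⟩⟩
  · refine top_le_iff.1 (hl ▸ Submodule.span_mono ?_)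
    rintro _ ⟨⟨i, j⟩, rfl⟩
    exact ⟨⟨.inl i, j⟩, rfl⟩
  · rintro (i | i) j
    · rw [Basis.reindex_apply]
      exact (hA i j).trans (hb _).symm
    · exact Fin.elim0 j
  · rintro (i | i) j
    · rw [Basis.reindex_apply]
      exact (hB i j).trans (hb _).symm
    · exact Fin.elim0 j

/-- The hypothesis is injectivity of (p, q) ↦ A p + B q on L × L, so the vectors A e_i, B e_i are
independent and every e_i is a block with `m = 1`. -/
theorem exists_kroneckerBasis_of_injective [FiniteDimensional ℂ W] {N : ℕ} (e : Basis (Fin N) ℂ L)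
    (h : ∀ p q, A p + B q = 0 → p = 0 ∧ q = 0) :
    Nonempty (KroneckerBasis A B (Sum.elim (fun _ : Fin N ↦ 1)
      fun _ : Fin (finrank ℂ W - 2 * N) ↦ 0)) := by
  have key := exists_kroneckerBasis (A := A) (B := B) (fun _ : Fin N ↦ 1)
    (v := fun p ↦ (![A (e p.1), B (e p.1)] : Fin 2 → W) p.2) ?_ (fun p ↦ e p.1) ?_
    (fun i j ↦ by fin_cases j; rfl) (fun i j ↦ by fin_cases j; rfl)
  · have : ∑ i : Fin N, (1 + 1) = 2 * N := by simp [mul_comm]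
    rwa [this] at key
  · rw [Fintype.linearIndependent_iff]
    intro c hc
    rw [Fintype.sum_sigma] at hc
    have hc : ∑ i : Fin N, ∑ j : Fin 2, c ⟨i, j⟩ • (![A (e i), B (e i)] : Fin 2 → W) j = 0 := hc
    simp only [Fin.sum_univ_two, Matrix.cons_val_zero, Matrix.cons_val_one,
      Finset.sum_add_distrib] at hc
    simp only [← map_smul, ← map_sum] at hc
    obtain ⟨h1, h2⟩ := h _ _ hc
    have h1 := Fintype.linearIndependent_iff.1 e.linearIndependent _ h1
    have h2 := Fintype.linearIndependent_iff.1 e.linearIndependent _ h2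
    rintro ⟨i, j⟩
    fin_cases j
    · exact h1 i
    · exact h2 i
  · refine top_le_iff.1 (e.span_eq ▸ Submodule.span_mono ?_)
    rintro _ ⟨i, rfl⟩
    exact ⟨⟨i, 0⟩, rfl⟩

/-- Here the kernel of (p, q) ↦ A p + B q is the line through (e_1, -e_0). It links e_0 and e_1 into
one block A e_0, A e_1 = B e_0, B e_1, and nothing else degenerates. -/
theorem exists_kroneckerBasis_of_relation [FiniteDimensional ℂ W] {N : ℕ}
    (e : Basis (Fin 2 ⊕ Fin N) ℂ L) (hAB : A (e (.inl 1)) = B (e (.inl 0)))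
    (h : ∀ p q, A p + B q = 0 → ∃ c : ℂ, p = c • e (.inl 1) ∧ q = -c • e (.inl 0)) :
    Nonempty (KroneckerBasis A B (Sum.elim (Sum.elim (fun _ : Unit ↦ 2) (fun _ : Fin N ↦ 1))
      fun _ : Fin (finrank ℂ W - (3 + 2 * N)) ↦ 0)) := by
  let m : Unit ⊕ Fin N → ℕ := Sum.elim (fun _ : Unit ↦ 2) (fun _ : Fin N ↦ 1)
  let v : (Σ i, Fin (m i + 1)) → W
    | ⟨.inl _, j⟩ => (![A (e (.inl 0)), A (e (.inl 1)), B (e (.inl 1))] : Fin 3 → W) j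
    | ⟨.inr i, j⟩ => (![A (e (.inr i)), B (e (.inr i))] : Fin 2 → W) j
  let l : (Σ i, Fin (m i)) → L
    | ⟨.inl _, j⟩ => e (.inl j)
    | ⟨.inr i, _⟩ => e (.inr i)
  have key := exists_kroneckerBasis (A := A) (B := B) m (v := v) ?_ l ?_ ?_ ?_
  · have : ∑ i, (m i + 1) = 3 + 2 * N := by simp [m, mul_comm]
    rwa [this] at key
  · rw [Fintype.linearIndependent_iff]
    intro c hc
    rw [Fintype.sum_sigma, Fintype.sum_sum_type, Fintype.sum_unique] at hc
    have h3 : ∑ j : Fin 3, c ⟨.inl (), j⟩ • v ⟨.inl (), j⟩ + ∑ i : Fin N, ∑ j : Fin 2,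
        c ⟨.inr i, j⟩ • v ⟨.inr i, j⟩ = 0 := hc
    -- The shared vector A e_1 = B e_0 is counted under `A`, so e_0 gets coefficient 0 under `B`.
    -- That zero forces the scalar `a` below to vanish.
    have h4 : A (∑ j : Fin 2 ⊕ Fin N, (Sum.elim ![c ⟨.inl (), (0 : Fin 3)⟩, c ⟨.inl (), (1 : Fin 3)⟩]
          fun i ↦ c ⟨.inr i, (0 : Fin 2)⟩ : _ → ℂ) j • e j) +
        B (∑ j : Fin 2 ⊕ Fin N, (Sum.elim ![0, c ⟨.inl (), (2 : Fin 3)⟩]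
          fun i ↦ c ⟨.inr i, (1 : Fin 2)⟩ : _ → ℂ) j • e j) = 0 := by
      rw [← h3]
      simp [Fin.sum_univ_three, Finset.sum_add_distrib, v]
      abel
    obtain ⟨a, h5, h6⟩ := h _ _ h4
    have h7 := congrArg (fun x ↦ e.repr x) h6
    have h8 (j) := DFunLike.congr_fun h7 j
    simp only [Basis.repr_sum_self, map_smul, Basis.repr_self, Finsupp.smul_single,
      Finsupp.single_apply] at h8
    have ha : a = 0 := by
      have := h8 (.inl 0)
      simpa using this.symm
    rw [ha, zero_smul] at h5
    have h9 := Fintype.linearIndependent_iff.1 e.linearIndependent _ h5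
    have h10 (j) := h8 j
    simp only [ha] at h10
    rintro ⟨_ | i, j⟩
    · change Fin 3 at j
      fin_cases j
      · exact h9 (.inl 0)
      · exact h9 (.inl 1)
      · simpa using h10 (.inl 1)
    · change Fin 2 at j
      fin_cases j
      · exact h9 (.inr i)
      · simpa using h10 (.inr i)
  · refine top_le_iff.1 (e.span_eq ▸ Submodule.span_mono ?_)
    rintro _ ⟨j | i, rfl⟩
    · exact ⟨⟨.inl (), j⟩, rfl⟩
    · exact ⟨⟨.inr i, (0 : Fin 1)⟩, rfl⟩
  · rintro (_ | i) j
    · change Fin 2 at j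
      fin_cases j
      · rfl
      · rfl
    · change Fin 1 at j
      fin_cases j
      rfl
  · rintro (_ | i) j
    · change Fin 2 at j
      fin_cases j
      · exact hAB.symm
      · rfl
    · change Fin 1 at j
      fin_cases j
      rfl

end LinearAlgebra

end Verlinde

namespace Verlinde

open MvPolynomial Module
attribute [local instance] MvPolynomial.gradedAlgebra

/-! ### The pencil of multiplications by two forms -/

section Forms

variable {n d : ℕ}

/-- The monomials form a basis of the space of forms of degree `d`. -/
def monomialBasis (n d : ℕ) :
    Basis (MonomialIndex n d) ℂ (homogeneousSubmodule (Fin (n + 1)) ℂ d) :=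
  Basis.ofEquivFun
    { toFun p I := coeff I.1 p.1
      invFun c := ∑ I, c I • monomialForm I
      map_add' _ _ := rfl
      map_smul' _ _ := rfl
      left_inv p := (form_eq_sum p).symm
      right_inv c := by
        ext I
        simp only [monomialForm, AddSubmonoidClass.coe_finsetSum, Submodule.coe_smul, coeff_sum,
          coeff_smul, coeff_monomial, smul_eq_mul, mul_ite, mul_one, mul_zero]
        rw [Finset.sum_eq_single I (fun J _ hJ ↦ if_neg fun h ↦ hJ (Subtype.ext h)) (by simp)]
        simp }

lemma monomialBasis_repr (p : homogeneousSubmodule (Fin (n + 1)) ℂ d) (I : MonomialIndex n d) :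
    (monomialBasis n d).repr p I = coeff I.1 p.1 := by
  rw [monomialBasis, Basis.ofEquivFun_repr_apply]
  rfl

@[simp] lemma monomialBasis_apply (I : MonomialIndex n d) : monomialBasis n d I = monomialForm I := by
  apply (monomialBasis n d).repr.injective
  ext J
  rw [Basis.repr_self, monomialBasis_repr, Finsupp.single_apply, monomialForm, coeff_monomial]
  simp only [Subtype.ext_iff]

instance : FiniteDimensional ℂ (homogeneousSubmodule (Fin (n + 1)) ℂ d) :=
  (monomialBasis n d).finiteDimensional_of_finite

lemma finrank_forms (n d : ℕ) :
    finrank ℂ (homogeneousSubmodule (Fin (n + 1)) ℂ d) = (n + d).choose n := by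
  rw [finrank_eq_card_basis (monomialBasis n d), Fintype.card_coe,
    Finset.card_finsuppAntidiag_nat_eq_choose, Finset.card_univ, Fintype.card_fin,
    show n + 1 + d - 1 = n + d by omega, ← Nat.choose_symm_add]

/-- Multiplication of linear forms by a form of degree `d`. -/
def mulForm (f : homogeneousSubmodule (Fin (n + 1)) ℂ d) :
    homogeneousSubmodule (Fin (n + 1)) ℂ 1 →ₗ[ℂ] homogeneousSubmodule (Fin (n + 1)) ℂ (d + 1) where
  toFun l := ⟨f.1 * l.1, IsHomogeneous.mul f.2 l.2⟩
  map_add' _ _ := Subtype.ext (mul_add _ _ _)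
  map_smul' _ _ := Subtype.ext (mul_smul_comm _ _ _)

lemma totalDegree_linear {p : homogeneousSubmodule (Fin (n + 1)) ℂ 1} (hp : p ≠ 0) :
    p.1.totalDegree = 1 :=
  IsHomogeneous.totalDegree p.2 fun h ↦ hp (Subtype.ext h)

/-- A polynomial of total degree 1 over a field is irreducible, hence prime by unique factorization.
-/
lemma prime_linear {p : homogeneousSubmodule (Fin (n + 1)) ℂ 1} (hp : p ≠ 0) : Prime p.1 := by
  refine (irreducible_of_totalDegree_eq_one (totalDegree_linear hp) fun x hx ↦ ?_).prime
  rw [isUnit_iff_ne_zero]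
  rintro rfl
  refine hp (Subtype.ext (MvPolynomial.ext _ _ fun i ↦ ?_))
  simpa using hx i

lemma exists_eq_smul_of_dvd {p q : homogeneousSubmodule (Fin (n + 1)) ℂ 1} (hp : p ≠ 0)
    (h : p.1 ∣ q.1) : ∃ c : ℂ, q = c • p := by
  obtain ⟨r, hr⟩ := h
  by_cases hq : q = 0
  · exact ⟨0, by simp [hq]⟩
  have hr0 : r ≠ 0 := by
    rintro rfl
    exact hq (Subtype.ext (by simpa using hr))
  have h1 := totalDegree_linear hq
  rw [hr, totalDegree_mul_of_isDomain (fun h ↦ hp (Subtype.ext h)) hr0, totalDegree_linear hp] at h1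
  have h2 : r.totalDegree = 0 := by omega
  rw [totalDegree_eq_zero_iff_eq_C] at h2
  refine ⟨coeff 0 r, Subtype.ext ?_⟩
  rw [hr, h2, mul_comm, ← smul_eq_C_mul]
  simp

/-- The pencil of multiplications by two linearly independent forms has one of two Kronecker
normal forms. -/
theorem exists_kroneckerBasis_mulForm (f : Fin 2 → homogeneousSubmodule (Fin (n + 1)) ℂ d)
    (hf : LinearIndependent ℂ f) :
    Nonempty (KroneckerBasis (mulForm (f 0)) (mulForm (f 1)) (Sum.elim (fun _ : Fin (n + 1) ↦ 1)
      fun _ : Fin ((n + d + 1).choose n - 2 * (n + 1)) ↦ 0)) ∨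
    Nonempty (KroneckerBasis (mulForm (f 0)) (mulForm (f 1))
      (Sum.elim (Sum.elim (fun _ : Unit ↦ 2) (fun _ : Fin (n - 1) ↦ 1))
        fun _ : Fin ((n + d + 1).choose n - (3 + 2 * (n - 1))) ↦ 0)) := by
  have hL : finrank ℂ (homogeneousSubmodule (Fin (n + 1)) ℂ 1) = n + 1 := by
    rw [finrank_forms, Nat.choose_succ_self_right]
  have hW : finrank ℂ (homogeneousSubmodule (Fin (n + 1)) ℂ (d + 1)) = (n + d + 1).choose n :=
    finrank_forms n (d + 1)
  rw [← hW]
  have hzero (p q : homogeneousSubmodule (Fin (n + 1)) ℂ 1) (h : mulForm (f 0) p + mulForm (f 1) q = 0) :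
      (f 0).1 * p.1 + (f 1).1 * q.1 = 0 := congrArg Subtype.val h
  by_cases h : ∀ p q, mulForm (f 0) p + mulForm (f 1) q = 0 → p = 0 ∧ q = 0
  · exact .inl (exists_kroneckerBasis_of_injective (finBasisOfFinrankEq _ _ hL) h)
  right
  push Not at h
  obtain ⟨p, q, hpq, hne⟩ := h
  -- If -a q + b p = 0, the relation f_0 p + f_1 q = 0 shows that a f_0 + b f_1 annihilates both p
  -- and q. One of them is nonzero, so a f_0 + b f_1 = 0 and a = b = 0.
  have hli : LinearIndependent ℂ ![-q, p] := by
    rw [LinearIndependent.pair_iff]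
    intro a b hab
    have h1 : -(C a * q.1) + C b * p.1 = 0 := by
      have := congrArg Subtype.val hab
      simpa [smul_eq_C_mul] using this
    have h2 := hzero p q hpq
    have h3 : (C a * (f 0).1 + C b * (f 1).1) * p.1 = 0 := by
      linear_combination (f 1).1 * h1 + C a * h2
    have h4 : (C a * (f 0).1 + C b * (f 1).1) * q.1 = 0 := by
      linear_combination C b * h2 - (f 0).1 * h1
    have h5 : C a * (f 0).1 + C b * (f 1).1 = 0 := by
      by_contra h0
      have hp : p = 0 := Subtype.ext ((mul_eq_zero.1 h3).resolve_left h0)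
      exact hne hp (Subtype.ext ((mul_eq_zero.1 h4).resolve_left h0))
    have hf' : LinearIndependent ℂ ![f 0, f 1] := by
      convert hf using 1
      ext i
      fin_cases i <;> rfl
    refine LinearIndependent.pair_iff.1 hf' a b (Subtype.ext ?_)
    simpa [smul_eq_C_mul] using h5
  have hp0 : p ≠ 0 := hli.ne_zero 1
  have hq0 : -q ≠ 0 := hli.ne_zero 0
  have hex := exists_basis_extend hli
  rw [hL, Fintype.card_fin, show n + 1 - 2 = n - 1 by omega] at hex
  obtain ⟨e, he⟩ := hex
  -- The sign turns f_0 p + f_1 q = 0 into A e_1 = B e_0.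
  have he0 : e (.inl 0) = -q := he 0
  have he1 : e (.inl 1) = p := he 1
  have hpq' := hzero p q hpq
  have hf0 : (f 0).1 ≠ 0 := fun h ↦ hf.ne_zero 0 (Subtype.ext h)
  refine exists_kroneckerBasis_of_relation e ?_ fun p' q' h' ↦ ?_
  · rw [he0, he1, map_neg]
    exact eq_neg_of_add_eq_zero_left hpq
  · have h1 := hzero p' q' h'
    -- Eliminating f_0 and f_1 from the two relations. The prime p then divides p' or q, and p ∣ q
    -- would make p and q dependent.
    have h2 : p'.1 * q.1 = p.1 * q'.1 := by
      by_cases hf1 : (f 1).1 = 0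
      · exact (hf.ne_zero 1 (Subtype.ext hf1)).elim
      apply mul_left_cancel₀ (mul_ne_zero hf0 hf1)
      linear_combination (f 1).1 * q.1 * h1 - (f 1).1 * q'.1 * hpq'
    have hdvd : p.1 ∣ p'.1 := by
      refine ((prime_linear hp0).dvd_or_dvd (Dvd.intro _ h2.symm)).resolve_right fun h ↦ ?_
      obtain ⟨c, hc⟩ := exists_eq_smul_of_dvd hp0 h
      have := LinearIndependent.pair_iff.1 hli 1 c (by rw [hc]; simp)
      exact one_ne_zero this.1
    obtain ⟨c, hc⟩ := exists_eq_smul_of_dvd hp0 hdvd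
    refine ⟨c, by rw [he1, hc], ?_⟩
    rw [he0]
    apply Subtype.ext
    apply mul_left_cancel₀ (show p.1 ≠ 0 from fun h ↦ hp0 (Subtype.ext h))
    rw [← h2, hc]
    simp [smul_eq_C_mul]
    ring

end Forms

end Verlinde

namespace Verlinde

open MvPolynomial
attribute [local instance] MvPolynomial.gradedAlgebra

/-! ### Forms modulo a form outside the ideals (x_i, x_j) -/

section Divisibility

variable {R τ : Type} [CommRing R] {i j : τ} {F : MvPolynomial τ R}

/-- Substituting 0 for x_i does not change the class modulo x_i. -/
lemma X_dvd_sub_aeval [DecidableEq τ] (i : τ) (p : MvPolynomial τ R) :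
    X i ∣ p - aeval (fun l ↦ if l = i then 0 else X l) p := by
  rw [← Ideal.mem_span_singleton, ← Ideal.Quotient.mk_eq_mk_iff_sub_mem]
  have : (Ideal.Quotient.mkₐ R (Ideal.span {(X i : MvPolynomial τ R)})) =
      (Ideal.Quotient.mkₐ R (Ideal.span {X i})).comp (aeval fun l ↦ if l = i then 0 else X l) := by
    ext l
    by_cases h : l = i
    · subst h
      simp
    · simp [h]
  exact DFunLike.congr_fun this p

/-- Every monomial of an element of (x_i, x_j) involves x_i or x_j. -/
lemma not_eq_X_mul_add_X_mul {m : τ →₀ ℕ} (hm : coeff m F ≠ 0) (hi : m i = 0) (hj : m j = 0)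
    (a b : MvPolynomial τ R) : F ≠ X i * a + X j * b := by
  classical
  rintro rfl
  apply hm
  rw [coeff_add, coeff_X_mul', coeff_X_mul', if_neg (by simpa using hi), if_neg (by simpa using hj),
    add_zero]

/-- The homogeneous quotient of a divisible homogeneous polynomial. -/
lemma exists_isHomogeneous_of_dvd {d e : ℕ} {G : MvPolynomial τ R} (hF : F.IsHomogeneous d)
    (hG : G.IsHomogeneous (d + e)) (h : F ∣ G) : ∃ H : MvPolynomial τ R, H.IsHomogeneous e ∧
      G = F * H := by
  obtain ⟨H, rfl⟩ := h
  refine ⟨DirectSum.decompose (homogeneousSubmodule τ R) H e,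
    (DirectSum.decompose (homogeneousSubmodule τ R) H e).2, ?_⟩
  rw [← DirectSum.coe_decompose_mul_add_of_left_mem (homogeneousSubmodule τ R) hF,
    DirectSum.decompose_of_mem_same _ hG]

variable [IsDomain R]

lemma dvd_of_dvd_X_pow_mul (hF : ¬ X i ∣ F) {N : ℕ} {G : MvPolynomial τ R}
    (h : F ∣ X i ^ N * G) : F ∣ G := by
  obtain ⟨c, hc⟩ := h
  obtain ⟨e, rfl⟩ := (X_prime (R := R) (i := i)).pow_dvd_of_dvd_mul_left N hF (Dvd.intro _ hc)
  refine ⟨e, mul_left_cancel₀ (pow_ne_zero N (X_ne_zero i)) (hc.trans (by ring))⟩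

/-- Sections over the union of two standard charts extend: if `x_j ^ q G_i = x_i ^ p G_j` modulo
`F`, then `G_i` is a multiple of `x_i ^ p` modulo `F`. -/
lemma exists_dvd_X_pow_mul_sub (hF : ∀ a b, F ≠ X i * a + X j * b) (hij : i ≠ j) (p q : ℕ)
    (G H : MvPolynomial τ R) (h : F ∣ X j ^ q * G - X i ^ p * H) : ∃ K, F ∣ X i ^ p * K - G := by
  classical
  have hFi : ¬ X i ∣ F := fun ⟨a, ha⟩ ↦ hF a 0 (by rw [ha, mul_zero, add_zero])
  induction p generalizing G with
  | zero => exact ⟨G, by simp⟩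
  | succ p ih =>
    obtain ⟨c, hc⟩ := h
    -- Reduce modulo x_i. There x_j^q G is a multiple of F, and x_j does not divide F because F ∉
    -- (x_i, x_j), so G itself is a multiple of F. Lifting gives G = F e + x_i G'; cancelling x_i
    -- leaves the same problem for G' with exponent p.
    let κ : MvPolynomial τ R →ₐ[R] MvPolynomial τ R := aeval fun l ↦ if l = i then 0 else X l
    have hκi : κ (X i) = 0 := by simp [κ]
    have hκj : κ (X j) = X j := by simp [κ, hij.symm]
    have hκ : X j ^ q * κ G = κ F * κ c := by
      have := congrArg κ hc
      simpa [hκi, hκj] using this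
    have hFj : ¬ X j ∣ κ F := by
      rintro ⟨b, hb⟩
      obtain ⟨a, ha⟩ := X_dvd_sub_aeval i F
      exact hF a b (by rw [← ha, ← hb]; simp [κ])
    obtain ⟨e, he⟩ := (X_prime (R := R) (i := j)).pow_dvd_of_dvd_mul_left q hFj (Dvd.intro _ hκ)
    have hG : κ G = κ F * e := by
      apply mul_left_cancel₀ (pow_ne_zero q (X_ne_zero (R := R) j))
      rw [hκ, he]
      ring
    obtain ⟨a, ha⟩ := X_dvd_sub_aeval i F
    obtain ⟨b, hb⟩ := X_dvd_sub_aeval i G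
    have hG' : G = F * e + X i * (b - a * e) := by
      change F - κ F = _ at ha
      change G - κ G = _ at hb
      linear_combination hb - e * ha + hG
    obtain ⟨K, hK⟩ := ih (b - a * e) (dvd_of_dvd_X_pow_mul hFi (N := 1) ⟨c - X j ^ q * e, by
      rw [hG'] at hc
      linear_combination hc⟩)
    refine ⟨K, ?_⟩
    obtain ⟨u, hu⟩ := hK
    exact ⟨X i * u - e, by linear_combination X i * hu - hG'⟩

/-- A family of fractions `G_i / x_i ^ p` of degree `k` which agree modulo `F` is given by one
form of degree `k` modulo `F`. -/
theorem exists_form_of_compatible {d k p : ℕ} [Nontrivial τ] (hd : F.IsHomogeneous d)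
    (hF : ∀ i j a b, F ≠ X i * a + X j * b) (G : τ → MvPolynomial τ R)
    (hG : ∀ i, (G i).IsHomogeneous (p + k))
    (h : ∀ i j, F ∣ X j ^ p * G i - X i ^ p * G j) :
    ∃ K : MvPolynomial τ R, K.IsHomogeneous k ∧ ∀ i, F ∣ X i ^ p * K - G i := by
  have hX (i : τ) : ¬ X i ∣ F := fun ⟨a, ha⟩ ↦ hF i i a 0 (by rw [ha, mul_zero, add_zero])
  obtain ⟨i, j, hij⟩ := exists_pair_ne τ
  obtain ⟨K, c, hK⟩ := exists_dvd_X_pow_mul_sub (hF i j) hij p p (G i) (G j) (h i j)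
  -- Take components of degree p + k: that of a multiple of the homogeneous F is again a multiple of
  -- F, or zero if p + k < d.
  have key : F ∣ X i ^ p * (DirectSum.decompose (homogeneousSubmodule τ R) K k).1 - G i := by
    rw [← DirectSum.coe_decompose_mul_add_of_left_mem (homogeneousSubmodule τ R)
      ((isHomogeneous_X_pow i p : (X i ^ p : MvPolynomial τ R).IsHomogeneous p)),
      ← sub_add_cancel (X i ^ p * K) (G i), hK, DirectSum.decompose_add, DirectSum.add_apply,
      AddMemClass.coe_add, DirectSum.decompose_of_mem_same (x := G i) (i := p + k) _ (hG i), add_sub_cancel_right]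
    obtain hlt | hle := lt_or_ge (p + k) d
    · rw [DirectSum.coe_decompose_mul_of_left_mem_of_not_le _ hd hlt.not_ge]
      exact dvd_zero _
    · rw [DirectSum.coe_decompose_mul_of_left_mem_of_le _ hd hle]
      exact dvd_mul_right _ _
  -- The form found for one pair of indices works for every l: compatibility of i and l gives the
  -- claim after multiplication by x_i^p, which can be cancelled.
  refine ⟨_, (DirectSum.decompose (homogeneousSubmodule τ R) K k).2, fun l ↦ dvd_of_dvd_X_pow_mul (hX i) (N := p) ?_⟩
  obtain ⟨a, ha⟩ := key
  obtain ⟨b, hb⟩ := h i l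
  exact ⟨X l ^ p * a + b, by linear_combination X l ^ p * ha + hb⟩

end Divisibility

end Verlinde

namespace Verlinde

open TopologicalSpace

/-! ### Ideal sheaves given by one equation on each chart -/

section LocalEquations

variable {X : Scheme.{0}} {U V : X.Opens} {f : Γ(X, U)}

lemma exists_pow_mul_eq_zero (hU : IsAffineOpen U) (hV : V = X.basicOpen f) (h : V ≤ U) {r : Γ(X, U)}
    (hr : rres h r = 0) : ∃ N : ℕ, f ^ N * r = 0 := by
  subst hV
  exact exists_pow_mul_eq_zero_of_res_basicOpen_eq_zero_of_isCompact X hU.isCompact r f hr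

lemma exists_rres_eq_pow_mul (hU : IsAffineOpen U) (hV : V = X.basicOpen f) (h : V ≤ U)
    (t : Γ(X, V)) : ∃ (N : ℕ) (r : Γ(X, U)), rres h r = rres h f ^ N * t := by
  subst hV
  exact exists_eq_pow_mul_of_isAffineOpen X U hU f t

lemma isUnit_rres (hV : V ≤ X.basicOpen f) (h : V ≤ U) : IsUnit (rres h f) := by
  have h1 : IsUnit (rres (X.basicOpen_le f) f) := RingedSpace.isUnit_res_basicOpen _ f
  rw [← rres_rres (X.basicOpen_le f) hV]
  exact h1.map _

variable {κ : Type} (c : κ → X.Opens) (e : ∀ i, Γ(X, c i))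

/-- The functions on `U` which are multiples of `e i` on `U ∩ c i` for all `i`. -/
def localIdeal (U : X.Opens) : Ideal Γ(X, U) :=
  ⨅ i, (Ideal.span {rres (inf_le_right : U ⊓ c i ≤ c i) (e i)}).comap
    (rres (inf_le_left : U ⊓ c i ≤ U))

variable {c e} in
lemma mem_localIdeal {r : Γ(X, U)} : r ∈ localIdeal c e U ↔
    ∀ i, rres (inf_le_right : U ⊓ c i ≤ c i) (e i) ∣ rres (inf_le_left : U ⊓ c i ≤ U) r := by
  simp [localIdeal, Ideal.mem_span_singleton]

lemma localIdeal_map (h : V ≤ U) : (localIdeal c e U).map (rres h) ≤ localIdeal c e V := by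
  rw [Ideal.map_le_iff_le_comap]
  intro r hr
  rw [Ideal.mem_comap, mem_localIdeal]
  intro i
  simpa using map_dvd (rres (inf_le_inf_right (c i) h)) (mem_localIdeal.1 hr i)

/-- On a separated scheme, ideals given by equations on finitely many affine charts are
quasi-coherent. -/
lemma map_localIdeal_basicOpen [X.IsSeparated] [Finite κ] (hc : ∀ i, IsAffineOpen (c i))
    (hU : IsAffineOpen U) (f : Γ(X, U)) :
    (localIdeal c e U).map (rres (X.basicOpen_le f)) = localIdeal c e (X.basicOpen f) := by
  refine (localIdeal_map c e _).antisymm fun t ht ↦ ?_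
  cases nonempty_fintype κ
  have hle := X.basicOpen_le f
  obtain ⟨N, s, hs⟩ := exists_rres_eq_pow_mul hU rfl hle t
  -- Here `s` extends f^N t. On each chart, a further power of f clears the denominator of the
  -- cofactor and kills the discrepancy; finitely many charts allow a common power.
  have key (i : κ) : ∃ M : ℕ, rres (inf_le_right : U ⊓ c i ≤ c i) (e i) ∣
      rres (inf_le_left : U ⊓ c i ≤ U) (f ^ M * s) := by
    -- This is where separatedness enters.
    have hA : IsAffineOpen (U ⊓ c i) := hU.inf (hc i)
    have hD : X.basicOpen f ⊓ c i = X.basicOpen (rres (inf_le_left : U ⊓ c i ≤ U) f) := by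
      rw [Scheme.basicOpen_res]
      exact le_antisymm (le_inf (inf_le_inf_right _ hle) inf_le_left)
        (le_inf inf_le_right (inf_le_left.trans inf_le_right))
    have hle' : X.basicOpen f ⊓ c i ≤ U ⊓ c i := inf_le_inf_right _ hle
    obtain ⟨a, ha⟩ := mem_localIdeal.1 ht i
    obtain ⟨M, b, hb⟩ := exists_rres_eq_pow_mul hA hD hle' a
    obtain ⟨L, hL⟩ := exists_pow_mul_eq_zero hA hD hle' (r := rres inf_le_left (f ^ M * s) -
      rres inf_le_left (f ^ N) * rres inf_le_right (e i) * b) (by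
        have hs' := congrArg (rres (inf_le_left : X.basicOpen f ⊓ c i ≤ _)) hs
        simp only [map_mul, map_pow, map_sub, rres_rres] at hs' hb ha ⊢
        rw [hs', hb, ha]
        ring)
    refine ⟨L + M, rres inf_le_left (f ^ (N + L)) * b, ?_⟩
    simp only [map_mul, map_pow] at hL ⊢
    linear_combination hL
  choose M hM using key
  have hmem : f ^ (∑ i, M i) * s ∈ localIdeal c e U := by
    rw [mem_localIdeal]
    intro i
    have h1 : f ^ (∑ i, M i) * s = f ^ (∑ i, M i - M i) * (f ^ M i * s) := by
      rw [← mul_assoc, ← pow_add, Nat.sub_add_cancel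
        (Finset.single_le_sum (fun _ _ ↦ Nat.zero_le _) (Finset.mem_univ i))]
    rw [h1, map_mul]
    exact (hM i).mul_left _
  obtain ⟨u, hu⟩ := isUnit_rres (f := f) le_rfl hle
  have h2 : t = ↑(u⁻¹ ^ (∑ i, M i + N)) * rres hle (f ^ (∑ i, M i) * s) := by
    rw [map_mul, hs, map_pow, ← hu, ← mul_assoc (_ ^ _) (_ ^ _) t, ← pow_add, ← mul_assoc,
      ← Units.val_pow_eq_pow_val, ← Units.val_mul, ← mul_pow, inv_mul_cancel, one_pow, Units.val_one,
      one_mul]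
  rw [h2]
  exact Ideal.mul_mem_left _ _ (Ideal.mem_map_of_mem _ hmem)

/-- The ideals already commute with restriction to basic opens, so the largest ideal sheaf contained
in them is the family itself. -/
lemma ofIdeals_localIdeal [X.IsSeparated] [Finite κ] (hc : ∀ i, IsAffineOpen (c i))
    (U : X.affineOpens) :
    (Scheme.IdealSheafData.ofIdeals fun U ↦ localIdeal c e U.1).ideal U = localIdeal c e U.1 := by
  let K : X.IdealSheafData :=
    { ideal U := localIdeal c e U.1
      map_ideal_basicOpen U f := map_localIdeal_basicOpen c e hc U.2 f }
  exact congrArg (fun I ↦ I.ideal U) (Scheme.IdealSheafData.ofIdeals_ideal K)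

/-- If the equations agree up to factors on overlaps, then inside a chart the ideal is generated by
the equation of that chart. -/
lemma localIdeal_eq_span {i : κ} (h : U ≤ c i)
    (he : ∀ j, rres (inf_le_right : c i ⊓ c j ≤ c j) (e j) ∣ rres inf_le_left (e i)) :
    localIdeal c e U = Ideal.span {rres h (e i)} := by
  refine le_antisymm (fun r hr ↦ ?_) ?_
  · rw [Ideal.mem_span_singleton]
    simpa using map_dvd (rres (le_inf le_rfl h : U ≤ U ⊓ c i)) (mem_localIdeal.1 hr i)
  · rw [Ideal.span_singleton_le_iff_mem, mem_localIdeal]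
    intro j
    simpa using map_dvd (rres (inf_le_inf_right (c j) h)) (he j)

end LocalEquations

end Verlinde

/-! ### Constants, and linear independence after base change -/

namespace Verlinde

open TopologicalSpace MvPolynomial Limits
attribute [local instance] MvPolynomial.gradedAlgebra
open Proj

variable {σ : Type} (i : σ)

/-- Constants as fractions of degree zero. -/
def constantsToAway : CommRingCat.of ℂ ⟶
    CommRingCat.of (HomogeneousLocalization.Away (homogeneousSubmodule σ ℂ) (X i)) :=
  CommRingCat.ofHom (algebraMap ℂ (homogeneousSubmodule σ ℂ 0)) ≫
    CommRingCat.ofHom (HomogeneousLocalization.fromZeroRingHom (homogeneousSubmodule σ ℂ) _)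

lemma ι_projSpaceToSpec : (stdOpen i).ι ≫ projSpaceToSpec σ = (stdOpen i).toSpecΓ ≫
    Spec.map (constantsToAway i ≫ awayToSection (homogeneousSubmodule σ ℂ) (X i)) := by
  have h := awayι_toSpecZero (homogeneousSubmodule σ ℂ) (f := X i) (X_mem i) one_pos
  rw [← basicOpenIsoSpec_inv_ι, Category.assoc, Iso.inv_comp_eq] at h
  rw [projSpaceToSpec, reassoc_of% h]
  simp [basicOpenIsoSpec_hom, basicOpenToSpec, constantsToAway]

lemma projSpaceToSpec_appLE (c : ℂ) : ((projSpaceToSpec σ).appLE ⊤ (stdOpen i) (by simp)).hom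
    ((Scheme.ΓSpecIso (.of ℂ)).inv.hom c) = cst (stdOpen i) c := by
  have h := congrArg (fun φ ↦ (Scheme.ΓSpecIso (.of ℂ)).inv ≫ Scheme.Hom.appTop φ ≫ (stdOpen i).topIso.hom) (ι_projSpaceToSpec i)
  simp only [Scheme.Hom.comp_appTop, Category.assoc, ← Scheme.ΓSpecIso_inv_naturality_assoc,
    Scheme.Opens.toSpecΓ_appTop, Iso.inv_hom_id, Category.comp_id] at h
  have h2 : (projSpaceToSpec σ).appLE ⊤ (stdOpen i) (by simp) = (projSpaceToSpec σ).appTop ≫ (stdOpen i).ι.appTop ≫ (stdOpen i).topIso.hom := by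
    simp only [Scheme.Hom.appLE, Scheme.Opens.ι_appTop, Scheme.Opens.topIso_hom]
    rfl
  rw [h2, ← CommRingCat.comp_apply, h]
  refine fun_ext fun x hx ↦ (evalAt_cst hx c).symm ▸ ?_
  exact Localization.mk_one_eq_algebraMap _



/-- Coordinate functionals dual to the independent family extend `A`-linearly to the base change and
read off each coefficient. -/
lemma eq_zero_of_isBaseChange {K A M N : Type} [Field K] [CommRing A] [Algebra K A] [AddCommGroup M]
    [Module K M] [AddCommGroup N] [Module A N] [Module K N] [IsScalarTower K A N] {b : M →ₗ[K] N}
    (hb : IsBaseChange A b) {κ : Type} [Fintype κ] (w : κ → M) (hw : LinearIndependent K w)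
    (r : κ → A) (hr : ∑ k, r k • b (w k) = 0) : r = 0 := by
  classical
  obtain ⟨φ, hφ⟩ := LinearMap.exists_leftInverse_of_injective (Fintype.linearCombination K w)
    (LinearMap.ker_eq_bot.2 hw.fintypeLinearCombination_injective)
  funext k
  have hψ (l : κ) : hb.lift (Algebra.linearMap K A ∘ₗ LinearMap.proj k ∘ₗ φ) (b (w l)) =
      if l = k then 1 else 0 := by
    have h2 := LinearMap.congr_fun hφ (Pi.single l 1)
    simp only [LinearMap.comp_apply, Fintype.linearCombination_apply_single, one_smul,
      LinearMap.id_apply] at h2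
    rw [IsBaseChange.lift_eq, LinearMap.comp_apply, LinearMap.comp_apply, h2, LinearMap.proj_apply,
      Pi.single_apply]
    simp [eq_comm]
  have h3 := congrArg (hb.lift (Algebra.linearMap K A ∘ₗ LinearMap.proj k ∘ₗ φ)) hr
  simp only [map_sum, map_smul, hψ, map_zero] at h3
  simpa using h3

open CommRingCat in
lemma eq_zero_of_isPushout {K : Type} [Field K] {A B Z : CommRingCat.{0}} {f : .of K ⟶ A}
    {g : .of K ⟶ B} {a : A ⟶ Z} {b : B ⟶ Z} (H : IsPushout f g a b) {κ : Type} [Fintype κ]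
    (w : κ → B) (hw : ∀ c : κ → K, ∑ k, g.hom (c k) * w k = 0 → c = 0) (r : κ → A)
    (hr : ∑ k, a.hom (r k) * b.hom (w k) = 0) : r = 0 := by
  algebraize [f.hom, g.hom, a.hom, b.hom, a.hom.comp f.hom]
  have : IsScalarTower K B Z := .of_algebraMap_eq fun x ↦ congr($(H.w) x)
  have hp : Algebra.IsPushout K A B Z := isPushout_iff_isPushout.mp H
  refine eq_zero_of_isBaseChange hp.out w ?_ r ?_
  · rw [Fintype.linearIndependent_iff]
    intro c hc
    refine congrFun (hw c ?_)
    rw [← hc]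
    exact Finset.sum_congr rfl fun k _ ↦ (Algebra.smul_def (c k) (w k)).symm
  · rw [← hr]
    exact Finset.sum_congr rfl fun k _ ↦ (Algebra.smul_def (r k) (b.hom (w k)))

end Verlinde

namespace Verlinde

open TopologicalSpace MvPolynomial Limits
attribute [local instance] MvPolynomial.gradedAlgebra

/-! ### Dehomogenization on a standard chart -/

section Coordinates

variable {σ : Type}

lemma exists_eq_stdFraction (i : σ) (r : Γ(projSpace σ, stdOpen i)) :
    ∃ (m : ℕ) (p : homogeneousSubmodule σ ℂ m), r = stdFraction i m p := by
  obtain ⟨z, rfl⟩ := (ConcreteCategory.bijective_of_isIso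
    (Proj.basicOpenIsoAway (homogeneousSubmodule σ ℂ) (X i) (X_mem i) one_pos).hom).2 r
  obtain ⟨m, p, hp, rfl⟩ := HomogeneousLocalization.Away.mk_surjective
    (homogeneousSubmodule σ ℂ) (X_mem i) z
  exact ⟨m, ⟨p, by simpa using hp⟩, rfl⟩

lemma eval₂_ratio (i : σ) {m : ℕ} (p : homogeneousSubmodule σ ℂ m) :
    eval₂Hom (cst (stdOpen i)) (fun l ↦ ratio l i) p.1 = stdFraction i m p := by
  refine fun_ext fun x hx ↦ ?_
  rw [evalAt_stdFraction]
  have h1 : (evalAt x hx).comp (eval₂Hom (cst (stdOpen i)) (fun l ↦ ratio l i)) =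
      eval₂Hom ((valAt x).comp C) (fun l ↦ valAt x (X l) *
        ((unitAt hx)⁻¹ : (LocalAt (homogeneousSubmodule σ ℂ) x)ˣ).val) := by
    apply MvPolynomial.ringHom_ext
    · intro c
      simp [evalAt_cst]
    · intro l
      simp [evalAt_ratio]
  have h2 := RingHom.congr_fun h1 p.1
  refine h2.trans ?_
  have h3 : valAt x p.1 = eval₂Hom ((valAt x).comp C) (fun l ↦ valAt x (X l)) p.1 := by
    congr 1
    apply MvPolynomial.ringHom_ext <;> simp
  rw [h3, coe_eval₂Hom, coe_eval₂Hom, eval₂_eq, eval₂_eq, Finset.sum_mul]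
  refine Finset.sum_congr rfl fun e he ↦ ?_
  have h4 : ∑ l ∈ e.support, e l = m := by
    have := p.2 (mem_support_iff.1 he)
    rw [← this, ← Finsupp.degree_apply, Finsupp.degree_eq_weight_one]
    rfl
  simp only [mul_pow, Finset.prod_mul_distrib]
  rw [Finset.prod_pow_eq_pow_sum, h4, mul_assoc, ← inv_pow, Units.val_pow_eq_pow_val]

lemma valAt_injective (x : projSpace σ) : Function.Injective (valAt x) :=
  have : x.asHomogeneousIdeal.toIdeal.IsPrime := ProjectiveSpectrum.isPrime x
  IsLocalization.injective (M := primeComplAt x) (LocalAt (homogeneousSubmodule σ ℂ) x)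
    (Ideal.primeCompl_le_nonZeroDivisors x.asHomogeneousIdeal.toIdeal)

lemma stdFraction_injective (i : σ) {m : ℕ} {p : homogeneousSubmodule σ ℂ m}
    (U : (projSpace σ).Opens) {x : projSpace σ} (hx : x ∈ U) (h : U ≤ stdOpen i)
    (hp : rres h (stdFraction i m p) = 0) : p = 0 := by
  have := congrArg (evalAt x hx) hp
  rw [evalAt_rres, evalAt_stdFraction, map_zero, Units.mul_left_eq_zero] at this
  exact Subtype.ext (valAt_injective x (this.trans (map_zero _).symm))

lemma nonempty_stdOpen (i : σ) : ∃ x : projSpace σ, x ∈ stdOpen i := by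
  have h : ¬ HomogeneousIdeal.irrelevant (homogeneousSubmodule σ ℂ) ≤ ⊥ := fun h ↦
    X_ne_zero (R := ℂ) i (h (HomogeneousIdeal.mem_irrelevant_of_mem _ one_pos (X_mem i)))
  exact ⟨⟨⊥, Ideal.isPrime_bot, h⟩, X_ne_zero i⟩

end Coordinates


/-! ### Functions on {x_i ≠ 0} × U as polynomials over the functions on U -/

section Charts

variable {n d : ℕ} {i j : Fin (n + 1)} {U V : (linearSystem n d).Opens}

/-- The open subset `{x_i ≠ 0} × U` of `ℙⁿ × |𝒪(d)|`. -/
def chartOver (i : Fin (n + 1)) (U : (linearSystem n d).Opens) : (ambient n d).Opens :=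
  ambientFst n d ⁻¹ᵁ stdOpen i ⊓ ambientSnd n d ⁻¹ᵁ U

/-- The pullback to `{x_i ≠ 0} × U` of functions on `{x_i ≠ 0}`. -/
def fstFun (i : Fin (n + 1)) (U : (linearSystem n d).Opens) :
    Γ(projSpace (Fin (n + 1)), stdOpen i) →+* Γ(ambient n d, chartOver i U) :=
  ((ambientFst n d).appLE (stdOpen i) (chartOver i U) inf_le_left).hom

/-- The pullback to `{x_i ≠ 0} × U` of functions on `U`. -/
def sndFun (i : Fin (n + 1)) (U : (linearSystem n d).Opens) :
    Γ(linearSystem n d, U) →+* Γ(ambient n d, chartOver i U) :=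
  ((ambientSnd n d).appLE U (chartOver i U) inf_le_right).hom

/-- The function on `{x_i ≠ 0} × U` given by a form with coefficients in the functions on `U`. -/
def coordMap (i : Fin (n + 1)) (U : (linearSystem n d).Opens) :
    MvPolynomial (Fin (n + 1)) Γ(linearSystem n d, U) →+* Γ(ambient n d, chartOver i U) :=
  eval₂Hom (sndFun i U) fun l ↦ fstFun i U (ratio l i)

@[simp] lemma coordMap_C (r : Γ(linearSystem n d, U)) : coordMap i U (C r) = sndFun i U r :=
  eval₂Hom_C _ _ _

@[simp] lemma coordMap_X (l : Fin (n + 1)) : coordMap i U (X l) = fstFun i U (ratio l i) :=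
  eval₂Hom_X' _ _ _

lemma coordMap_X_self : coordMap i U (X i) = 1 := by
  rw [coordMap_X, ratio_self, map_one]

/-- Constants as functions on an open subset of `|𝒪(d)|`. -/
def scalarHom (U : (linearSystem n d).Opens) : .of ℂ ⟶ Γ(linearSystem n d, U) :=
  (Scheme.ΓSpecIso (.of ℂ)).inv ≫ (projSpaceToSpec _).appLE ⊤ U (by simp)

/-- The functions on a product of affines over ℂ are the tensor product of the functions on the
factors. -/
lemma isPushout_chartOver (i : Fin (n + 1)) (hU : IsAffineOpen U) :
    IsPushout (scalarHom U)
      (CommRingCat.ofHom (S := Γ(projSpace (Fin (n + 1)), stdOpen i)) (cst (stdOpen i)))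
      ((ambientSnd n d).appLE U (chartOver i U) inf_le_right)
      ((ambientFst n d).appLE (stdOpen i) (chartOver i U) inf_le_left) := by
  have hi : IsAffineOpen (stdOpen i) := Proj.isAffineOpen_basicOpen _ (X i) (X_mem i) one_pos
  have h1 := (isIso_pushoutSection_iff _ _ _ _).1 (isIso_pushoutSection_of_isAffineOpen
    (IsPullback.of_hasPullback
      (projSpaceToSpec (Fin (n + 1))) (projSpaceToSpec (MonomialIndex n d)))
    (US := ⊤) (UT := U) (UX := stdOpen i) (by simp) (by simp) (UY := chartOver i U) rfl
    (isAffineOpen_top _) hU hi)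
  refine IsPushout.of_iso h1.flip (Scheme.ΓSpecIso (.of ℂ)) (.refl _) (.refl _) (.refl _) ?_ ?_ ?_ ?_
  · simp [scalarHom]
  · rw [← Iso.inv_comp_eq]
    ext c
    simpa using projSpaceToSpec_appLE i c
  · simp
  · simp

lemma sndFun_scalarHom (hU : IsAffineOpen U) (c : ℂ) :
    sndFun i U ((scalarHom U).hom c) = fstFun i U (cst (stdOpen i) c) :=
  congr($((isPushout_chartOver i hU).w) c)

lemma coordMap_map (hU : IsAffineOpen U) (p : MvPolynomial (Fin (n + 1)) ℂ) :
    coordMap i U (map (scalarHom U).hom p) =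
      fstFun i U (eval₂Hom (cst (stdOpen i)) (fun l ↦ ratio l i) p) := by
  have : (coordMap i U).comp (map (scalarHom U).hom) =
      (fstFun i U).comp (eval₂Hom (cst (stdOpen i)) fun l ↦ ratio l i) := by
    apply MvPolynomial.ringHom_ext
    · intro c
      simp [sndFun_scalarHom hU]
    · intro l
      simp
  exact RingHom.congr_fun this p

lemma coordMap_monomial (m : ℕ) (I : Fin (n + 1) →₀ ℕ)
    (hI : (monomial I (1 : ℂ)).IsHomogeneous m) :
    coordMap i U (monomial I 1) = fstFun i U (stdFraction i m ⟨monomial I 1, hI⟩) := by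
  rw [← eval₂_ratio]
  simp [coordMap, eval₂_monomial]

lemma coordMap_monomial_eq_mul (m : ℕ) (I : Fin (n + 1) →₀ ℕ)
    (hI : (monomial I (1 : ℂ)).IsHomogeneous m) (r : Γ(linearSystem n d, U)) :
    coordMap i U (monomial I r) =
      sndFun i U r * fstFun i U (stdFraction i m ⟨monomial I 1, hI⟩) := by
  rw [← coordMap_monomial, ← coordMap_C, ← map_mul, C_mul_monomial, mul_one]

lemma coordMap_surjective (hU : IsAffineOpen U) : Function.Surjective (coordMap i U) := by
  have h := CommRingCat.closure_range_union_range_eq_top_of_isPushout (isPushout_chartOver i hU)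
  rw [← RingHom.range_eq_top, ← top_le_iff, ← h, Subring.closure_le]
  rintro _ (⟨r, rfl⟩ | ⟨r, rfl⟩)
  · exact ⟨C r, coordMap_C r⟩
  · obtain ⟨m, p, rfl⟩ := exists_eq_stdFraction i r
    refine ⟨map (scalarHom U).hom p.1, ?_⟩
    rw [coordMap_map hU, eval₂_ratio]
    rfl

/-- Since x_i maps to 1, each homogeneous component can be multiplied by the missing power of x_i.
-/
lemma exists_isHomogeneous_coordMap_eq (G : MvPolynomial (Fin (n + 1)) Γ(linearSystem n d, U))
    {m : ℕ} (hm : G.totalDegree ≤ m) : ∃ H : MvPolynomial (Fin (n + 1)) Γ(linearSystem n d, U),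
      H.IsHomogeneous m ∧ coordMap i U H = coordMap i U G := by
  refine ⟨∑ k ∈ Finset.range (m + 1), X i ^ (m - k) * homogeneousComponent k G,
    IsHomogeneous.sum _ _ _ fun k hk ↦ ?_, ?_⟩
  · rw [Finset.mem_range] at hk
    have := (isHomogeneous_X_pow (R := Γ(linearSystem n d, U)) i (m - k)).mul
      (homogeneousComponent_isHomogeneous k G)
    rwa [Nat.sub_add_cancel (by omega)] at this
  · rw [map_sum]
    simp only [map_mul, map_pow, coordMap_X_self, one_pow, one_mul]
    rw [← map_sum]
    congr 1
    conv_rhs => rw [← sum_homogeneousComponent G]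
    refine (Finset.sum_subset (Finset.range_mono (by omega)) fun k _ hk ↦ ?_).symm
    exact homogeneousComponent_eq_zero _ _ (by simpa using hk)

lemma degree_eq_of_isHomogeneous {τ R : Type} [CommSemiring R] {m : ℕ} {G : MvPolynomial τ R}
    (hG : G.IsHomogeneous m) {I : τ →₀ ℕ} (hI : I ∈ G.support) : I.degree = m := by
  rw [Finsupp.degree_eq_weight_one]
  exact hG (mem_support_iff.1 hI)

/-- The fractions x^I / x_i^m with |I| = m are independent over ℂ, hence over the functions on `U`
by base change. -/
lemma coordMap_eq_zero (hU : IsAffineOpen U) {m : ℕ}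
    {G : MvPolynomial (Fin (n + 1)) Γ(linearSystem n d, U)} (hG : G.IsHomogeneous m)
    (h : coordMap i U G = 0) : G = 0 := by
  have hm (I : G.support) : (monomial I.1 (1 : ℂ)).IsHomogeneous m :=
    isHomogeneous_monomial 1 (degree_eq_of_isHomogeneous hG I.2)
  have key := eq_zero_of_isPushout (isPushout_chartOver i hU)
    (fun I : G.support ↦ stdFraction i m ⟨monomial I.1 1, hm I⟩) (fun c hc ↦ ?_)
    (fun I ↦ coeff I.1 G) ?_
  · ext I
    by_contra hI
    exact hI (congrFun key ⟨I, mem_support_iff.2 hI⟩)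
  · have h1 : (∑ I : G.support, c I • (⟨monomial I.1 1, hm I⟩ : homogeneousSubmodule (Fin (n + 1)) ℂ m)) = 0 := by
      obtain ⟨x, hx⟩ := nonempty_stdOpen i
      refine stdFraction_injective i (stdOpen i) hx le_rfl ?_
      rw [rres_self, ← eval₂_ratio, ← hc]
      simp only [← eval₂_ratio, AddSubmonoidClass.coe_finsetSum, Submodule.coe_smul, map_sum,
        smul_eq_C_mul, map_mul]
      refine Finset.sum_congr rfl fun I _ ↦ ?_
      rw [eval₂Hom_C]
      rfl
    funext I
    have h2 := congrArg (coeff I.1) (congrArg Subtype.val h1)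
    simp only [AddSubmonoidClass.coe_finsetSum, Submodule.coe_smul, coeff_sum, coeff_smul,
      coeff_monomial] at h2
    rw [Finset.sum_eq_single I (fun J _ hJ ↦ by rw [if_neg fun h ↦ hJ (Subtype.ext h), smul_zero])
      (by simp)] at h2
    simpa using h2
  · rw [← h]
    conv_rhs => rw [G.as_sum, map_sum, ← Finset.sum_coe_sort]
    exact Finset.sum_congr rfl fun I _ ↦ (coordMap_monomial_eq_mul m I.1 (hm I) _).symm

end Charts

/-! ### Changes of chart -/

section AppLE

variable {X Y : Scheme.{0}} (f : X ⟶ Y) {U U' : Y.Opens} {V V' : X.Opens}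

lemma rres_appLE (h : V ≤ f ⁻¹ᵁ U) (h' : V' ≤ V) (r : Γ(Y, U)) :
    rres h' ((f.appLE U V h).hom r) = (f.appLE U V' (h'.trans h)).hom r :=
  congr($(Scheme.Hom.appLE_map f h (homOfLE h').op) r)

lemma appLE_rres (h : V ≤ f ⁻¹ᵁ U) (h' : U ≤ U') (r : Γ(Y, U')) :
    (f.appLE U V h).hom (rres h' r) = (f.appLE U' V (h.trans fun _ hx ↦ h' hx)).hom r :=
  congr($(Scheme.Hom.map_appLE f h (homOfLE h').op) r)

end AppLE

lemma eval₂_mul_of_isHomogeneous {τ R S : Type} [CommSemiring R] [CommSemiring S] (f : R →+* S)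
    (g : τ → S) (u : S) {m : ℕ} {G : MvPolynomial τ R} (hG : G.IsHomogeneous m) :
    eval₂ f (fun l ↦ g l * u) G = eval₂ f g G * u ^ m := by
  rw [eval₂_eq, eval₂_eq, Finset.sum_mul]
  refine Finset.sum_congr rfl fun e he ↦ ?_
  have h4 : ∑ l ∈ e.support, e l = m := degree_eq_of_isHomogeneous hG he
  simp only [mul_pow, Finset.prod_mul_distrib]
  rw [Finset.prod_pow_eq_pow_sum, h4, mul_assoc]

section Ratio

variable {σ : Type}

lemma rres_ratio_mul {U : (projSpace σ).Opens} (i j l : σ) (hi : U ≤ stdOpen i)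
    (hj : U ≤ stdOpen j) : rres hi (ratio l i) * rres hj (ratio i j) = rres hj (ratio l j) := by
  refine fun_ext fun x hx ↦ ?_
  rw [map_mul, evalAt_rres, evalAt_rres, evalAt_rres, evalAt_ratio, evalAt_ratio, evalAt_ratio,
    ← unitAt_val (hi hx), mul_assoc, ← mul_assoc _ (unitAt (hi hx)).val, Units.inv_mul, one_mul]

lemma basicOpen_ratio (i j : σ) : (projSpace σ).basicOpen (ratio i j) = stdOpen i ⊓ stdOpen j := by
  apply le_antisymm
  · refine le_inf (fun x hx ↦ ?_) (Scheme.basicOpen_le _ _)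
    have hj := (projSpace σ).basicOpen_le (ratio i j)
    have h := (isUnit_rres (f := ratio i j) le_rfl hj).map (evalAt x hx)
    rw [evalAt_rres, evalAt_ratio, Units.isUnit_mul_units] at h
    have h2 : x.asHomogeneousIdeal.toIdeal.IsPrime := ProjectiveSpectrum.isPrime x
    exact (IsLocalization.AtPrime.isUnit_to_map_iff (LocalAt (homogeneousSubmodule σ ℂ) x)
      x.asHomogeneousIdeal.toIdeal (X i)).1 h
  · intro x hx
    have h' := rres_ratio_mul (U := stdOpen i ⊓ stdOpen j) i j j inf_le_left inf_le_right
    have h2 : IsUnit (rres (inf_le_right : stdOpen i ⊓ stdOpen j ≤ stdOpen j) (ratio i j)) :=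
      .of_mul_eq_one (rres inf_le_left (ratio j i)) (by rw [mul_comm, h', ratio_self, map_one])
    have h3 := Scheme.basicOpen_of_isUnit _ h2
    rw [Scheme.basicOpen_res] at h3
    exact (h3.ge hx).2

end Ratio

section Overlap

variable {n d : ℕ} {U V : (linearSystem n d).Opens}

lemma chartOver_mono (i : Fin (n + 1)) (h : V ≤ U) : chartOver i V ≤ chartOver i U :=
  inf_le_inf_left _ fun _ hx ↦ h hx

lemma rres_sndFun {i : Fin (n + 1)} {W : (ambient n d).Opens} (h : W ≤ chartOver i U)
    (r : Γ(linearSystem n d, U)) : rres h (sndFun i U r) =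
      ((ambientSnd n d).appLE U W (h.trans inf_le_right)).hom r :=
  rres_appLE _ _ _ _

lemma rres_fstFun {i : Fin (n + 1)} {W : (ambient n d).Opens} (h : W ≤ chartOver i U)
    (r : Γ(projSpace (Fin (n + 1)), stdOpen i)) : rres h (fstFun i U r) =
      ((ambientFst n d).appLE (stdOpen i) W (h.trans inf_le_left)).hom r :=
  rres_appLE _ _ _ _

lemma rres_coordMap_eq {i : Fin (n + 1)} {W : (ambient n d).Opens} (h : W ≤ chartOver i U)
    (G : MvPolynomial (Fin (n + 1)) Γ(linearSystem n d, U)) : rres h (coordMap i U G) =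
      eval₂ ((ambientSnd n d).appLE U W (h.trans inf_le_right)).hom (fun l ↦
        ((ambientFst n d).appLE (stdOpen i) W (h.trans inf_le_left)).hom (ratio l i)) G := by
  rw [coordMap, coe_eval₂Hom]
  refine (hom_eval₂ _ _ _ _).trans ?_
  congr 1
  · ext r
    exact rres_sndFun h r
  · ext l
    exact rres_fstFun h _

lemma rres_coordMap (i : Fin (n + 1)) (h : V ≤ U)
    (G : MvPolynomial (Fin (n + 1)) Γ(linearSystem n d, U)) :
    rres (chartOver_mono i h) (coordMap i U G) = coordMap i V (map (rres h) G) := by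
  rw [rres_coordMap_eq, coordMap, coe_eval₂Hom, eval₂_map]
  congr 1
  ext r
  exact (appLE_rres _ _ h r).symm

/-- Change of coordinates. -/
lemma rres_coordMap_mul {i j : Fin (n + 1)} {W : (ambient n d).Opens} (hi : W ≤ chartOver i U)
    (hj : W ≤ chartOver j U) {m : ℕ} {G : MvPolynomial (Fin (n + 1)) Γ(linearSystem n d, U)}
    (hG : G.IsHomogeneous m) :
    rres hi (coordMap i U G) * rres hj (coordMap j U (X i)) ^ m = rres hj (coordMap j U G) := by
  rw [rres_coordMap_eq, rres_coordMap_eq, rres_coordMap_eq, eval₂_X,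
    ← eval₂_mul_of_isHomogeneous _ _ _ hG]
  congr 1
  ext l
  have h1 : W ≤ ambientFst n d ⁻¹ᵁ (stdOpen i ⊓ stdOpen j) :=
    le_inf (hi.trans inf_le_left) (hj.trans inf_le_left)
  have h2 := congrArg ((ambientFst n d).appLE _ W h1).hom
    (rres_ratio_mul (U := stdOpen i ⊓ stdOpen j) i j l inf_le_left inf_le_right)
  rwa [map_mul, appLE_rres, appLE_rres, appLE_rres] at h2

lemma basicOpen_coordMap_X (i j : Fin (n + 1)) :
    (ambient n d).basicOpen (coordMap j U (X i)) = chartOver i U ⊓ chartOver j U := by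
  rw [coordMap_X, fstFun]
  refine (Scheme.basicOpen_appLE _ _ _ _ _).trans ?_
  rw [basicOpen_ratio]
  refine le_antisymm ?_ ?_
  · exact le_inf (le_inf (fun x hx ↦ hx.2.1) (inf_le_left.trans inf_le_right)) inf_le_left
  · exact le_inf inf_le_right fun x hx ↦ ⟨hx.1.1, hx.2.1⟩

end Overlap

/-! ### The universal form and the ideal of the universal hypersurface -/

section UniversalForm

variable {n d : ℕ} {U V : (linearSystem n d).Opens} {J J' : MonomialIndex n d}

/-- The universal form `∑ (α_I / α_J) x ^ I` with coefficients in the functions on `U`. -/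
def universalForm (h : U ≤ stdOpen J) : MvPolynomial (Fin (n + 1)) Γ(linearSystem n d, U) :=
  ∑ I : MonomialIndex n d, monomial I.1 (rres h (ratio I J))

lemma isHomogeneous_universalForm (h : U ≤ stdOpen J) : (universalForm h).IsHomogeneous d :=
  IsHomogeneous.sum _ _ _ fun I _ ↦ isHomogeneous_monomial _ (degree_monomialIndex I)

lemma coeff_universalForm (h : U ≤ stdOpen J) (I : MonomialIndex n d) :
    coeff I.1 (universalForm h) = rres h (ratio I J) := by
  rw [universalForm, coeff_sum]
  simp only [coeff_monomial]
  rw [Finset.sum_eq_single I (fun K _ hK ↦ if_neg fun h ↦ hK (Subtype.ext h)) (by simp), if_pos rfl]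

lemma rres_ratio_ne_zero (h : U ≤ stdOpen J) {x : linearSystem n d} (hx : x ∈ U)
    (I : MonomialIndex n d) : rres h (ratio I J) ≠ 0 := fun h0 ↦
  X_ne_zero (R := ℂ) I (congrArg Subtype.val (stdFraction_injective J U hx h h0))

lemma map_universalForm (h : U ≤ stdOpen J) (h' : V ≤ U) :
    map (rres h') (universalForm h) = universalForm (h'.trans h) := by
  simp [universalForm, map_monomial]

lemma universalForm_eq_mul (h : U ≤ stdOpen J) (h' : U ≤ stdOpen J') :
    universalForm h = C (rres h (ratio J' J)) * universalForm h' := by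
  rw [universalForm, universalForm, Finset.mul_sum]
  refine Finset.sum_congr rfl fun I _ ↦ ?_
  rw [C_mul_monomial, ← rres_ratio_mul J' J I h' h, mul_comm]

lemma coordMap_universalForm (h : U ≤ stdOpen J) (i : Fin (n + 1)) :
    coordMap i U (universalForm h) =
      rres (chartOver_mono i h : chartOver i U ≤ chart i J) (chartEquation i J) := by
  rw [← map_universalForm le_rfl h, ← rres_coordMap]
  congr 1
  rw [universalForm, map_sum, chartEquation]
  refine Finset.sum_congr rfl fun I _ ↦ ?_
  rw [coordMap_monomial_eq_mul d I.1 (isHomogeneous_monomial 1 (degree_monomialIndex I)), rres_self]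
  rfl

instance (σ : Type) : IsSeparated (projSpaceToSpec σ) := by
  unfold projSpaceToSpec
  infer_instance

instance : (ambient n d).IsSeparated := by
  constructor
  rw [← terminal.comp_from (ambientFst n d ≫ projSpaceToSpec _)]
  infer_instance

lemma isAffineOpen_chartOver (i : Fin (n + 1)) (hU : IsAffineOpen U) :
    IsAffineOpen (chartOver i U) := by
  have hi : IsAffineOpen (stdOpen i) := Proj.isAffineOpen_basicOpen _ (X i) (X_mem i) one_pos
  have : IsAffine _ := hU
  have : IsAffine _ := hi
  have : IsAffine ((⊤ : (Spec (.of ℂ)).Opens) : Scheme) := isAffineOpen_top _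
  exact .of_isIso (Scheme.Hom.isPullback_resLE (IsPullback.of_hasPullback
    (projSpaceToSpec (Fin (n + 1))) (projSpaceToSpec (MonomialIndex n d)))
    (US := ⊤) (UT := U) (UX := stdOpen i) (by simp) (by simp) (UY := chartOver i U)
    rfl).isoPullback.hom

lemma isAffineOpen_stdOpen {σ : Type} (i : σ) : IsAffineOpen (stdOpen i) :=
  Proj.isAffineOpen_basicOpen _ (X i) (X_mem i) one_pos

/-- On overlaps the chart equations differ by α_{J'}/α_J and a power of a ratio of the x's, so each
divides the other's restriction and the ideal is principal inside a chart. -/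
theorem universalIdeal_chartOver (h : U ≤ stdOpen J) (i : Fin (n + 1)) (hU : IsAffineOpen U) :
    (universalIdeal n d).ideal ⟨chartOver i U, isAffineOpen_chartOver i hU⟩ =
      Ideal.span {coordMap i U (universalForm h)} := by
  let c (p : Fin (n + 1) × MonomialIndex n d) : (ambient n d).Opens := chart p.1 p.2
  let e (p : Fin (n + 1) × MonomialIndex n d) : Γ(ambient n d, c p) := chartEquation p.1 p.2
  have h1 : universalIdeal n d = Scheme.IdealSheafData.ofIdeals fun U ↦ localIdeal c e U.1 := by
    rw [universalIdeal]
    congr 1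
    funext U
    exact (iInf_prod (f := fun p : Fin (n + 1) × MonomialIndex n d ↦
      (Ideal.span {rres (inf_le_right : U.1 ⊓ c p ≤ c p) (e p)}).comap
        (rres (inf_le_left : U.1 ⊓ c p ≤ U.1)))).symm
  have hc (p) : IsAffineOpen (c p) := isAffineOpen_chartOver p.1 (isAffineOpen_stdOpen p.2)
  rw [h1, ofIdeals_localIdeal c e hc, localIdeal_eq_span c e (i := (i, J)) (chartOver_mono i h),
    coordMap_universalForm]
  · rfl
  intro p
  let W : (linearSystem n d).Opens := stdOpen J ⊓ stdOpen p.2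
  have hJ : W ≤ stdOpen J := inf_le_left
  have hp : W ≤ stdOpen p.2 := inf_le_right
  have hi : c (i, J) ⊓ c p ≤ chartOver i W := fun x hx ↦ ⟨hx.1.1, hx.1.2, hx.2.2⟩
  have hj : c (i, J) ⊓ c p ≤ chartOver p.1 W := fun x hx ↦ ⟨hx.2.1, hx.1.2, hx.2.2⟩
  have h2 := (congrArg (rres hi) (coordMap_universalForm hJ i)).trans (rres_rres _ _ _)
  have h3 := (congrArg (rres hj) (coordMap_universalForm hp p.1)).trans (rres_rres _ _ _)
  refine Dvd.dvd.trans (dvd_of_eq h3.symm) (Dvd.dvd.trans ?_ (dvd_of_eq h2))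
  rw [universalForm_eq_mul hJ hp, map_mul, map_mul]
  refine Dvd.dvd.mul_left ?_ _
  rw [← rres_coordMap_mul hj hi (isHomogeneous_universalForm hp)]
  exact dvd_mul_right _ _

end UniversalForm

/-! ### Functions on the universal hypersurface -/

section Family

variable {n d : ℕ} {U V : (linearSystem n d).Opens} {i j : Fin (n + 1)}

/-- The open subset of the universal family where `x_i ≠ 0` and the parameter lies in `U`. -/
abbrev famOpen (i : Fin (n + 1)) (U : (linearSystem n d).Opens) : (universalFamily n d).Opens :=
  (universalIdeal n d).subschemeι ⁻¹ᵁ chartOver i U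

/-- The function on the universal family given by a form with coefficients in the functions
on `U`. -/
def famMap (i : Fin (n + 1)) (U : (linearSystem n d).Opens) :
    MvPolynomial (Fin (n + 1)) Γ(linearSystem n d, U) →+* Γ(universalFamily n d, famOpen i U) :=
  ((universalIdeal n d).subschemeι.app (chartOver i U)).hom.comp (coordMap i U)

lemma famMap_X_self : famMap i U (X i) = 1 := by
  rw [famMap, RingHom.comp_apply, coordMap_X_self, map_one]

lemma famOpen_le (i : Fin (n + 1)) (U : (linearSystem n d).Opens) :
    famOpen i U ≤ universalMap n d ⁻¹ᵁ U := fun _ hx ↦ hx.2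

lemma famOpen_le' (i : Fin (n + 1)) (U : (linearSystem n d).Opens) :
    famOpen i U ≤ universalToSpace n d ⁻¹ᵁ stdOpen i := fun _ hx ↦ hx.1

lemma exists_mem_famOpen {x : universalFamily n d} (hx : x ∈ universalMap n d ⁻¹ᵁ U) :
    ∃ i, x ∈ famOpen i U := by
  obtain ⟨i, hi⟩ := exists_mem_stdOpen (universalToSpace n d x)
  exact ⟨i, hi, hx⟩

/-- All large degrees are provided, so that the charts can later share one degree. -/
lemma exists_famMap_eq (hU : IsAffineOpen U) (i : Fin (n + 1))
    (r : Γ(universalFamily n d, famOpen i U)) : ∃ m₀, ∀ m ≥ m₀,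
      ∃ G : MvPolynomial (Fin (n + 1)) Γ(linearSystem n d, U), G.IsHomogeneous m ∧
        famMap i U G = r := by
  obtain ⟨a, rfl⟩ := (universalIdeal n d).subschemeι_app_surjective
    ⟨chartOver i U, isAffineOpen_chartOver i hU⟩ r
  obtain ⟨G, rfl⟩ := coordMap_surjective hU a
  refine ⟨G.totalDegree, fun m hm ↦ ?_⟩
  obtain ⟨H, hH, e⟩ := exists_isHomogeneous_coordMap_eq (i := i) G hm
  exact ⟨H, hH, congrArg ((universalIdeal n d).subschemeι.app (chartOver i U)).hom e⟩

lemma rres_famMap_mul {W : (universalFamily n d).Opens} (hi : W ≤ famOpen i U)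
    (hj : W ≤ famOpen j U) {m : ℕ} {G : MvPolynomial (Fin (n + 1)) Γ(linearSystem n d, U)}
    (hG : G.IsHomogeneous m) :
    rres hi (famMap i U G) * rres hj (famMap j U (X i)) ^ m = rres hj (famMap j U G) := by
  have h1 : W ≤ (universalIdeal n d).subschemeι ⁻¹ᵁ (chartOver i U ⊓ chartOver j U) :=
    le_inf hi hj
  have h2 := congrArg ((universalIdeal n d).subschemeι.appLE _ W h1).hom
    (rres_coordMap_mul inf_le_left inf_le_right hG)
  rwa [map_mul, map_pow, appLE_rres, appLE_rres, appLE_rres] at h2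

lemma exists_famMap_X_pow_mul_eq_zero (hU : IsAffineOpen U)
    {G : MvPolynomial (Fin (n + 1)) Γ(linearSystem n d, U)}
    (h : rres (inf_le_right : famOpen i U ⊓ famOpen j U ≤ famOpen j U) (famMap j U G) = 0) :
    ∃ N : ℕ, famMap j U (X i ^ N * G) = 0 := by
  have h1 : IsAffineOpen (famOpen j U) := (isAffineOpen_chartOver j hU).preimage _
  have h2 : famOpen i U ⊓ famOpen j U = (universalFamily n d).basicOpen (famMap j U (X i)) := by
    refine Eq.trans ?_ (Scheme.preimage_basicOpen (universalIdeal n d).subschemeι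
      (coordMap j U (X i)))
    rw [basicOpen_coordMap_X]
    rfl
  obtain ⟨N, hN⟩ := exists_pow_mul_eq_zero h1 h2 inf_le_right h
  exact ⟨N, by rw [map_mul, map_pow, hN]⟩

variable {J : MonomialIndex n d}

lemma famMap_universalForm (h : U ≤ stdOpen J) (hU : IsAffineOpen U) (i : Fin (n + 1)) :
    famMap i U (universalForm h) = 0 := by
  have h1 := (universalIdeal n d).ker_subschemeι_app ⟨chartOver i U, isAffineOpen_chartOver i hU⟩
  rw [universalIdeal_chartOver h i hU] at h1
  exact (h1.ge (Ideal.mem_span_singleton_self _) : _)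

/-- As n ≥ 2 there is an index l other than i and j. The coefficient of x_l^d is a nonzero ratio of
coordinates, and this monomial avoids x_i and x_j. -/
lemma universalForm_ne (hn : 2 ≤ n) (h : U ≤ stdOpen J) {x : linearSystem n d} (hx : x ∈ U)
    (i j : Fin (n + 1)) (a b : MvPolynomial (Fin (n + 1)) Γ(linearSystem n d, U)) :
    universalForm h ≠ X i * a + X j * b := by
  obtain ⟨l, hl⟩ : ∃ l, l ∉ ({i, j} : Finset (Fin (n + 1))) := by
    by_contra! hall
    have h1 := Finset.card_le_card (fun l _ ↦ hall l : Finset.univ ⊆ _)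
    have h2 := Finset.card_le_two (a := i) (b := j)
    simp only [Finset.card_univ, Fintype.card_fin] at h1
    omega
  simp only [Finset.mem_insert, Finset.mem_singleton, not_or] at hl
  let I : MonomialIndex n d := ⟨Finsupp.single l d, by
    rw [Finset.mem_finsuppAntidiag]
    simp⟩
  refine not_eq_X_mul_add_X_mul (m := I.1) ?_ ?_ ?_ a b
  · rw [coeff_universalForm]
    exact rres_ratio_ne_zero h hx I
  · simp [I, hl.1]
  · simp [I, hl.2]

/-- On the chart the kernel is generated by the universal form. Homogenizing the cofactor gives
divisibility up to a power of x_i, which cancels since x_i does not divide the universal form. -/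
lemma famMap_eq_zero_iff (hn : 2 ≤ n) [IsDomain Γ(linearSystem n d, U)] (h : U ≤ stdOpen J)
    {x : linearSystem n d} (hx : x ∈ U) (hU : IsAffineOpen U) {m : ℕ}
    {G : MvPolynomial (Fin (n + 1)) Γ(linearSystem n d, U)} (hG : G.IsHomogeneous m) :
    famMap i U G = 0 ↔ universalForm h ∣ G := by
  constructor
  · intro hG0
    have h1 := (universalIdeal n d).ker_subschemeι_app ⟨chartOver i U, isAffineOpen_chartOver i hU⟩
    rw [universalIdeal_chartOver h i hU] at h1
    have h2 := h1.le hG0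
    obtain ⟨b, hb⟩ := Ideal.mem_span_singleton.1 h2
    obtain ⟨H, rfl⟩ := coordMap_surjective hU b
    -- The degree is chosen so that F·K and x_i^(d + deg H)·G have equal degree and dehomogenization
    -- is injective on their difference.
    obtain ⟨K, hK, e⟩ := exists_isHomogeneous_coordMap_eq (i := i) H (m := H.totalDegree + m) (by omega)
    have h3 : (universalForm h * K).IsHomogeneous (d + (H.totalDegree + m)) :=
      (isHomogeneous_universalForm h).mul hK
    have h4 : (X i ^ (d + H.totalDegree) * G).IsHomogeneous (d + (H.totalDegree + m)) := by
      have := (isHomogeneous_X_pow (R := Γ(linearSystem n d, U)) i (d + H.totalDegree)).mul hG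
      rwa [add_assoc] at this
    have h5 := coordMap_eq_zero (i := i) hU (h4.sub h3) (by
      rw [map_sub, map_mul, map_mul, e, map_pow, coordMap_X_self, hb]
      simp)
    have h6 : ¬ X i ∣ universalForm h := fun ⟨a, ha⟩ ↦
      universalForm_ne hn h hx i i a 0 (by rw [ha, mul_zero, add_zero])
    exact dvd_of_dvd_X_pow_mul h6 ⟨K, sub_eq_zero.1 h5⟩
  · rintro ⟨b, rfl⟩
    rw [map_mul, famMap_universalForm h hU, zero_mul]

end Family

/-! ### Generators and sections of ℒ^k on the universal hypersurface -/

section TwistOverlap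

variable {σ : Type}

lemma mres_twistGen {U : (projSpace σ).Opens} {i j : σ} (hi : U ≤ stdOpen i) (hj : U ≤ stdOpen j)
    (k : ℕ) : mres _ hi (twistGen (X_mem i) k) =
      rres hj (ratio i j) ^ k • mres _ hj (twistGen (X_mem j) k) := by
  refine twist_ext fun x hx ↦ ?_
  rw [secAt_smul, map_pow, evalAt_rres, evalAt_ratio, secAt_mres, secAt_mres, secAt_twistGen,
    secAt_twistGen, zpow_natCast, zpow_natCast, Units.val_pow_eq_pow_val, Units.val_pow_eq_pow_val,
    ← mul_pow, mul_assoc, Units.inv_mul, mul_one, unitAt_val]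

end TwistOverlap

section Sections

variable {n d k : ℕ} {U V : (linearSystem n d).Opens} {i j : Fin (n + 1)}

/-- The generator `x_i ^ k` of `ℒ ^ k` where `x_i ≠ 0`. -/
def famGen (i : Fin (n + 1)) (U : (linearSystem n d).Opens) (k : ℕ) :
    Γ(polarizationPow n d k, famOpen i U) :=
  mres _ (famOpen_le' i U) (unitSec (universalToSpace n d) _ (stdOpen i) (twistGen (X_mem i) k))

lemma isGen_famGen : IsGen (famGen i U k) :=
  ((isGen_twistGen (X_mem i) k).unitSec _).mres _

/-- The section of `ℒ ^ k` given by a form of degree `k`. -/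
def formSec (p : homogeneousSubmodule (Fin (n + 1)) ℂ k) : Γ(polarizationPow n d k, ⊤) :=
  unitSec (universalToSpace n d) _ ⊤ (globalSec p.2)

lemma app_fstFun (r : Γ(projSpace (Fin (n + 1)), stdOpen i)) :
    ((universalIdeal n d).subschemeι.app (chartOver i U)).hom (fstFun i U r) =
      ((universalToSpace n d).appLE (stdOpen i) (famOpen i U) (famOpen_le' i U)).hom r := by
  rw [Scheme.Hom.app_eq_appLE]
  exact congr($(Scheme.Hom.appLE_comp_appLE (universalIdeal n d).subschemeι (ambientFst n d)
    (stdOpen i) (chartOver i U) (famOpen i U) inf_le_left le_rfl) r)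

lemma app_sndFun (r : Γ(linearSystem n d, U)) :
    ((universalIdeal n d).subschemeι.app (chartOver i U)).hom (sndFun i U r) =
      ((universalMap n d).appLE U (famOpen i U) (famOpen_le i U)).hom r := by
  rw [Scheme.Hom.app_eq_appLE]
  exact congr($(Scheme.Hom.appLE_comp_appLE (universalIdeal n d).subschemeι (ambientSnd n d)
    U (chartOver i U) (famOpen i U) inf_le_right le_rfl) r)

lemma mres_formSec (i : Fin (n + 1)) (U : (linearSystem n d).Opens) (I : MonomialIndex n k) :
    mres _ (le_top : famOpen i U ≤ ⊤) (formSec (d := d) (monomialForm I)) =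
      famMap i U (monomial I.1 1) • famGen i U k := by
  have h1 := (unitSec_mres (universalToSpace n d) (le_top : stdOpen i ≤ ⊤)
    (globalSec (monomialForm I).2)).symm.trans (congrArg _ (globalSec_eq_smul i k (monomialForm I)))
  rw [unitSec_smul] at h1
  have h2 := congrArg (mres _ (famOpen_le' i U)) h1
  rw [mres_smul] at h2
  refine (mres_mres _ _ _).symm.trans (h2.trans ?_)
  refine congrArg (· • famGen i U k) ?_
  have h3 := congrArg ((universalIdeal n d).subschemeι.app (chartOver i U)).hom
    (coordMap_monomial (i := i) (U := U) k I.1 (monomialForm I).2)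
  exact (h3.trans (app_fstFun _)).symm

lemma mres_famGen {W : (universalFamily n d).Opens} (hi : W ≤ famOpen i U)
    (hj : W ≤ famOpen j U) :
    mres _ hi (famGen i U k) = rres hj (famMap j U (X i)) ^ k • mres _ hj (famGen j U k) := by
  have hW : W ≤ universalToSpace n d ⁻¹ᵁ (stdOpen i ⊓ stdOpen j) := fun x hx ↦
    ⟨(hi hx).1, (hj hx).1⟩
  have h1 := congrArg (unitSec (universalToSpace n d) _ _)
    (mres_twistGen (U := stdOpen i ⊓ stdOpen j) inf_le_left inf_le_right k)
  rw [unitSec_smul, unitSec_mres, unitSec_mres] at h1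
  have h2 := congrArg (mres _ hW) h1
  rw [mres_smul, mres_mres, mres_mres, map_pow, map_pow] at h2
  refine (mres_mres _ _ _).trans (h2.trans ?_)
  refine congrArg₂ (· ^ k • ·) ?_ (mres_mres _ _ _).symm
  have h3 := (congrArg (rres hj) ((congrArg
    ((universalIdeal n d).subschemeι.app (chartOver j U)).hom (coordMap_X (U := U) i)).trans
      (app_fstFun (ratio i j)))).trans (rres_appLE _ _ _ _)
  refine Eq.trans ?_ h3.symm
  exact appLE_rres (universalToSpace n d) hW inf_le_right (ratio i j)

/-- Multiplication by functions in `V_k`. -/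
lemma mres_famOpen_smul (r : Γ(linearSystem n d, U)) (s : Γ(verlindeBundle n d k, U)) :
    mres (polarizationPow n d k) (famOpen_le i U) (r • s : Γ(verlindeBundle n d k, U)) =
      famMap i U (C r) • mres (polarizationPow n d k) (famOpen_le i U) s := by
  refine Eq.trans (mres_smul (M := polarizationPow n d k) (famOpen_le i U)
    ((universalMap n d).app U r) s) ?_
  refine congrArg (· • mres (polarizationPow n d k) (famOpen_le i U) s) ?_
  exact ((congrArg ((universalIdeal n d).subschemeι.app (chartOver i U)).hom
    (coordMap_C (i := i) r)).trans (app_sndFun r)).symm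

end Sections

/-! ### Small affine opens of projective space -/

section NiceOpens

/-- An affine neighbourhood in a chart whose ring of functions is a domain. -/
lemma exists_isDomain_nhd {σ : Type} {U : (projSpace σ).Opens} {x : projSpace σ} (hx : x ∈ U) :
    ∃ V ≤ U, x ∈ V ∧ IsAffineOpen V ∧ IsDomain Γ(projSpace σ, V) ∧ ∃ j, V ≤ stdOpen j := by
  obtain ⟨j, hj⟩ := exists_mem_stdOpen x
  obtain ⟨_, ⟨_, ⟨f, rfl⟩, rfl⟩, hxf, hfU⟩ :=
    (Proj.isBasis_basicOpen (homogeneousSubmodule σ ℂ)).exists_subset_of_mem_open hx U.2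
  have h1 := Proj.basicOpen_eq_iSup_proj (homogeneousSubmodule σ ℂ) f
  rw [SetLike.mem_coe, h1, Opens.mem_iSup] at hxf
  obtain ⟨m, hxm⟩ := hxf
  -- A homogeneous component of f not vanishing at x. The factor x_j places the open set in a chart
  -- and makes the degree positive, so it is affine.
  let g : MvPolynomial σ ℂ := GradedRing.proj (homogeneousSubmodule σ ℂ) m f
  have hg : X j * g ∈ homogeneousSubmodule σ ℂ (1 + m) :=
    SetLike.mul_mem_graded (X_mem j) (SetLike.coe_mem _)
  have hV := Proj.basicOpen_mul (homogeneousSubmodule σ ℂ) (X j) g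
  have hxV : x ∈ Proj.basicOpen (homogeneousSubmodule σ ℂ) (X j * g) := hV.ge ⟨hj, hxm⟩
  refine ⟨Proj.basicOpen (homogeneousSubmodule σ ℂ) (X j * g), ?_, hxV,
    Proj.isAffineOpen_basicOpen _ _ hg (by omega), ?_, j, hV.le.trans inf_le_left⟩
  · exact (hV.le.trans inf_le_right).trans (le_trans ((le_iSup _ m).trans h1.ge) hfU)
  · have h0 : X j * g ≠ 0 := fun h ↦ hxV (h ▸ zero_mem _)
    have h2 : IsDomain (Localization.Away (X j * g)) :=
      IsLocalization.isDomain_localization (powers_le_nonZeroDivisors_of_noZeroDivisors h0)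
    have h3 : IsDomain (HomogeneousLocalization.Away (homogeneousSubmodule σ ℂ) (X j * g)) :=
      Function.Injective.isDomain
        (algebraMap _ (Localization.Away (X j * g))) (HomogeneousLocalization.val_injective _)
    exact (Proj.basicOpenIsoAway (homogeneousSubmodule σ ℂ) (X j * g) hg
      (by omega)).symm.commRingCatIsoToRingEquiv.toMulEquiv.isDomain _

end NiceOpens

/-! ### Sections of V_k as forms modulo the universal form -/

section Sections

variable {n d k : ℕ} {U V : (linearSystem n d).Opens} {i j : Fin (n + 1)} {J : MonomialIndex n d}

lemma eq_sum_monomial {R : Type} [CommRing R] {G : MvPolynomial (Fin (n + 1)) R}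
    (hG : G.IsHomogeneous k) : G = ∑ I : MonomialIndex n k, monomial I.1 (coeff I.1 G) := by
  ext m
  simp only [coeff_sum, coeff_monomial]
  by_cases hm : m ∈ Finset.finsuppAntidiag (Finset.univ : Finset (Fin (n + 1))) k
  · rw [Finset.sum_eq_single ⟨m, hm⟩ (fun J _ hJ ↦ if_neg fun h ↦ hJ (Subtype.ext h)) (by simp)]
    simp
  · rw [Finset.sum_eq_zero fun J _ ↦ if_neg fun (h : J.1 = m) ↦ hm (h ▸ J.2)]
    by_contra h
    refine hm (Finset.mem_finsuppAntidiag.2 ⟨?_, Finset.subset_univ _⟩)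
    rw [← degree_eq_of_isHomogeneous hG (mem_support_iff.2 h), Finsupp.degree_eq_sum]

lemma isHomogeneous_sum_monomial {R : Type} [CommRing R] (c : MonomialIndex n k → R) :
    (∑ I : MonomialIndex n k, monomial I.1 (c I)).IsHomogeneous k :=
  IsHomogeneous.sum _ _ _ fun I _ ↦ isHomogeneous_monomial _ (degree_monomialIndex I)

lemma verlinde_ext {s t : Γ(verlindeBundle n d k, U)}
    (h : ∀ i, mres (polarizationPow n d k) (famOpen_le i U) s =
      mres (polarizationPow n d k) (famOpen_le i U) t) : s = t := by
  refine sec_ext (M := polarizationPow n d k) (U := universalMap n d ⁻¹ᵁ U) fun x hx ↦ ?_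
  obtain ⟨i, hi⟩ := exists_mem_famOpen hx
  exact ⟨_, famOpen_le i U, hi, h i⟩

/-- The global section of `V_k` given by a form of degree `k`. -/
def verlindeSec (d : ℕ) (p : homogeneousSubmodule (Fin (n + 1)) ℂ k) : Γ(verlindeBundle n d k, ⊤) :=
  formSec p

lemma mres_famOpen_sum (c : MonomialIndex n k → Γ(linearSystem n d, U)) (i : Fin (n + 1)) :
    mres (polarizationPow n d k) (famOpen_le i U)
      (∑ I, c I • mres _ (le_top : U ≤ ⊤) (verlindeSec d (monomialForm I)) :
        Γ(verlindeBundle n d k, U)) =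
      famMap i U (∑ I, monomial I.1 (c I)) • famGen i U k := by
  refine (map_sum (mres (polarizationPow n d k) (famOpen_le i U)) _ _).trans ?_
  rw [map_sum, Finset.sum_smul]
  refine Finset.sum_congr rfl fun I _ ↦ ?_
  have h1 : monomial I.1 (c I) = C (c I) * monomial I.1 1 := by rw [C_mul_monomial, mul_one]
  rw [h1, map_mul, mul_smul]
  refine (mres_famOpen_smul _ _).trans ?_
  refine congrArg (famMap i U (C (c I)) • ·) ?_
  exact (mres_mres _ _ _).trans (mres_formSec i U I)

/-- On each chart the section is the function of the form times a free generator, so its vanishing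
is that of the function. -/
lemma sum_smul_eq_zero_iff (hn : 2 ≤ n) [IsDomain Γ(linearSystem n d, U)] (h : U ≤ stdOpen J)
    {x : linearSystem n d} (hx : x ∈ U) (hU : IsAffineOpen U)
    (c : MonomialIndex n k → Γ(linearSystem n d, U)) :
    (∑ I, c I • mres _ (le_top : U ≤ ⊤) (verlindeSec d (monomialForm I)) :
        Γ(verlindeBundle n d k, U)) = 0 ↔ universalForm h ∣ ∑ I, monomial I.1 (c I) := by
  have key (i : Fin (n + 1)) := famMap_eq_zero_iff (i := i) hn h hx hU
    (isHomogeneous_sum_monomial c)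
  constructor
  · intro h0
    refine (key 0).1 ((isGen_famGen (k := k) _ le_rfl).1 ?_)
    have h1 := mres_famOpen_sum c 0
    rw [h0] at h1
    have h2 := h1.symm.trans (map_zero (mres (polarizationPow n d k) (famOpen_le 0 U)))
    simpa only [mres_self, zero_smul] using h2
  · intro hdvd
    refine verlinde_ext fun i ↦ ?_
    rw [mres_famOpen_sum, (key i).2 hdvd, zero_smul]
    exact (map_zero _).symm

/-- On the i-th chart the section is t_i x_i^k with t_i = G_i / x_i^(p+k), that is, G_i / x_i^p.
Agreement on overlaps is the compatibility required by `exists_form_of_compatible`. -/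
theorem exists_form_of_section (hn : 2 ≤ n) [IsDomain Γ(linearSystem n d, U)] (h : U ≤ stdOpen J)
    {x : linearSystem n d} (hx : x ∈ U) (hU : IsAffineOpen U) (s : Γ(verlindeBundle n d k, U)) :
    ∃ c : MonomialIndex n k → Γ(linearSystem n d, U),
      s = ∑ I, c I • mres _ (le_top : U ≤ ⊤) (verlindeSec d (monomialForm I)) := by
  have hgen (i : Fin (n + 1)) : ∃ t : Γ(universalFamily n d, famOpen i U), t • famGen i U k =
      mres (polarizationPow n d k) (famOpen_le i U) s := by
    obtain ⟨t, ht⟩ := (isGen_famGen (k := k) (famOpen i U) le_rfl).2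
      (mres (polarizationPow n d k) (famOpen_le i U) s)
    exact ⟨t, by simpa using ht⟩
  choose t ht using hgen
  choose m₀ hm₀ using fun i ↦ exists_famMap_eq hU i (t i)
  -- Any common bound for the `m₀ i` would do.
  let p := ∑ i, m₀ i
  choose G hG hGt using fun i ↦ hm₀ i (p + k)
    ((Finset.single_le_sum (fun _ _ ↦ Nat.zero_le _) (Finset.mem_univ i)).trans (by omega))
  have hF (i : Fin (n + 1)) : ¬ X i ∣ universalForm h := fun ⟨a, ha⟩ ↦
    universalForm_ne hn h hx i i a 0 (by rw [ha, mul_zero, add_zero])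
  have hcomp (i j : Fin (n + 1)) : universalForm h ∣ X j ^ p * G i - X i ^ p * G j := by
    have h1 : rres inf_le_left (t i) * rres inf_le_right (famMap j U (X i)) ^ k =
        rres (inf_le_right : famOpen i U ⊓ famOpen j U ≤ _) (t j) := by
      apply (isGen_famGen (k := k) (famOpen i U ⊓ famOpen j U) inf_le_right).1
      have h2 := congrArg (mres _ (inf_le_left : famOpen i U ⊓ famOpen j U ≤ famOpen i U)) (ht i)
      have h3 := congrArg (mres _ (inf_le_right : famOpen i U ⊓ famOpen j U ≤ famOpen j U)) (ht j)
      have h4 := (mres_smul _ _ _).symm.trans (h2.trans (mres_mres _ _ _))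
      have h5 := (mres_smul _ _ _).symm.trans (h3.trans (mres_mres _ _ _))
      refine Eq.trans ?_ (h4.trans h5.symm)
      rw [mres_famGen inf_le_left inf_le_right, smul_smul]
    have h2 := rres_famMap_mul (W := famOpen i U ⊓ famOpen j U) inf_le_left inf_le_right (hG i)
    have h3 : rres (inf_le_right : famOpen i U ⊓ famOpen j U ≤ _)
        (famMap j U (X j ^ p * G i - X i ^ p * G j)) = 0 := by
      simp only [map_sub, map_mul, map_pow, famMap_X_self, ← h2, hGt, ← h1, map_one, one_pow]
      ring
    obtain ⟨N, hN⟩ := exists_famMap_X_pow_mul_eq_zero hU h3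
    rw [famMap_eq_zero_iff hn h hx hU (m := N + (p + (p + k)))] at hN
    · exact dvd_of_dvd_X_pow_mul (hF i) hN
    · exact (isHomogeneous_X_pow i N).mul (((isHomogeneous_X_pow j p).mul (hG i)).sub
        ((isHomogeneous_X_pow i p).mul (hG j)))
  have : Nontrivial (Fin (n + 1)) := Fin.nontrivial_iff_two_le.2 (by omega)
  obtain ⟨K, hK, hKG⟩ := exists_form_of_compatible (isHomogeneous_universalForm h)
    (universalForm_ne hn h hx) G hG hcomp
  refine ⟨fun I ↦ coeff I.1 K, verlinde_ext fun i ↦ ?_⟩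
  rw [mres_famOpen_sum, ← eq_sum_monomial hK, ← ht i]
  have h1 := (famMap_eq_zero_iff (i := i) hn h hx hU
    (((isHomogeneous_X_pow i p).mul hK).sub (hG i))).2 (hKG i)
  rw [map_sub, map_mul, map_pow, famMap_X_self, one_pow, one_mul, sub_eq_zero] at h1
  rw [h1, hGt]

end Sections

/-! ### Multiples of a form by linear forms, in coordinates -/

section Shift

variable {n d : ℕ}

/-- The exponent of `x_l * x ^ I`. -/
def shift (l : Fin (n + 1)) (I : MonomialIndex n d) : MonomialIndex n (d + 1) :=
  ⟨I.1 + Finsupp.single l 1, by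
    rw [Finset.mem_finsuppAntidiag]
    refine ⟨?_, Finset.subset_univ _⟩
    have h := (Finset.mem_finsuppAntidiag.1 I.2).1
    refine Finset.sum_add_distrib.trans ?_
    rw [h]
    simp [Finsupp.single_apply]⟩

/-- The coordinate `x_l` as a linear form. -/
def coordForm (l : Fin (n + 1)) : homogeneousSubmodule (Fin (n + 1)) ℂ 1 := ⟨X l, X_mem l⟩

lemma exists_eq_single (I : MonomialIndex n 1) : ∃ l, I.1 = Finsupp.single l 1 :=
  (Finsupp.sum_eq_one_iff _).1 (degree_monomialIndex I)

lemma span_coordForm : Submodule.span ℂ (Set.range (coordForm (n := n))) = ⊤ := by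
  refine top_le_iff.1 fun p _ ↦ ?_
  rw [form_eq_sum p]
  refine Submodule.sum_mem _ fun I _ ↦ Submodule.smul_mem _ _ (Submodule.subset_span ?_)
  obtain ⟨l, hl⟩ := exists_eq_single I
  exact ⟨l, Subtype.ext (by simp [coordForm, monomialForm, hl, X])⟩

lemma mulForm_coordForm (p : homogeneousSubmodule (Fin (n + 1)) ℂ d) (l : Fin (n + 1)) :
    mulForm p (coordForm l) = ∑ I : MonomialIndex n d, coeff I.1 p.1 • monomialForm (shift l I) := by
  have h := congrArg (fun q ↦ mulForm q (coordForm l)) (form_eq_sum p)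
  refine h.trans (Subtype.ext ?_)
  change (Subtype.val (∑ I : MonomialIndex n d, coeff I.1 p.1 • monomialForm I)) * X l = _
  simp only [AddSubmonoidClass.coe_finsetSum, Submodule.coe_smul, Finset.sum_mul]
  refine Finset.sum_congr rfl fun I _ ↦ ?_
  rw [smul_mul_assoc]
  simp [monomialForm, shift, X, monomial_mul]

lemma eq_sum_C_mul_X {R : Type} [CommRing R] {H : MvPolynomial (Fin (n + 1)) R}
    (hH : H.IsHomogeneous 1) : ∃ h : Fin (n + 1) → R, H = ∑ l, C (h l) * X l := by
  have h1 : H ∈ Submodule.span R (Set.range (X : Fin (n + 1) → MvPolynomial (Fin (n + 1)) R)) := by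
    rw [eq_sum_monomial hH]
    refine Submodule.sum_mem _ fun I _ ↦ ?_
    obtain ⟨l, hl⟩ := exists_eq_single I
    have : monomial I.1 (coeff I.1 H) = coeff I.1 H • (X l : MvPolynomial (Fin (n + 1)) R) := by
      rw [hl, X, smul_monomial, smul_eq_mul, mul_one]
    rw [this]
    exact Submodule.smul_mem _ _ (Submodule.subset_span ⟨l, rfl⟩)
  obtain ⟨c, hc⟩ := (Submodule.mem_span_range_iff_exists_fun R).1 h1
  exact ⟨c, by rw [← hc]; simp [smul_eq_C_mul]⟩

lemma sum_smul_of_eq_mul {R Y : Type} [CommRing R] [AddCommGroup Y] [Module R Y]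
    (y : MonomialIndex n (d + 1) → Y) (c : MonomialIndex n (d + 1) → R) (a : MonomialIndex n d → R)
    (h : Fin (n + 1) → R) (e : ∑ I, monomial I.1 (c I) =
      (∑ I : MonomialIndex n d, monomial I.1 (a I)) * ∑ l, C (h l) * X l) :
    ∑ I, c I • y I = ∑ l, h l • ∑ I, a I • y (shift l I) := by
  classical
  -- Sending x^I to `y I` turns the polynomial identity into the identity in `Y`.
  let T : MvPolynomial (Fin (n + 1)) R →ₗ[R] Y := (basisMonomials (Fin (n + 1)) R).constr R fun m ↦
    if hm : m ∈ Finset.finsuppAntidiag (Finset.univ : Finset (Fin (n + 1))) (d + 1) then y ⟨m, hm⟩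
    else 0
  have hT (I : MonomialIndex n (d + 1)) (r : R) : T (monomial I.1 r) = r • y I := by
    rw [← mul_one r, ← smul_eq_mul, ← smul_monomial, map_smul]
    have := (basisMonomials (Fin (n + 1)) R).constr_basis R (fun m ↦
      if hm : m ∈ Finset.finsuppAntidiag (Finset.univ : Finset (Fin (n + 1))) (d + 1) then
        y ⟨m, hm⟩ else 0) I.1
    rw [coe_basisMonomials, dif_pos I.2] at this
    rw [smul_eq_mul, mul_one]
    exact congrArg (r • ·) this
  have h1 := congrArg T e
  simp only [map_sum, hT] at h1
  rw [h1, Finset.mul_sum, map_sum]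
  refine Finset.sum_congr rfl fun l _ ↦ ?_
  rw [Finset.sum_mul, map_sum, Finset.smul_sum]
  refine Finset.sum_congr rfl fun I _ ↦ ?_
  rw [smul_smul, ← hT]
  congr 1
  rw [C_mul_X_eq_monomial, monomial_mul, mul_comm]
  rfl

end Shift

/-! ### Ratios of linear forms and pullback to the line -/

section AwayFraction

variable {A σ : Type} [CommRing A] [SetLike σ A] [AddSubgroupClass σ A]
variable {𝒜 : ℕ → σ} [GradedRing 𝒜]

/-- The function `a / b` where `a` and `b` have degree one. -/
def awayFraction {a b : A} (ha : a ∈ 𝒜 1) (hb : b ∈ 𝒜 1) : Γ(Proj 𝒜, Proj.basicOpen 𝒜 b) :=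
  (Proj.awayToSection 𝒜 b).hom (HomogeneousLocalization.Away.mk 𝒜 hb 1 a (by simpa using ha))

lemma evalAt_awayFraction {a b : A} (ha : a ∈ 𝒜 1) (hb : b ∈ 𝒜 1) {x : Proj 𝒜}
    (hx : x ∈ Proj.basicOpen 𝒜 b) : evalAt x hx (awayFraction ha hb) = valAt x a *
      ((unitAt hx)⁻¹ : (LocalAt 𝒜 x)ˣ).val := by
  refine Eq.trans ?_ (congrArg (· * ((unitAt hx)⁻¹ : (LocalAt 𝒜 x)ˣ).val)
    (Localization.mk_one_eq_algebraMap _))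
  conv_rhs => rw [← pow_one (unitAt hx)]
  exact mk_eq_unitAt (a := a) hx 1 (pow_mem (S := primeComplAt x) hx _)

lemma rres_awayFraction_mul {a b c : A} (ha : a ∈ 𝒜 1) (hb : b ∈ 𝒜 1) (hc : c ∈ 𝒜 1)
    {U : (Proj 𝒜).Opens} (hUb : U ≤ Proj.basicOpen 𝒜 b) (hUc : U ≤ Proj.basicOpen 𝒜 c) :
    rres hUb (awayFraction ha hb) * rres hUc (awayFraction hb hc) =
      rres hUc (awayFraction ha hc) := by
  refine fun_ext fun x hx ↦ ?_
  rw [map_mul, evalAt_rres, evalAt_rres, evalAt_rres, evalAt_awayFraction, evalAt_awayFraction,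
    evalAt_awayFraction, ← unitAt_val (hUb hx), mul_assoc,
    ← mul_assoc _ (unitAt (hUb hx)).val, Units.inv_mul, one_mul]

end AwayFraction

section Line

variable {n d : ℕ} (f : Fin 2 → homogeneousSubmodule (Fin (n + 1)) ℂ d) (hf : LinearIndependent ℂ f)

lemma lineHom_X_mem (I : MonomialIndex n d) : lineHom f (X I) ∈ homogeneousSubmodule (Fin 2) ℂ 1 :=
  (lineHom f).map_mem (X_mem I)

lemma lineHom_X (I : MonomialIndex n d) : lineHom f (X I) = ∑ j, C (coeff I.1 (f j).1) * X j :=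
  aeval_X _ I

/-- With a_I, b_I the coefficients of f_0, f_1, α_I / α_J pulls back to (s a_I + t b_I) / (s a_J + t
b_J). -/
lemma appLE_lineMap_ratio (I J : MonomialIndex n d) :
    ((lineMap f hf).appLE (stdOpen J) (Proj.basicOpen _ (lineHom f (X J))) le_rfl).hom (ratio I J) =
      awayFraction (lineHom_X_mem f I) (lineHom_X_mem f J) := by
  refine congr($(Proj.awayToSection_comp_appLE (lineHom f) (lineHom_irrelevant f hf) (X_mem J))
    (HomogeneousLocalization.Away.mk _ (X_mem J) 1 (X I) (by simpa using X_mem I))).trans ?_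
  refine congrArg (Proj.awayToSection (homogeneousSubmodule (Fin 2) ℂ) (lineHom f (X J))).hom ?_
  exact HomogeneousLocalization.Away.map_mk ..

variable {f} in
lemma appLE_ratio {U : (linearSystem n d).Opens} {J : MonomialIndex n d} (h : U ≤ stdOpen J)
    {W : line.Opens} (hW : W ≤ lineMap f hf ⁻¹ᵁ U) (I : MonomialIndex n d) :
    ((lineMap f hf).appLE U W hW).hom (rres h (ratio I J)) =
      rres (hW.trans fun _ hx ↦ h hx) (awayFraction (lineHom_X_mem f I) (lineHom_X_mem f J)) := by
  rw [← appLE_lineMap_ratio f hf, appLE_rres]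
  exact (rres_appLE (lineMap f hf) _ _ _).symm

lemma awayFraction_lineHom (I : MonomialIndex n d) (b : Fin 2) :
    awayFraction (lineHom_X_mem f I) (X_mem b) =
      cst _ (coeff I.1 (f 0).1) * ratio 0 b + cst _ (coeff I.1 (f 1).1) * ratio 1 b := by
  refine fun_ext fun x hx ↦ ?_
  rw [map_add, map_mul, map_mul, evalAt_cst, evalAt_cst, evalAt_ratio, evalAt_ratio,
    evalAt_awayFraction, lineHom_X, Fin.sum_univ_two, map_add, map_mul, map_mul, add_mul, mul_assoc,
    mul_assoc]

variable {Z : line.Modules}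

/-- The right side expands (s f_0 + t f_1) x_l in monomials, divided by the b-th coordinate. It
exhibits the pencil relation as the pullback of F·x_l = 0, apart from the denominator. -/
lemma pencil_eq_sum (z : homogeneousSubmodule (Fin (n + 1)) ℂ (d + 1) →ₗ[ℂ] Γ(Z, ⊤)) (b : Fin 2)
    (l : Fin (n + 1)) :
    ratio 0 b • mres Z (le_top : stdOpen b ≤ ⊤) (z (mulForm (f 0) (coordForm l))) +
      ratio 1 b • mres Z (le_top : stdOpen b ≤ ⊤) (z (mulForm (f 1) (coordForm l))) =
    ∑ I : MonomialIndex n d, awayFraction (lineHom_X_mem f I) (X_mem b) •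
      mres Z (le_top : stdOpen b ≤ ⊤) (z (monomialForm (shift l I))) := by
  simp only [mulForm_coordForm, map_sum, map_smul, mres_smul_complex, Finset.smul_sum,
    smul_smul_comm']
  rw [← Finset.sum_add_distrib]
  refine Finset.sum_congr rfl fun I _ ↦ ?_
  rw [awayFraction_lineHom, add_smul, mul_smul, mul_smul]
  rfl

end Line

lemma mres_smul_pushforward {X Y : Scheme.{0}} (g : X ⟶ Y) {M : X.Modules} {U : Y.Opens}
    {W : X.Opens} (hW : W ≤ g ⁻¹ᵁ U) (r : Γ(Y, U))
    (s : Γ((Scheme.Modules.pushforward g).obj M, U)) :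
    mres M hW (r • s : Γ((Scheme.Modules.pushforward g).obj M, U)) =
      (g.appLE U W hW).hom r • mres M hW s :=
  mres_smul (M := M) hW (g.app U r) s

/-! ### V_{d+1} on a line as the cokernel of the pencil -/

section

variable {n d : ℕ} {f : Fin 2 → homogeneousSubmodule (Fin (n + 1)) ℂ d}

/-- The Verlinde bundle is locally generated by forms. -/
lemma verlindeSec_generates (hn : 2 ≤ n) {k : ℕ} {U : (linearSystem n d).Opens}
    (s : Γ(verlindeBundle n d k, U)) (x : linearSystem n d) (hx : x ∈ U) :
    ∃ V, ∃ h : V ≤ U, x ∈ V ∧ ∃ c : MonomialIndex n k → Γ(linearSystem n d, V),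
      mres _ h s = ∑ I, c I • mres _ (le_top : V ≤ ⊤) (verlindeSec d (monomialForm I)) := by
  obtain ⟨V, hVU, hxV, hV, hdom, J, hJ⟩ := exists_isDomain_nhd hx
  exact ⟨V, hVU, hxV, exists_form_of_section hn hJ hxV hV _⟩

/-- This is the relation F·x_l = 0 on the universal hypersurface. -/
lemma sum_ratio_smul_verlindeSec (hn : 2 ≤ n) {U : (linearSystem n d).Opens}
    [IsDomain Γ(linearSystem n d, U)] {J : MonomialIndex n d} (h : U ≤ stdOpen J)
    {x : linearSystem n d} (hx : x ∈ U) (hU : IsAffineOpen U) (l : Fin (n + 1)) :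
    (∑ I, rres h (ratio I J) • mres _ (le_top : U ≤ ⊤) (verlindeSec d (monomialForm (shift l I))) :
      Γ(verlindeBundle n d (d + 1 : ℕ), U)) = 0 := by
  have hdeg : (universalForm h * X l).IsHomogeneous (d + 1) :=
    (isHomogeneous_universalForm h).mul (isHomogeneous_X _ l)
  have h1 := (sum_smul_eq_zero_iff hn h hx hU (fun I ↦ coeff I.1 (universalForm h * X l))).2
    (by rw [← eq_sum_monomial hdeg]; exact dvd_mul_right _ _)
  have h2 := sum_smul_of_eq_mul (fun I : MonomialIndex n (d + 1) ↦ (mres _ (le_top : U ≤ ⊤)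
    (verlindeSec d (monomialForm I)) : Γ(verlindeBundle n d (d + 1 : ℕ), U)))
    (fun I ↦ coeff I.1 (universalForm h * X l)) (fun I ↦ rres h (ratio I J)) (Pi.single l 1) (by
      rw [← eq_sum_monomial hdeg, universalForm]
      congr 1
      rw [Finset.sum_eq_single l (fun j _ hj ↦ by simp [hj]) (by simp)]
      simp)
  rw [h2] at h1
  rw [Finset.sum_eq_single l (fun j _ hj ↦ by simp [hj]) (by simp), Pi.single_eq_same,
    one_smul] at h1
  exact h1

/-- The relations between the generating sections of the Verlinde bundle hold for the values of a
pencil map. -/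
lemma IsPencilMap.sum_smul_eq_zero (hn : 2 ≤ n) (hf : LinearIndependent ℂ f) {Z : line.Modules}
    {z : homogeneousSubmodule (Fin (n + 1)) ℂ (d + 1) →ₗ[ℂ] Γ(Z, ⊤)}
    (hz : IsPencilMap (mulForm (f 0)) (mulForm (f 1)) z) {U : (linearSystem n d).Opens}
    (c : MonomialIndex n (d + 1) → Γ(linearSystem n d, U))
    (hc : (∑ I, c I • mres _ (le_top : U ≤ ⊤) (verlindeSec d (monomialForm I)) :
      Γ(verlindeBundle n d (d + 1 : ℕ), U)) = 0) (x : linearSystem n d) (hx : x ∈ U) :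
    ∃ V, ∃ h : V ≤ U, x ∈ V ∧ (∑ I, rres h (c I) • mres _ (le_top : V ≤ ⊤)
      (z (monomialForm I) : Γ((Scheme.Modules.pushforward (lineMap f hf)).obj Z, ⊤)) :
        Γ((Scheme.Modules.pushforward (lineMap f hf)).obj Z, V)) = 0 := by
  obtain ⟨V, hVU, hxV, hV, hdom, J, hJ⟩ := exists_isDomain_nhd hx
  refine ⟨V, hVU, hxV, ?_⟩
  have h1 := congrArg (mres _ hVU) hc
  simp only [map_sum, mres_smul, mres_mres, map_zero] at h1
  rw [sum_smul_eq_zero_iff hn hJ hxV hV] at h1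
  -- Here k = d + 1 is decisive: the cofactor of F has degree 1, so only the relations F·x_l need
  -- checking.
  obtain ⟨H, hH, e⟩ := exists_isHomogeneous_of_dvd (isHomogeneous_universalForm hJ)
    (isHomogeneous_sum_monomial _) h1
  obtain ⟨h, rfl⟩ := eq_sum_C_mul_X hH
  rw [sum_smul_of_eq_mul _ _ _ _ e]
  refine Finset.sum_eq_zero fun l _ ↦ ?_
  refine (congrArg (h l • ·) ?_).trans (smul_zero _)
  refine sec_ext (M := Z) (U := lineMap f hf ⁻¹ᵁ V) fun y hy ↦ ?_
  obtain ⟨b, hb⟩ := exists_mem_stdOpen y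
  refine ⟨lineMap f hf ⁻¹ᵁ V ⊓ stdOpen b, inf_le_left, ⟨hy, hb⟩, ?_⟩
  refine Eq.trans ?_ (map_zero (mres Z _)).symm
  have hWJ : lineMap f hf ⁻¹ᵁ V ⊓ stdOpen b ≤ Proj.basicOpen _ (lineHom f (X J)) :=
    fun y hy ↦ hJ hy.1
  have h2 := congrArg (mres Z (inf_le_right : lineMap f hf ⁻¹ᵁ V ⊓ stdOpen b ≤ _))
    ((pencil_eq_sum f z b l).symm.trans (hz b (coordForm l)))
  simp only [map_sum, mres_smul, mres_mres, map_zero] at h2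
  -- This factor exchanges the denominator x_b for the pullback of α_J.
  have h3 := congrArg (rres hWJ (awayFraction (X_mem b) (lineHom_X_mem f J)) • ·) h2
  simp only [Finset.smul_sum, smul_smul, smul_zero] at h3
  rw [← h3]
  refine (map_sum (mres Z (inf_le_left : lineMap f hf ⁻¹ᵁ V ⊓ stdOpen b ≤ _)) _ _).trans ?_
  refine Finset.sum_congr rfl fun I _ ↦ ?_
  refine (mres_smul_pushforward (lineMap f hf) inf_le_left _ _).trans ?_
  refine congrArg₂ (· • ·) ?_ (mres_mres _ _ _)
  rw [appLE_ratio hf hJ, mul_comm]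
  exact (rres_awayFraction_mul _ _ _ inf_le_right hWJ).symm

/-- The linear map on forms of degree `k` with prescribed values on the monomials. -/
def formMap {k : ℕ} (Z : line.Modules) (y : MonomialIndex n k → Γ(Z, ⊤)) :
    homogeneousSubmodule (Fin (n + 1)) ℂ k →ₗ[ℂ] Γ(Z, ⊤) :=
  (monomialBasis n k).constr ℂ y

lemma formMap_monomialForm {k : ℕ} (Z : line.Modules) (y : MonomialIndex n k → Γ(Z, ⊤))
    (I : MonomialIndex n k) : formMap Z y (monomialForm I) = y I := by
  rw [← monomialBasis_apply]
  exact (monomialBasis n k).constr_basis ℂ _ I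

/-- The images in `V_{d+1,T}` of the forms of degree `d + 1`. -/
def lineSec (hf : LinearIndependent ℂ f) : homogeneousSubmodule (Fin (n + 1)) ℂ (d + 1) →ₗ[ℂ]
    Γ((Scheme.Modules.pullback (lineMap f hf)).obj (verlindeBundle n d (d + 1 : ℕ)), ⊤) :=
  formMap _ fun I ↦
    unitSec (lineMap f hf) (verlindeBundle n d (d + 1 : ℕ)) ⊤ (verlindeSec d (monomialForm I))

lemma lineSec_monomialForm (hf : LinearIndependent ℂ f) (I : MonomialIndex n (d + 1)) :
    lineSec hf (monomialForm I) = unitSec (lineMap f hf) (verlindeBundle n d (d + 1 : ℕ)) ⊤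
      (verlindeSec d (monomialForm I)) :=
  formMap_monomialForm _ _ I

lemma isPencilMap_lineSec (hn : 2 ≤ n) (hf : LinearIndependent ℂ f) :
    IsPencilMap (mulForm (f 0)) (mulForm (f 1)) (lineSec hf) := by
  refine IsPencilMap.of_span span_coordForm ?_
  rintro b _ ⟨l, rfl⟩
  rw [pencil_eq_sum]
  refine sec_ext fun y hy ↦ ?_
  obtain ⟨J, hJy⟩ := exists_mem_stdOpen (lineMap f hf y)
  obtain ⟨V, hVJ, hxV, hV, hdom, -⟩ := exists_isDomain_nhd hJy
  refine ⟨lineMap f hf ⁻¹ᵁ V ⊓ stdOpen b, inf_le_right, ⟨hxV, hy⟩, ?_⟩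
  have h1 := congrArg (unitSec (lineMap f hf) _ V) (sum_ratio_smul_verlindeSec hn hVJ hxV hV l)
  simp only [map_sum, map_zero, unitSec_smul, unitSec_mres] at h1
  have h2 := congrArg (mres _ (inf_le_left : lineMap f hf ⁻¹ᵁ V ⊓ stdOpen b ≤ _)) h1
  simp only [map_sum, map_zero, mres_smul] at h2
  have hWJ : lineMap f hf ⁻¹ᵁ V ⊓ stdOpen b ≤ Proj.basicOpen _ (lineHom f (X J)) :=
    fun y hy ↦ hVJ hy.1
  have h3 := congrArg ((rres (inf_le_right : lineMap f hf ⁻¹ᵁ V ⊓ stdOpen b ≤ _)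
    (awayFraction (lineHom_X_mem f J) (X_mem b))) • ·) h2
  simp only [Finset.smul_sum, smul_smul, smul_zero] at h3
  rw [map_zero, ← h3, map_sum]
  refine Finset.sum_congr rfl fun I _ ↦ ?_
  rw [mres_smul, mres_mres]
  refine congrArg₂ (· • ·) ?_ ?_
  · rw [mul_comm]
    have h4 := appLE_ratio hf hVJ (inf_le_left : lineMap f hf ⁻¹ᵁ V ⊓ stdOpen b ≤ _) I
    refine Eq.trans ?_ (congrArg (· * _) h4).symm
    exact (rres_awayFraction_mul _ _ _ hWJ inf_le_right).symm
  · rw [lineSec_monomialForm]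
    exact (mres_mres _ _ _).symm

/-- By adjunction, maps from the pullback to `Z` are maps from V_{d+1} to the pushforward of `Z`.
Such a map is fixed by the images of the monomials, and these must satisfy exactly the pencil
relations. -/
theorem isUniversalPencilMap_lineSec (hn : 2 ≤ n) (hf : LinearIndependent ℂ f) :
    IsUniversalPencilMap (mulForm (f 0)) (mulForm (f 1)) (lineSec hf) := by
  refine ⟨isPencilMap_lineSec hn hf, fun {Z z} hz ↦ ?_, fun {Z φ ψ} h ↦ ?_⟩
  · obtain ⟨ψ, hψ⟩ := exists_hom_of_generators (M := verlindeBundle n d (d + 1 : ℕ))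
      (N := (Scheme.Modules.pushforward (lineMap f hf)).obj Z)
      (fun I : MonomialIndex n (d + 1) ↦ verlindeSec d (monomialForm I))
      (fun I ↦ z (monomialForm I)) (fun s x hx ↦ verlindeSec_generates hn s x hx)
      (fun c hc x hx ↦ hz.sum_smul_eq_zero hn hf c hc x hx)
    obtain ⟨φ, hφ⟩ := exists_pullback_hom (lineMap f hf) ψ
    refine ⟨φ, fun w ↦ ?_⟩
    suffices (secMapₗ φ ⊤).comp (lineSec hf) = z from LinearMap.congr_fun this w
    refine (monomialBasis n (d + 1)).ext fun I ↦ ?_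
    rw [monomialBasis_apply]
    refine Eq.trans (congrArg (secMap φ ⊤) (lineSec_monomialForm hf I)) ?_
    exact (hφ ⊤ _).trans (hψ I)
  · refine pullback_hom_ext (lineMap f hf) fun U s ↦ sec_ext fun y hy ↦ ?_
    obtain ⟨V, hVU, hxV, c, hc⟩ := verlindeSec_generates hn s (lineMap f hf y) hy
    refine ⟨lineMap f hf ⁻¹ᵁ V, fun x hx ↦ hVU hx, hxV, ?_⟩
    have h1 := congrArg (unitSec (lineMap f hf) _ V) hc
    simp only [map_sum, unitSec_smul, unitSec_mres] at h1
    have h2 (θ : (Scheme.Modules.pullback (lineMap f hf)).obj (verlindeBundle n d (d + 1 : ℕ)) ⟶ Z) :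
        mres Z ((lineMap f hf).preimage_mono hVU) (secMap θ (lineMap f hf ⁻¹ᵁ U)
          (unitSec (lineMap f hf) _ U s)) = ∑ I, (lineMap f hf).app V (c I) •
            mres Z (le_top : lineMap f hf ⁻¹ᵁ V ≤ ⊤) (secMap θ ⊤ (lineSec hf (monomialForm I))) := by
      rw [← secMap_mres, h1, map_sum]
      refine Finset.sum_congr rfl fun I _ ↦ ?_
      rw [map_smul, ← secMap_mres, lineSec_monomialForm]
      rfl
    rw [h2, h2]
    simp only [h]

end

/-! ### Homomorphisms between twisting sheaves on the line -/

section TwistHom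

variable {a b c : ℤ}

/-- The generator `X i ^ a` of `𝒪(a)` on the standard open subset of `X i`. -/
abbrev lineGen (i : Fin 2) (a : ℤ) : Γ(twist (homogeneousSubmodule (Fin 2) ℂ) a, stdOpen i) :=
  twistGen (X_mem i) a

lemma exists_coeff (φ : twist (homogeneousSubmodule (Fin 2) ℂ) a ⟶ twist _ b) (i : Fin 2) :
    ∃ p : Γ(line, stdOpen i), secMap φ (stdOpen i) (lineGen i a) = p • lineGen i b := by
  obtain ⟨p, hp⟩ := (isGen_twistGen (X_mem i) b _ le_rfl).2 (secMap φ (stdOpen i) (lineGen i a))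
  rw [mres_self] at hp
  exact ⟨p, hp.symm⟩

lemma smul_lineGen_injective {i : Fin 2} {p q : Γ(line, stdOpen i)}
    (h : p • lineGen i a = q • lineGen i a) : p = q := by
  refine (isGen_twistGen (X_mem i) a _ le_rfl).1 ?_
  simpa only [mres_self] using h

/-- The coefficient on the first standard open subset of a homomorphism `𝒪(a) ⟶ 𝒪(b)`. -/
def homCoeff (φ : twist (homogeneousSubmodule (Fin 2) ℂ) a ⟶ twist _ b) :
    Γ(line, stdOpen 0) :=
  (exists_coeff φ 0).choose

lemma homCoeff_spec (φ : twist (homogeneousSubmodule (Fin 2) ℂ) a ⟶ twist _ b) :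
    secMap φ (stdOpen 0) (lineGen 0 a) = homCoeff φ • lineGen 0 b :=
  (exists_coeff φ 0).choose_spec

lemma homCoeff_comp (φ : twist (homogeneousSubmodule (Fin 2) ℂ) a ⟶ twist _ b)
    (ψ : twist (homogeneousSubmodule (Fin 2) ℂ) b ⟶ twist _ c) :
    homCoeff (φ ≫ ψ) = homCoeff φ * homCoeff ψ := by
  refine smul_lineGen_injective (a := c) ?_
  rw [← homCoeff_spec, secMap_comp, homCoeff_spec, map_smul, homCoeff_spec, smul_smul]

lemma homCoeff_id : homCoeff (𝟙 (twist (homogeneousSubmodule (Fin 2) ℂ) a)) = 1 := by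
  refine smul_lineGen_injective (a := a) ?_
  rw [← homCoeff_spec, secMap_id, one_smul]

lemma homCoeff_add (φ ψ : twist (homogeneousSubmodule (Fin 2) ℂ) a ⟶ twist _ b) :
    homCoeff (φ + ψ) = homCoeff φ + homCoeff ψ := by
  refine smul_lineGen_injective (a := b) ?_
  rw [← homCoeff_spec, add_smul, ← homCoeff_spec, ← homCoeff_spec]
  rfl

/-- The coefficient of a homomorphism, as an additive map. -/
def homCoeffHom (a b : ℤ) : (twist (homogeneousSubmodule (Fin 2) ℂ) a ⟶ twist _ b) →+
    Γ(line, stdOpen 0) :=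
  AddMonoidHom.mk' homCoeff homCoeff_add

lemma exists_mem_forall_stdOpen : ∃ x : line, ∀ i, x ∈ stdOpen i := by
  have h : ¬ HomogeneousIdeal.irrelevant (homogeneousSubmodule (Fin 2) ℂ) ≤ ⊥ := fun h ↦
    X_ne_zero (R := ℂ) (0 : Fin 2) (h (HomogeneousIdeal.mem_irrelevant_of_mem _ one_pos (X_mem 0)))
  exact ⟨⟨⊥, Ideal.isPrime_bot, h⟩, fun i ↦ X_ne_zero i⟩

/-- Clears denominators in the comparison of the two chart coefficients of a map 𝒪(b+k+1) → 𝒪(b); v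
and w stand for the two coordinates. -/
lemma cross_mul_eq {R : Type} [CommRing R] {v w : Rˣ} {b : ℤ} {k M N : ℕ} {p q : R}
    (h : (w ^ (b + (k + 1)) * (v ^ (b + (k + 1)))⁻¹ : Rˣ).val *
      (p * ((v ^ N)⁻¹ : Rˣ).val * (v ^ b : Rˣ).val) = q * ((w ^ M)⁻¹ : Rˣ).val * (w ^ b : Rˣ).val) :
    q * v.val ^ (N + (k + 1)) = w.val ^ (M + (k + 1)) * p := by
  have hk : (b + (k + 1) : ℤ) = b + ((k + 1 : ℕ) : ℤ) := by push_cast; ring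
  rw [hk, zpow_add, zpow_add, mul_inv, zpow_natCast, zpow_natCast] at h
  simp only [Units.val_mul] at h
  rw [pow_add _ N, pow_add _ M]
  simp only [← Units.val_pow_eq_pow_val]
  have e1 := (w ^ b).mul_inv
  have e2 := (v ^ b).mul_inv
  have e3 := (v ^ (k + 1)).mul_inv
  have e4 := (v ^ N).mul_inv
  have e5 := (w ^ M).mul_inv
  generalize (w ^ b : Rˣ).val = x1, ((w ^ b)⁻¹ : Rˣ).val = y1, (v ^ b : Rˣ).val = x2,
    ((v ^ b)⁻¹ : Rˣ).val = y2, (v ^ (k + 1) : Rˣ).val = x3, ((v ^ (k + 1))⁻¹ : Rˣ).val = y3,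
    (v ^ N : Rˣ).val = x4, ((v ^ N)⁻¹ : Rˣ).val = y4, (w ^ M : Rˣ).val = x5,
    ((w ^ M)⁻¹ : Rˣ).val = y5, (w ^ (k + 1) : Rˣ).val = z at *
  calc q * (x4 * x3) = q * (x4 * x3) * (x1 * y1) * (x5 * y5) := by rw [e1, e5]; ring
    _ = (q * y5 * x1) * (x4 * x3 * y1 * x5) := by ring
    _ = x5 * z * p * (x1 * y1) * (x2 * y2) * (x3 * y3) * (x4 * y4) := by rw [← h]; ring
    _ = x5 * z * p := by rw [e1, e2, e3, e4]; ring

/-- There are no nonzero homomorphisms from a twist of larger degree to one of smaller degree. -/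
lemma homCoeff_eq_zero (hab : b < a) (φ : twist (homogeneousSubmodule (Fin 2) ℂ) a ⟶ twist _ b) :
    homCoeff φ = 0 := by
  obtain ⟨x, hx⟩ := exists_mem_forall_stdOpen
  obtain ⟨q, hq⟩ := exists_coeff φ 1
  obtain ⟨k, rfl⟩ : ∃ k : ℕ, a = b + (k + 1) := ⟨(a - b - 1).toNat, by omega⟩
  obtain ⟨u, hu⟩ := (isGen_twistGen (X_mem (0 : Fin 2)) (b + (k + 1)) (stdOpen 0 ⊓ stdOpen 1)
    inf_le_left).2 (mres _ inf_le_right (lineGen 1 (b + (k + 1))))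
  have hx' : x ∈ (stdOpen 0 ⊓ stdOpen 1 : line.Opens) := ⟨hx 0, hx 1⟩
  have h1 := congrArg (secMap φ _) hu
  simp only [map_smul] at h1
  rw [secMap_mres, secMap_mres, homCoeff_spec, hq] at h1
  have h2 := congrArg (secAt x hx') h1
  have h3 := congrArg (secAt x hx') hu
  obtain ⟨N, P, hP⟩ := exists_eq_stdFraction (0 : Fin 2) (homCoeff φ)
  obtain ⟨M, Q, rfl⟩ := exists_eq_stdFraction (1 : Fin 2) q
  rw [hP] at h2 ⊢
  simp only [secAt_smul, secAt_mres, secAt_twistGen, evalAt_stdFraction] at h2 h3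
  set v := unitAt (hx 0)
  set w := unitAt (hx 1)
  have h4 : evalAt x hx' u = (w ^ (b + (k + 1)) * (v ^ (b + (k + 1)))⁻¹ : (LocalAt
      (homogeneousSubmodule (Fin 2) ℂ) x)ˣ).val := by
    rw [Units.val_mul, ← h3, mul_assoc, Units.mul_inv, mul_one]
  rw [h4] at h2
  have h5 := cross_mul_eq h2
  rw [unitAt_val, unitAt_val, ← map_pow, ← map_pow, ← map_mul, ← map_mul] at h5
  have h6 := valAt_injective x h5
  -- x_1^(M+k+1) divides Q times a power of x_0, hence divides Q, whose degree is only M.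
  have hQ : Q = 0 := by
    by_contra hQ
    have hQ' : Q.1 ≠ 0 := fun h ↦ hQ (Subtype.ext h)
    have h7 : (X 1 : MvPolynomial (Fin 2) ℂ) ^ (M + (k + 1)) ∣ Q.1 := by
      have h8 : Prime (X 1 : MvPolynomial (Fin 2) ℂ) := prime_linear (n := 1)
        (p := ⟨X 1, X_mem 1⟩) fun h ↦ X_ne_zero (R := ℂ) (1 : Fin 2) (congrArg Subtype.val h)
      refine h8.pow_dvd_of_dvd_mul_right _ (fun h ↦ ?_) (Dvd.intro _ h6.symm)
      exact absurd (X_dvd_X.1 (h8.dvd_of_dvd_pow h)) (by simp)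
    have h8 := totalDegree_le_of_dvd_of_isDomain h7 hQ'
    rw [IsHomogeneous.totalDegree Q.2 hQ', totalDegree_X_pow] at h8
    omega
  have hP0 : P = 0 := by
    rw [hQ] at h6
    simpa using h6
  rw [hP0]
  refine fun_ext fun y hy ↦ ?_
  rw [evalAt_stdFraction]
  simp

end TwistHom

/-! ### Isomorphic sums of twists have the same degrees -/

section Multiplicity

variable {ι κ : Type} [Fintype ι] [Fintype κ] {m : ι → ℤ} {m' : κ → ℤ}

/-- The direct sum of twisting sheaves. -/
abbrev twistSum (m : ι → ℤ) : line.Modules := ∐ fun i ↦ twist (homogeneousSubmodule (Fin 2) ℂ) (m i)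

/-- The inclusion of a summand. -/
abbrev twistIncl (m : ι → ℤ) (i : ι) : twist (homogeneousSubmodule (Fin 2) ℂ) (m i) ⟶ twistSum m :=
  Sigma.ι (fun i ↦ twist (homogeneousSubmodule (Fin 2) ℂ) (m i)) i

/-- The projection to a summand. -/
abbrev twistProj [DecidableEq ι] (m : ι → ℤ) (i : ι) :
    twistSum m ⟶ twist (homogeneousSubmodule (Fin 2) ℂ) (m i) :=
  Sigma.π (fun i ↦ twist (homogeneousSubmodule (Fin 2) ℂ) (m i)) i

/-- The matrix entries of an isomorphism and its inverse multiply to the identity, read on the first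
chart. -/
lemma sum_homCoeff_mul [DecidableEq ι] [DecidableEq κ]
    (φ : twistSum m ≅ twistSum m') (i k : ι) :
    ∑ j, homCoeff (twistIncl m i ≫ φ.hom ≫ twistProj m' j) *
      homCoeff (twistIncl m' j ≫ φ.inv ≫ twistProj m k) = if i = k then 1 else 0 := by
  have h1 : ∑ j, twistProj m' j ≫ twistIncl m' j = 𝟙 _ := by
    refine Sigma.hom_ext _ _ fun j ↦ ?_
    rw [Preadditive.comp_sum, Finset.sum_eq_single j]
    · rw [Sigma.ι_π_eq_id_assoc, Category.comp_id]
    · intro l _ hl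
      rw [Sigma.ι_π_of_ne_assoc _ hl.symm, zero_comp]
    · simp
  simp only [← homCoeff_comp]
  have h2 := map_sum (homCoeffHom (m i) (m k)) (fun j ↦
    (twistIncl m i ≫ φ.hom ≫ twistProj m' j) ≫ twistIncl m' j ≫ φ.inv ≫ twistProj m k) Finset.univ
  refine h2.symm.trans ?_
  have h3 : ∑ j, (twistIncl m i ≫ φ.hom ≫ twistProj m' j) ≫ twistIncl m' j ≫ φ.inv ≫ twistProj m k =
      twistIncl m i ≫ twistProj m k := by
    have h4 := congrArg (fun θ ↦ (twistIncl m i ≫ φ.hom) ≫ θ ≫ φ.inv ≫ twistProj m k) h1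
    simp only [Preadditive.comp_sum, Preadditive.sum_comp, Category.id_comp, Category.assoc,
      Iso.hom_inv_id_assoc] at h4 ⊢
    exact h4
  rw [h3]
  split_ifs with h
  · subst h
    rw [Sigma.ι_π_eq_id]
    exact homCoeff_id
  · rw [Sigma.ι_π_of_ne _ h]
    exact map_zero (homCoeffHom _ _)

instance : Nontrivial Γ(line, stdOpen 0) := by
  obtain ⟨x, hx⟩ := exists_mem_forall_stdOpen
  have : Nontrivial (LocalAt (homogeneousSubmodule (Fin 2) ℂ) x) :=
    (valAt_injective x).nontrivial
  exact (evalAt x (hx 0)).domain_nontrivial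

/-- Entries from a degree ≥ t to a degree < t vanish, so the blocks of `φ.hom` and `φ.inv` on
degrees ≥ t still satisfy P Q = 1. Thus P is injective between free modules over a nontrivial
commutative ring, which bounds the rank. -/
lemma card_le_of_iso (φ : twistSum m ≅ twistSum m') (t : ℤ) :
    Fintype.card {i // t ≤ m i} ≤ Fintype.card {j // t ≤ m' j} := by
  classical
  let P : Matrix {i // t ≤ m i} {j // t ≤ m' j} Γ(line, stdOpen 0) := fun i j ↦
    homCoeff (twistIncl m i.1 ≫ φ.hom ≫ twistProj m' j.1)
  let Q : Matrix {j // t ≤ m' j} {i // t ≤ m i} Γ(line, stdOpen 0) := fun j i ↦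
    homCoeff (twistIncl m' j.1 ≫ φ.inv ≫ twistProj m i.1)
  have h : P * Q = 1 := by
    ext i k
    rw [Matrix.mul_apply, Matrix.one_apply]
    simp only [Subtype.ext_iff]
    rw [← sum_homCoeff_mul φ i.1 k.1]
    refine Eq.trans ?_ (Finset.sum_filter_of_ne (p := fun j ↦ t ≤ m' j) fun j _ h ↦ ?_)
    · exact (Finset.sum_subtype (Finset.univ.filter fun j ↦ t ≤ m' j) (by simp) fun j ↦
        homCoeff (twistIncl m i.1 ≫ φ.hom ≫ twistProj m' j) *
          homCoeff (twistIncl m' j ≫ φ.inv ≫ twistProj m k.1)).symm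
    · by_contra hj
      exact h (by rw [homCoeff_eq_zero (by have := i.2; omega), zero_mul])
  refine card_le_of_injective Γ(line, stdOpen 0) P.vecMulLinear ?_
  refine Function.LeftInverse.injective (g := Q.vecMulLinear) fun v ↦ ?_
  simp [h]

lemma card_eq_of_iso (φ : twistSum m ≅ twistSum m') (t : ℤ) :
    Fintype.card {i // t ≤ m i} = Fintype.card {j // t ≤ m' j} :=
  (card_le_of_iso φ t).antisymm (card_le_of_iso φ.symm t)

end Multiplicity

/-! ### Existence and uniqueness of splitting types -/

section SplittingType

lemma card_le_get (b : List ℤ) (t : ℤ) :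
    Fintype.card {i : Fin b.length // t ≤ b.get i} = b.countP (t ≤ ·) := by
  have h : Finset.univ.val.map b.get = b := by simp
  rw [← Multiset.coe_countP, ← h, Multiset.countP_map, Fintype.card_subtype]
  rfl

lemma countP_succ_add_count (b : List ℤ) (t : ℤ) :
    b.countP (t + 1 ≤ ·) + b.count t = b.countP (t ≤ ·) := by
  induction b with
  | nil => rfl
  | cons a b ih =>
    simp only [List.countP_cons, List.count_cons, ← ih]
    simp only [decide_eq_true_eq, beq_iff_eq]
    split_ifs <;> omega

/-- The number of entries equal to t is the difference of those ≥ t and ≥ t + 1, so both lists are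
the same multiset, and both are sorted. -/
theorem IsSplittingType.unique {E : line.Modules} {b c : List ℤ} (hb : IsSplittingType E b)
    (hc : IsSplittingType E c) : b = c := by
  obtain ⟨hb, ⟨φ⟩⟩ := hb
  obtain ⟨hc, ⟨ψ⟩⟩ := hc
  have h (t : ℤ) : b.countP (t ≤ ·) = c.countP (t ≤ ·) := by
    rw [← card_le_get, ← card_le_get]
    exact card_eq_of_iso (φ.symm ≪≫ ψ) t
  refine List.Perm.eq_of_pairwise (fun x y _ _ h1 h2 ↦ le_antisymm h2 h1) hb hc ?_
  rw [List.perm_iff_count]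
  intro t
  have := countP_succ_add_count b t
  have := countP_succ_add_count c t
  have := h t
  have := h (t + 1)
  omega

lemma exists_equiv_of_map_univ_eq {ι κ α : Type} [Fintype ι] [Fintype κ] {f : ι → α} {g : κ → α}
    (h : Finset.univ.val.map f = Finset.univ.val.map g) : ∃ e : ι ≃ κ, ∀ i, g (e i) = f i := by
  classical
  have h1 (a : α) : Fintype.card {i // f i = a} = Fintype.card {j // g j = a} := by
    have := congrArg (Multiset.countP (· = a)) h
    rw [Multiset.countP_map, Multiset.countP_map] at this
    rw [Fintype.card_subtype, Fintype.card_subtype]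
    exact this
  exact ⟨Equiv.ofFiberEquiv fun a ↦ Fintype.equivOfCardEq (h1 a), Equiv.ofFiberEquiv_map _⟩

lemma IsSplittingType.of_iso {E : line.Modules} {ι : Type} [Fintype ι] {m : ι → ℕ} {b : List ℤ}
    (hb : b.Pairwise (· ≥ ·)) (h : Finset.univ.val.map (fun i ↦ (m i : ℤ)) = b)
    (φ : E ≅ ∐ fun i ↦ twist (homogeneousSubmodule (Fin 2) ℂ) (m i)) : IsSplittingType E b := by
  obtain ⟨e, he⟩ := exists_equiv_of_map_univ_eq (f := fun i ↦ (m i : ℤ)) (g := b.get) (by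
    rw [h]; simp)
  exact ⟨hb, ⟨φ ≪≫ Sigma.whiskerEquiv e fun i ↦ eqToIso (by rw [he])⟩⟩

lemma pairwise_replicate_append_replicate {a b : ℤ} (h : b ≤ a) (p q : ℕ) :
    (List.replicate p a ++ List.replicate q b).Pairwise (· ≥ ·) := by
  rw [List.pairwise_append]
  simp [List.pairwise_replicate, h]

end SplittingType

/-- Both the restricted bundle and the sum of twists attached to the Kronecker form are cokernels of
the same pencil. The blocks use 2(n+1), respectively 3 + 2(n-1), dimensions of W; the rest gives the
zeros. -/
theorem isSplittingType_verlindeOnLine {n d : ℕ} (hn : 2 ≤ n)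
    {f : Fin 2 → homogeneousSubmodule (Fin (n + 1)) ℂ d} (hf : LinearIndependent ℂ f) :
    IsSplittingType (verlindeOnLine (d + 1) f hf) (List.replicate (n + 1) 1 ++
      List.replicate ((n + d + 1).choose n - (2 * n + 2)) 0) ∨
    IsSplittingType (verlindeOnLine (d + 1) f hf) (2 :: (List.replicate (n - 1) 1 ++
      List.replicate ((n + d + 1).choose n - (2 * n + 1)) 0)) := by
  have h : ((d : ℤ) + 1) = ((d + 1 : ℕ) : ℤ) := by push_cast; rfl
  rw [h]
  obtain ⟨⟨K⟩⟩ | ⟨⟨K⟩⟩ := exists_kroneckerBasis_mulForm f hf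
  · left
    obtain ⟨u, hu⟩ := K.exists_universal
    obtain ⟨φ⟩ := (isUniversalPencilMap_lineSec hn hf).nonempty_iso hu
    refine IsSplittingType.of_iso (pairwise_replicate_append_replicate zero_le_one _ _) ?_ φ
    rw [← Finset.univ_disjSum_univ, Finset.val_disjSum, Multiset.map_disjSum]
    simp only [Multiset.map_const', Sum.elim_inl, Sum.elim_inr, Finset.card_val, Finset.card_univ,
      Fintype.card_fin, show 2 * (n + 1) = 2 * n + 2 by ring, ← Multiset.coe_add,
      Multiset.coe_replicate, Nat.cast_one, Nat.cast_zero]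
  · right
    obtain ⟨u, hu⟩ := K.exists_universal
    obtain ⟨φ⟩ := (isUniversalPencilMap_lineSec hn hf).nonempty_iso hu
    refine IsSplittingType.of_iso ?_ ?_ φ
    · refine List.pairwise_cons.2 ⟨fun x hx ↦ ?_, pairwise_replicate_append_replicate zero_le_one _ _⟩
      simp only [List.mem_append, List.mem_replicate] at hx
      omega
    · rw [← Finset.univ_disjSum_univ, Finset.val_disjSum, Multiset.map_disjSum,
        ← Finset.univ_disjSum_univ, Finset.val_disjSum, Multiset.map_disjSum]
      simp only [Multiset.map_const', Sum.elim_inl, Sum.elim_inr, Finset.card_val,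
        Finset.card_univ, Fintype.card_fin, show 3 + 2 * (n - 1) = 2 * n + 1 by omega,
        ← Multiset.cons_coe, ← Multiset.coe_add, Multiset.coe_replicate, Nat.cast_one,
        Nat.cast_zero, Nat.cast_ofNat, Fintype.card_unit, Multiset.replicate_one,
        Multiset.singleton_add, Multiset.cons_add]

end Verlinde

end

theorem proposition2p5 (n d : ℕ) (hn : 2 ≤ n) (hd : 1 ≤ d)
    (f : Fin 2 → MvPolynomial.homogeneousSubmodule (Fin (n + 1)) ℂ d)
    (hf : LinearIndependent ℂ f) :
    (∃! b : List ℤ, Verlinde.IsSplittingType (Verlinde.verlindeOnLine (d + 1) f hf) b) ∧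
      ∀ b : List ℤ, Verlinde.IsSplittingType (Verlinde.verlindeOnLine (d + 1) f hf) b →
        b = List.replicate (n + 1) 1 ++
              List.replicate ((n + d + 1).choose n - (2 * n + 2)) 0 ∨
        b = 2 :: (List.replicate (n - 1) 1 ++
              List.replicate ((n + d + 1).choose n - (2 * n + 1)) 0) := by
  have h := Verlinde.isSplittingType_verlindeOnLine hn hf
  refine ⟨?_, fun b hb ↦ h.imp hb.unique hb.unique⟩
  obtain h | h := h
  · exact ⟨_, h, fun c hc ↦ hc.unique h⟩
  · exact ⟨_, h, fun c hc ↦ hc.unique h⟩
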